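/- **Setting.** Let $(X,\|\cdot\|)$ be $\mathbb R^2$ with a norm whose closed unit ball $\mathcal P$ is a quadrilateral. Its boundary consists of four facets $\pm F_1,\pm F_2$, and $\varphi_{F_j}$ denotes the linear functional with $\varphi_{F_j}\le 1$ on $\mathcal P$ and $F_j=\{x\in\mathcal P:\varphi_{F_j}(x)=1\}$. Let $\mathbb Z_2=\{1,-1\}$, let $G=(V,E)$ be a finite simple graph with $V\neq\emptyset$, and let $\theta:\mathbb Z_2\to\operatorname{Aut}(G)$ be a homomorphism that acts freely on $V$; write $-v$ for $\theta(-1)v$. **Frameworks.** A bar-joint framework $(G,p)$ is a map $p:V\to X$ with $p_v\ne p_w$ for all $vw\in E$. It is well-positioned if the rigidity map $f_G:X^V\to\mathbb R^E$, $x\mapsto(\|x_v-x_w\|)_{vw\in E}$, is differentiable at $p$. Given a representation $\tau$ of $\mathbb Z_2$ by linear isometries of $X$, the framework is $\mathbb Z_2$-symmetric if $\tau(-1)p_v=p_{-v}$ for all $v$. An infinitesimal flex of $(G,p)$ is a vector $u\in X^V$ such that the directional derivative of $f_G$ at $p$ along $u$ is $0$. It is symmetric if $\tau(-1)u_v=u_{-v}$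 for all $v$, and trivial if $u_v=\alpha_{p_v}'(0)$ for all $v$, for some family of continuous paths $\alpha_x:[-1,1]\to X$ ($x\in X$), differentiable at $0$, with $\alpha_x(0)=x$ and $\|\alpha_x(t)-\alpha_y(t)\|=\|x-y\|$ for all $x,y,t$. The framework $(G,p)$ is symmetrically infinitesimally rigid if each of its symmetric infinitesimal flexes is trivial, and symmetrically isostatic if, moreover, no proper spanning subframework $(H,p)$, with $H$ invariant under $\theta$, is symmetrically infinitesimally rigid. **Signed quotient graphs.** Choose one representative in each vertex orbit $[v]=\{v,-v\}$. The signed quotient graph $(G_0,\psi)$ is the multigraph $G_0=(V_0,E_0)$ whose vertices and edges are the orbits $[v]$ and $[e]=\{e,-e\}$, where $[vw]$ joins $[v]$ and $[w]$, with gain $\psi_{[e]}=1$ if $e$ or $-e$ joins two chosen representatives and $\psi_{[e]}=-1$ otherwise. In general, a signed quotient graph is a multigraph with gains in $\{1,-1\}$ on its edges such that parallel edges have different gains and loops have gain $-1$. An edge set is balanced if each of its cycles (including loops and pairs of parallel edges) has product of gains $1$. The graph $(G_0,\psi)$ is $(2,2,1)$-gain-tight if $|E_0|=2|V_0|-1$,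 $|F|\le 2|V(F)|-1$ for every nonempty $F\subseteq E_0$, and $|F|\le 2|V(F)|-2$ for every nonempty balanced $F\subseteq E_0$; here $V(F)$ is the set of vertices incident with an edge of $F$. **Moves** (each producing again a signed quotient graph). * *Henneberg 1* (H1a,b,c): add a new vertex $v$ and two edges incident with $v$ that are not both loops (H1a: not parallel and no loop; H1b: parallel, with different gains; H1c: one is a loop). * *Henneberg 2* (H2a,b,c): delete an edge $e=ab$, add a new vertex $v$ and edges $e_1=va$, $e_2=vb$ with $\psi_{e_1}\psi_{e_2}=\psi_e$, and an edge $e_3=vz$ to an old vertex $z$, such that every pair of parallel edges among $e_1,e_2,e_3$ is unbalanced (H2a: $a,b,z$ distinct; H2b: $a\ne b$, $z\in\{a,b\}$; H2c: $e$ is a loop). * *Vertex-to-$K_4$*: replace a vertex $v$ by a copy of $K_4$ with trivial gains; each non-loop edge $xv$ is replaced by an edge $xy$, with the same gain, for some vertex $y$ of the $K_4$; a loop at $v$ is replaced by an edge $yz$ with gain $-1$, where $y,z$ are vertices of the $K_4$, not necessarily distinct. * *Vertex splitting* (edge-to-$K_3$): for an edge $vu$ with gain $1$, replace $v$ by two vertices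 $v_0,v_1$ and $vu$ by the edges $v_0v_1,v_0u,v_1u$ with gain $1$; each other non-loop edge $vw$ is replaced by $v_0w$ or $v_1w$ with the same gain, and a loop at $v$ by a loop at $v_0$ or $v_1$ with gain $-1$. Switching a vertex $v$ means changing the sign of the gains of all non-loop edges incident with $v$, that is, replacing the chosen representative of that orbit. **Theorem (Symmetrically isostatic graphs).** For every choice of representatives, the following are equivalent: (i) There are a representation $\tau:\mathbb Z_2\to\operatorname{Isom}(X)$ by linear isometries, where $\tau(-1)$ is the reflection in the mirror $\ker\varphi_{F_1}$ along $\ker\varphi_{F_2}$ (i.e. $\tau(-1)=I-2P$, $P$ the projection with range $\ker\varphi_{F_2}$ and kernel $\ker\varphi_{F_1}$), and a realisation $p$ such that $(G,p)$ is a well-positioned, $\mathbb Z_2$-symmetric and symmetrically isostatic bar-joint framework in $X$. (ii) $(G_0,\psi)$ is $(2,2,1)$-gain-tight. (iii) $(G_0,\psi)$ can be constructed from a single unbalanced loop by a sequence of H1a,b,c-moves, H2a,b,c-moves, vertex-to-$K_4$ moves and vertex splitting moves, where signed quotient graphs are considered up to isomorphism and switching (i.e. switching operations are allowed between the moves). 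-/

import Mathlib

noncomputable section

namespace GridLike

/-! ### Frameworks in a normed space -/

section Frameworks

variable {X : Type*} [NormedAddCommGroup X] [NormedSpace ℝ X] {V : Type*}

/-- The rigidity map `(x_v) ↦ (‖x_v - x_w‖)_{vw ∈ E}`. -/
def rigidityMap (G : SimpleGraph V) (p : V → X) : G.edgeSet → ℝ := fun e =>
  Sym2.lift ⟨fun v w => ‖p v - p w‖, fun v w => norm_sub_rev (p v) (p w)⟩ e.1

/-- `(G, p)` is a bar-joint framework: adjacent vertices are placed at distinct points. -/
def IsFramework (G : SimpleGraph V) (p : V → X) : Prop :=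
  ∀ v w, G.Adj v w → p v ≠ p w

/-- The rigidity map is differentiable at `p`. -/
def WellPositioned (G : SimpleGraph V) (p : V → X) : Prop :=
  DifferentiableAt ℝ (rigidityMap G) p

/-- The directional derivative of the rigidity map at `p` in the direction `u`, the limit of
`(f_G (p + tu) - f_G p) / t` for `t → 0`, exists and vanishes. -/
def IsInfinitesimalFlex (G : SimpleGraph V) (p u : V → X) : Prop :=
  HasDerivAt (fun t : ℝ => rigidityMap G (p + t • u)) 0 0

/-- A rigid motion of `X`: a family of continuous paths `α x : [-1, 1] → X`, differentiable at
`0`, starting at `x` (at time `0`), and preserving all distances at all times. (Values of `α x`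
outside `[-1, 1]` are irrelevant.) -/
structure IsRigidMotion (α : X → ℝ → X) : Prop where
  continuousOn : ∀ x, ContinuousOn (α x) (Set.Icc (-1) 1)
  differentiableAt : ∀ x, DifferentiableAt ℝ (α x) 0
  start : ∀ x, α x 0 = x
  isometric : ∀ x y, ∀ t ∈ Set.Icc (-1 : ℝ) 1, ‖α x t - α y t‖ = ‖x - y‖

/-- `u` is the trivial infinitesimal flex at `p` induced by a rigid motion. -/
def IsTrivialFlex (p u : V → X) : Prop :=
  ∃ α : X → ℝ → X, IsRigidMotion α ∧ ∀ v, u v = deriv (α (p v)) 0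

variable {G : SimpleGraph V}

/-- `x_{-v} = τ(-1) x_v` for all `v`. Applied to a placement `p` this says that `(G, p)` is
`ℤ₂`-symmetric; applied to a flex `u` it says that `u` is symmetric. -/
def IsSymmetricVec (θ : ℤˣ →* (G ≃g G)) (τ : ℤˣ →* (X ≃ₗᵢ[ℝ] X)) (x : V → X) : Prop :=
  ∀ v, τ (-1) (x v) = x (θ (-1) v)

/-- The subframework `(H, p)` (with vertex set all of `V`) is symmetrically infinitesimally
rigid: each of its symmetric infinitesimal flexes is trivial. -/
def SymInfRigid (θ : ℤˣ →* (G ≃g G)) (τ : ℤˣ →* (X ≃ₗᵢ[ℝ] X))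
    (H : SimpleGraph V) (p : V → X) : Prop :=
  ∀ u : V → X, IsSymmetricVec θ τ u → IsInfinitesimalFlex H p u → IsTrivialFlex p u

/-- `(G, p)` is symmetrically isostatic: it is symmetrically infinitesimally rigid and no
`ℤ₂`-symmetric proper spanning subframework is. -/
def SymIsostatic (θ : ℤˣ →* (G ≃g G)) (τ : ℤˣ →* (X ≃ₗᵢ[ℝ] X))
    (p : V → X) : Prop :=
  SymInfRigid θ τ G p ∧
    ∀ H : SimpleGraph V, H ≤ G → H ≠ G →
      (∀ v w, H.Adj v w ↔ H.Adj (θ (-1) v) (θ (-1) w)) → ¬ SymInfRigid θ τ H p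

/-- `T` is the reflection in the mirror `Z` along the line `W`: `X = Z ⊕ W`, `dim W = 1` and
`T = I - 2P` with `P` the linear projection with range `W` and kernel `Z`. -/
def IsReflection (T : X ≃ₗᵢ[ℝ] X) (Z W : Submodule ℝ X) : Prop :=
  IsCompl Z W ∧ Module.finrank ℝ W = 1 ∧
    ∃ P : X →ₗ[ℝ] X, (∀ x, P (P x) = P x) ∧ LinearMap.range P = W ∧ LinearMap.ker P = Z ∧
      ∀ x, T x = x - (2 : ℝ) • P x

/-- A quadrilateral: the convex hull of four points in convex position. -/
def IsQuadrilateral (P : Set X) : Prop :=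
  ∃ a : Fin 4 → X, ConvexIndependent ℝ a ∧ P = convexHull ℝ (Set.range a)

/-- `φ` is the linear functional of a facet `F` of the planar convex body `P` (with `0` in its
interior): `φ ≤ 1` on `P`, and the face `F = {x ∈ P | φ x = 1}` is not a single point
(and not empty). -/
def IsFacetFunctional (P : Set X) (φ : X →ₗ[ℝ] ℝ) : Prop :=
  (∀ x ∈ P, φ x ≤ 1) ∧ {x ∈ P | φ x = 1}.Nontrivial

end Frameworks

/-! ### Signed quotient graphs -/

/-- A signed quotient graph with vertex set `W` and edge set `E`: a multigraph whose edges carry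
a gain in `ℤˣ = {1, -1}`, such that distinct parallel edges have different gains and every loop
has gain `-1`. -/
structure SignedGraph (W E : Type*) where
  ends : E → Sym2 W
  gain : E → ℤˣ
  gain_ne_of_parallel : ∀ e f, e ≠ f → ends e = ends f → gain e ≠ gain f
  gain_of_loop : ∀ e, (ends e).IsDiag → gain e = -1

namespace SignedGraph

section Sparsity

variable {W E : Type*} (S : SignedGraph W E)

/-- The set `V(F)` of vertices incident with an edge in `F`. -/
def support (F : Finset E) : Set W := {w | ∃ e ∈ F, w ∈ S.ends e}

/-- Distinct vertices `x 0, …, x n` and distinct edges `c 0, …, c n` form a cycle, `c i` joining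
`x i` to `x (i + 1)`, with indices modulo `n + 1`. (For `n = 0` this is a loop, for `n = 1` a
pair of parallel edges.) -/
def IsCycle {n : ℕ} (x : Fin (n + 1) → W) (c : Fin (n + 1) → E) : Prop :=
  Function.Injective x ∧ Function.Injective c ∧ ∀ i, S.ends (c i) = s(x i, x (i + 1))

/-- `F` is balanced: every cycle of edges in `F` has gain `1`. -/
def Balanced (F : Finset E) : Prop :=
  ∀ (n : ℕ) (x : Fin (n + 1) → W) (c : Fin (n + 1) → E),
    S.IsCycle x c → (∀ i, c i ∈ F) → ∏ i, S.gain (c i) = 1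

/-- `(2,2,1)`-gain-sparsity. -/
def GainSparse : Prop :=
  (∀ F : Finset E, F.Nonempty → S.Balanced F →
    (F.card : ℤ) ≤ 2 * ((S.support F).ncard : ℤ) - 2) ∧
  (∀ F : Finset E, F.Nonempty → (F.card : ℤ) ≤ 2 * ((S.support F).ncard : ℤ) - 1)

/-- `(2,2,1)`-gain-tightness. -/
def GainTight : Prop :=
  S.GainSparse ∧ (Nat.card E : ℤ) = 2 * (Nat.card W : ℤ) - 1

end Sparsity

section Moves

variable {W E W' E' : Type*}

/-- A single vertex with a single (hence unbalanced) loop. -/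
def IsSingleLoop (S : SignedGraph W E) : Prop :=
  ∃ (v : W) (e : E), (∀ w, w = v) ∧ (∀ f, f = e) ∧ S.ends e = s(v, v)

open Classical in
/-- `S'` is obtained from `S` by switching the vertex `v` (replacing the orbit representative at
`v` by the other vertex of the orbit): the gains of the edges joining `v` to other vertices
change sign. -/
def IsSwitching (S S' : SignedGraph W E) : Prop :=
  ∃ v : W, ∀ e, S'.ends e = S.ends e ∧
    S'.gain e = if v ∈ S.ends e ∧ ¬ (S.ends e).IsDiag then - S.gain e else S.gain e

/-- `S'` is obtained from `S` by a Henneberg 1 move: a new vertex `v` and two new edges incident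
with `v`, not both loops. The move is H1a if `e₁`, `e₂` are neither parallel nor loops, H1b if
they are parallel (the gains then differ since `S'` is a signed quotient graph), and H1c if one
of them is a loop. -/
def IsH1 (S : SignedGraph W E) (S' : SignedGraph W' E') : Prop :=
  ∃ (i : W ↪ W') (j : E ↪ E') (v : W') (e₁ e₂ : E'),
    e₁ ≠ e₂ ∧ Set.range i = {v}ᶜ ∧ Set.range j = {e₁, e₂}ᶜ ∧
    (∀ e, S'.ends (j e) = (S.ends e).map i ∧ S'.gain (j e) = S.gain e) ∧
    v ∈ S'.ends e₁ ∧ v ∈ S'.ends e₂ ∧ ¬ ((S'.ends e₁).IsDiag ∧ (S'.ends e₂).IsDiag)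

/-- `S'` is obtained from `S` by a Henneberg 2 move: the edge `e = ab` is deleted and replaced by
`e₁ = va`, `e₂ = vb`, where `v` is a new vertex and the product of the new gains is the gain of
`e`; a third new edge `e₃` joins `v` to an old vertex `z`. Since `S'` is a signed quotient graph,
parallel edges among the `eᵢ` have different gains, that is, form unbalanced 2-cycles. The move
is H2a if `a, b, z` are distinct, H2b if `a ≠ b` and `z ∈ {a, b}`, and H2c if `a = b`. -/
def IsH2 (S : SignedGraph W E) (S' : SignedGraph W' E') : Prop :=
  ∃ (e : E) (a b z : W) (i : W ↪ W') (j : {f : E // f ≠ e} ↪ E') (v : W') (e₁ e₂ e₃ : E'),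
    e₁ ≠ e₂ ∧ e₁ ≠ e₃ ∧ e₂ ≠ e₃ ∧ Set.range i = {v}ᶜ ∧ Set.range j = {e₁, e₂, e₃}ᶜ ∧
    (∀ f, S'.ends (j f) = (S.ends f.1).map i ∧ S'.gain (j f) = S.gain f.1) ∧
    S.ends e = s(a, b) ∧ S'.ends e₁ = s(v, i a) ∧ S'.ends e₂ = s(v, i b) ∧
    S'.gain e₁ * S'.gain e₂ = S.gain e ∧ S'.ends e₃ = s(v, i z)

/-- `π : W' → W` collapses a set of `k` vertices of `W'` to the vertex `v`, and is bijective
elsewhere. -/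
def IsCollapse (π : W' → W) (v : W) (k : ℕ) : Prop :=
  (π ⁻¹' {v}).ncard = k ∧ ∀ w, w ≠ v → ∃! w', π w' = w

/-- `S'` is obtained from `S` by a vertex-to-`K₄` move at `v`. The map `π` sends the four new
vertices to `v` and identifies the remaining vertices of `S'` with those of `S`; `j` sends each
edge of `S` to the edge that stays or replaces it, with the same gain. In particular an edge `xv`
is replaced by an edge `xy` with `y` one of the four new vertices, and a loop at `v` by an edge
`yz` with gain `-1`, where `y, z` are new vertices, possibly equal. The other edges of `S'` are
those of a complete graph with trivial gains on the new vertices. -/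
def IsVertexToK4 (S : SignedGraph W E) (S' : SignedGraph W' E') : Prop :=
  ∃ (v : W) (π : W' → W) (j : E ↪ E'),
    IsCollapse π v 4 ∧
    (∀ e, (S'.ends (j e)).map π = S.ends e ∧ S'.gain (j e) = S.gain e) ∧
    (∀ f ∉ Set.range j, ∃ y z, y ≠ z ∧ π y = v ∧ π z = v ∧ S'.ends f = s(y, z) ∧
      S'.gain f = 1) ∧
    (∀ y z, y ≠ z → π y = v → π z = v → ∃ f ∉ Set.range j, S'.ends f = s(y, z))

/-- `S'` is obtained from `S` by an edge-to-`K₃` move (vertex splitting) at `v`. Here `e₀ = vu`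
has trivial gain, `π` sends the two new vertices `v₀, v₁` to `v` and identifies the remaining
vertices of `S'` with those of `S`; `j` sends each edge of `S` to the edge that stays or replaces
it, with the same gain, where a loop is replaced by a loop and `e₀` by `v₀u`. The edges of `S'`
outside the range of `j` are `v₀v₁` and `v₁u`, with trivial gains. -/
def IsVertexSplitting (S : SignedGraph W E) (S' : SignedGraph W' E') : Prop :=
  ∃ (v u : W) (e₀ : E) (π : W' → W) (j : E ↪ E') (v₀ v₁ u' : W') (f₁ f₂ : E'),
    S.ends e₀ = s(v, u) ∧ S.gain e₀ = 1 ∧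
    IsCollapse π v 2 ∧ v₀ ≠ v₁ ∧ π v₀ = v ∧ π v₁ = v ∧ π u' = u ∧
    (∀ e, (S'.ends (j e)).map π = S.ends e ∧ S'.gain (j e) = S.gain e ∧
      ((S.ends e).IsDiag → (S'.ends (j e)).IsDiag)) ∧
    S'.ends (j e₀) = s(v₀, u') ∧
    f₁ ≠ f₂ ∧ Set.range j = {f₁, f₂}ᶜ ∧
    S'.ends f₁ = s(v₀, v₁) ∧ S'.gain f₁ = 1 ∧ S'.ends f₂ = s(v₁, u') ∧ S'.gain f₂ = 1

end Moves

universe u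

/-- `S` can be constructed from a single unbalanced loop by a sequence of H1a,b,c-moves,
H2a,b,c-moves, vertex-to-`K₄` moves and vertex splitting moves, where signed quotient graphs are
considered up to switching. -/
inductive Constructible : ∀ {W E : Type u}, SignedGraph W E → Prop
  | loop {W E : Type u} {S : SignedGraph W E} : S.IsSingleLoop → Constructible S
  | switching {W E : Type u} {S S' : SignedGraph W E} :
      Constructible S → S.IsSwitching S' → Constructible S'
  | henneberg1 {W E W' E' : Type u} {S : SignedGraph W E} {S' : SignedGraph W' E'} :
      Constructible S → S.IsH1 S' → Constructible S'
  | henneberg2 {W E W' E' : Type u} {S : SignedGraph W E} {S' : SignedGraph W' E'} :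
      Constructible S → S.IsH2 S' → Constructible S'
  | vertexToK4 {W E W' E' : Type u} {S : SignedGraph W E} {S' : SignedGraph W' E'} :
      Constructible S → S.IsVertexToK4 S' → Constructible S'
  | vertexSplitting {W E W' E' : Type u} {S : SignedGraph W E} {S' : SignedGraph W' E'} :
      Constructible S → S.IsVertexSplitting S' → Constructible S'

end SignedGraph

/-! ### The signed quotient graph of a `ℤ₂`-symmetric graph -/

section Quotient

variable {V : Type*} {G : SimpleGraph V}

/-- The orbit relation on vertices. -/
def vertexSetoid (θ : ℤˣ →* (G ≃g G)) : Setoid V where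
  r v w := ∃ γ : ℤˣ, θ γ v = w
  iseqv :=
    { refl := fun v => ⟨1, by simp⟩
      symm := by
        rintro v w ⟨γ, rfl⟩
        exact ⟨γ⁻¹, by rw [← RelIso.mul_apply, ← map_mul]; simp⟩
      trans := by
        rintro u v w ⟨γ, rfl⟩ ⟨δ, rfl⟩
        exact ⟨δ * γ, by rw [map_mul, RelIso.mul_apply]⟩ }

/-- The orbit relation on edges. -/
def edgeSetoid (θ : ℤˣ →* (G ≃g G)) : Setoid G.edgeSet where
  r e f := ∃ γ : ℤˣ, e.1.map (θ γ) = f.1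
  iseqv :=
    { refl := fun e => ⟨1, by
        have : (⇑(θ 1) : V → V) = id := by ext v; simp
        rw [this, Sym2.map_id, id]⟩
      symm := by
        rintro e f ⟨γ, h⟩
        refine ⟨γ⁻¹, ?_⟩
        rw [← h, Sym2.map_map]
        have : (⇑(θ γ⁻¹) ∘ ⇑(θ γ) : V → V) = id := by
          ext v; rw [Function.comp, ← RelIso.mul_apply, ← map_mul]; simp
        rw [this, Sym2.map_id, id]
      trans := by
        rintro e f g ⟨γ, h⟩ ⟨δ, k⟩
        refine ⟨δ * γ, ?_⟩
        rw [← k, ← h, Sym2.map_map]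
        congr 1
        ext v; rw [map_mul, RelIso.mul_apply]; rfl }

/-- The set `V₀` of vertex orbits. -/
abbrev VertexOrbit (θ : ℤˣ →* (G ≃g G)) := Quotient (vertexSetoid θ)

/-- The set `E₀` of edge orbits. -/
abbrev EdgeOrbit (θ : ℤˣ →* (G ≃g G)) := Quotient (edgeSetoid θ)

/-- The orbit `[v]` of a vertex. -/
abbrev vertexOrbit (θ : ℤˣ →* (G ≃g G)) (v : V) : VertexOrbit θ := Quotient.mk (vertexSetoid θ) v

/-- The orbit `[e]` of an edge. -/
abbrev edgeOrbit (θ : ℤˣ →* (G ≃g G)) (e : G.edgeSet) : EdgeOrbit θ :=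
  Quotient.mk (edgeSetoid θ) e

/-- `R` is a choice of representatives for the vertex orbits. -/
def IsRepresentatives (θ : ℤˣ →* (G ≃g G)) (R : Set V) : Prop :=
  ∀ q : VertexOrbit θ, ∃! v, v ∈ R ∧ vertexOrbit θ v = q

/-- The pair of vertex orbits with which an edge orbit is incident. -/
def orbitEnds (θ : ℤˣ →* (G ≃g G)) : EdgeOrbit θ → Sym2 (VertexOrbit θ) :=
  Quotient.lift (fun e => e.1.map (vertexOrbit θ)) (by
    rintro e f ⟨γ, h⟩
    rw [← h, Sym2.map_map]
    congr 1
    ext v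
    exact Quotient.sound ⟨γ, rfl⟩)

open Classical in
/-- The gain of `[e]` induced by the representatives `R`: it is `1` if an edge in the orbit has
both end-vertices in `R`, and `-1` otherwise. -/
def orbitGain (θ : ℤˣ →* (G ≃g G)) (R : Set V) (q : EdgeOrbit θ) : ℤˣ :=
  if ∃ e : G.edgeSet, edgeOrbit θ e = q ∧ ∀ v ∈ e.1, v ∈ R then 1 else -1

theorem act_act (θ : ℤˣ →* (G ≃g G)) (γ δ : ℤˣ) (v : V) : θ γ (θ δ v) = θ (γ * δ) v := by
  rw [map_mul, RelIso.mul_apply]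

theorem vertexOrbit_act (θ : ℤˣ →* (G ≃g G)) (γ : ℤˣ) (v : V) :
    vertexOrbit θ (θ γ v) = vertexOrbit θ v :=
  (Quotient.sound (s := vertexSetoid θ) ⟨γ, rfl⟩ : vertexOrbit θ v = vertexOrbit θ (θ γ v)).symm

/-- Every edge orbit contains an edge `v (γ w)` with `v, w` representatives and `γ` the gain of
the edge orbit. -/
theorem exists_normal_form (θ : ℤˣ →* (G ≃g G)) {R : Set V} (hR : IsRepresentatives θ R)
    (q : EdgeOrbit θ) : ∃ v ∈ R, ∃ w ∈ R, ∃ f : G.edgeSet,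
      f.1 = s(v, θ (orbitGain θ R q) w) ∧ edgeOrbit θ f = q ∧
      orbitEnds θ q = s(vertexOrbit θ v, vertexOrbit θ w) := by
  by_cases h : ∃ e : G.edgeSet, edgeOrbit θ e = q ∧ ∀ v ∈ e.1, v ∈ R
  · have hg : orbitGain θ R q = 1 := if_pos h
    obtain ⟨⟨e, he⟩, rfl, hr⟩ := h
    induction e using Sym2.inductionOn with
    | hf a b =>
      exact ⟨a, hr a (Sym2.mem_mk_left a b), b, hr b (Sym2.mem_mk_right a b), ⟨s(a, b), he⟩,
        by rw [hg, map_one, RelIso.one_apply], rfl, rfl⟩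
  · have hg : orbitGain θ R q = -1 := if_neg h
    obtain ⟨⟨e, he⟩, rfl⟩ := Quotient.exists_rep q
    induction e using Sym2.inductionOn with
    | hf a b =>
      obtain ⟨v, ⟨hv, hva⟩, -⟩ := hR (vertexOrbit θ a)
      obtain ⟨w, ⟨hw, hwb⟩, -⟩ := hR (vertexOrbit θ b)
      obtain ⟨α, rfl⟩ := Quotient.exact hva
      obtain ⟨β, rfl⟩ := Quotient.exact hwb
      have hab : G.Adj (θ α v) (θ β w) := he
      have hadj : G.Adj v (θ (α⁻¹ * β) w) := by
        have := (θ α⁻¹).map_rel_iff.2 hab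
        simpa only [act_act, inv_mul_cancel, map_one, RelIso.one_apply] using this
      have horb : edgeOrbit θ ⟨s(v, θ (α⁻¹ * β) w), hadj⟩ =
          Quotient.mk (edgeSetoid θ) ⟨s(θ α v, θ β w), he⟩ := by
        refine Quotient.sound ⟨α, ?_⟩
        simp only [Sym2.map_mk, act_act, mul_inv_cancel_left]
      have hγ : α⁻¹ * β = -1 := by
        rcases Int.units_eq_one_or (α⁻¹ * β) with h1 | h1
        · refine absurd ⟨_, horb, ?_⟩ h
          intro x hx
          have hx : x ∈ s(v, θ (α⁻¹ * β) w) := hx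
          rw [h1, map_one, RelIso.one_apply] at hx
          rcases Sym2.mem_iff.1 hx with rfl | rfl
          exacts [hv, hw]
        · exact h1
      refine ⟨v, hv, w, hw, ⟨s(v, θ (α⁻¹ * β) w), hadj⟩, ?_, horb, ?_⟩
      · change s(v, θ (α⁻¹ * β) w) = _
        rw [hg, hγ]
      change s(vertexOrbit θ (θ α v), vertexOrbit θ (θ β w)) = _
      rw [vertexOrbit_act, vertexOrbit_act]

/-- The signed quotient graph `(G₀, ψ)` of `(G, θ)` with the gain `ψ` induced by the choice `R` of
vertex orbit representatives. -/
def signedQuotient (θ : ℤˣ →* (G ≃g G)) (R : Set V) (hR : IsRepresentatives θ R) :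
    SignedGraph (VertexOrbit θ) (EdgeOrbit θ) where
  ends := orbitEnds θ
  gain := orbitGain θ R
  gain_ne_of_parallel := by
    intro q q' hne hends hgain
    obtain ⟨v, hv, w, hw, f, hf, hfq, hq⟩ := exists_normal_form θ hR q
    obtain ⟨v', hv', w', hw', f', hf', hfq', hq'⟩ := exists_normal_form θ hR q'
    rw [← hgain] at hf'
    have huniq : ∀ x ∈ R, ∀ y ∈ R, vertexOrbit θ x = vertexOrbit θ y → x = y :=
      fun x hx y hy hxy => (hR (vertexOrbit θ y)).unique ⟨hx, hxy⟩ ⟨hy, rfl⟩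
    apply hne
    rw [← hfq, ← hfq']
    rw [hq, hq', Sym2.eq_iff] at hends
    rcases hends with ⟨h1, h2⟩ | ⟨h1, h2⟩
    · obtain rfl := huniq v hv v' hv' h1
      obtain rfl := huniq w hw w' hw' h2
      rw [Subtype.ext (hf.trans hf'.symm)]
    · obtain rfl := huniq v hv w' hw' h1
      obtain rfl := huniq w hw v' hv' h2
      refine Quotient.sound ⟨orbitGain θ R q, ?_⟩
      rw [hf, hf', Sym2.map_mk, act_act, Int.units_mul_self, map_one, RelIso.one_apply,
        Sym2.eq_swap]
  gain_of_loop := by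
    intro q hq
    obtain ⟨v, hv, w, hw, f, hf, -, hvw⟩ := exists_normal_form θ hR q
    rw [hvw, Sym2.mk_isDiag_iff] at hq
    obtain rfl := (hR (vertexOrbit θ w)).unique ⟨hv, hq⟩ ⟨hw, rfl⟩
    rcases Int.units_eq_one_or (orbitGain θ R q) with h1 | h1
    · rw [h1, map_one, RelIso.one_apply] at hf
      have hadj : G.Adj v v := by
        rw [← SimpleGraph.mem_edgeSet, ← hf]
        exact f.2
      exact absurd rfl (G.ne_of_adj hadj)
    · exact h1

end Quotient

end GridLike

end

/-!
A norm on the plane whose unit ball is a quadrilateral is, in the coordinates `φ₁`, `φ₂`, the maximum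
norm (`IsQuadrilateral.isMaxNorm`), and the reflection is `(ξ, η) ↦ (-ξ, η)`. A framework is
well-positioned if no edge lies in a diagonal direction (`IsMaxNorm.isGeneral_iff`). An edge whose
first coordinate dominates forces the flex to have equal first coordinates at its ends, any other
edge does so for the second coordinate, and the trivial flexes are the translations. In terms of
orbit representatives, a symmetric flex is a pair of functions `(u₁, u₂)` on the signed quotient
graph. Each edge orbit with ends `a`, `b` and gain `g` imposes either `u₁ a = g u₁ b` or
`u₂ a = u₂ b`. Rigidity means that `u₁ = 0` and that `u₂` is constant (`IsLift.symInfRigid_iff`).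

*Isostatic implies gain-tight* (`IsRigid.gainTight`). In a minimally rigid framework the constraints
are independent. The edges within a vertex set `U` therefore number at most `2 |U|` minus the
dimension of the space of flexes on `U`. The flexes always contain the translations of the second
coordinate. A balanced edge set has a potential, which is a further flex, in the first coordinate.

*Gain-tight implies constructible* (`GainTight.constructible`). By induction on the number of
vertices, it is enough to undo one move. Since `|E| < 2 |W|`, some vertex has degree at most two,
and an inverse Henneberg 1 move applies, or it has three edges and no loop. In the second case the
tight sets that obstruct the three possible inverse Henneberg 2 moves can be combined by uncrossing
arguments (`Sparse.union_unbalanced`, `Sparse.union_balanced_right`, `Sparse.union_balanced`). It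
follows that a Henneberg 2 move can be undone unless the vertex and its neighbours form a balanced
`K₄` (`IsClaw.exists_not_blocks_or_isK4`). A balanced `K₄` can be contracted to a vertex unless an
outside vertex is attached to one of its edges by a balanced triangle. If it is, one takes a maximal
balanced tight set with such an attached triangle, and contracts an edge of the triangle that joins
the outside vertex to the tight set. By maximality this undoes a vertex splitting
(`Tight.constructible_of_hasAttachedTriangle`).

*Constructible implies isostatic* (`Constructible.isRealizable`). The single loop is realised by an
edge orthogonal to the mirror, and each move can be realised geometrically. For a Henneberg 1 move
the new vertex is placed such that one new edge constrains the first and the other one the second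
coordinate. For a Henneberg 2 move it is placed on the line through the ends of the deleted edge,
and for the other two moves a vertex is replaced by a small cluster of vertices. The resulting rigid
framework has at most `2 |W| - 1` edge orbits, and a rigid framework needs at least that many
(`IsRigid.two_mul_card_le`), so no edge orbit is redundant.
-/

noncomputable section

namespace GridLike

open Filter Topology

namespace SignedGraph

/-! ### Potentials and balance -/

section Potentials

variable {W E : Type*} (S : SignedGraph W E)

/-- All end-vertices of edges in `F` lie in `U`. -/
def Within (U : Finset W) (F : Finset E) : Prop :=
  ∀ e ∈ F, ∀ w ∈ S.ends e, w ∈ U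

/-- `s` is a potential for `F`: switching the vertices `w` with `s w = -1` makes all gains on `F`
trivial. -/
def IsPotential (s : W → ℤˣ) (F : Finset E) : Prop :=
  ∀ e ∈ F, ∀ a b, S.ends e = s(a, b) → S.gain e = s a * s b

/-- `(2,2,1)`-gain-sparsity, expressed through pairs of a nonempty vertex set and a possibly
empty edge set within it, and with potentials in place of cycles. -/
def Sparse : Prop :=
  ∀ (U : Finset W) (F : Finset E), U.Nonempty → S.Within U F →
    F.card + 1 ≤ 2 * U.card ∧ ((∃ s, S.IsPotential s F) → F.card + 2 ≤ 2 * U.card)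

variable {S}

theorem Within.mono {U U' : Finset W} {F F' : Finset E} (h : S.Within U F) (hU : U ⊆ U')
    (hF : F' ⊆ F) : S.Within U' F' :=
  fun e he w hw => hU (h e (hF he) w hw)

theorem IsPotential.mono {s : W → ℤˣ} {F F' : Finset E} (h : S.IsPotential s F)
    (hF : F' ⊆ F) : S.IsPotential s F' :=
  fun e he => h e (hF he)

/-- It suffices to check a potential for one orientation of each edge. -/
theorem isPotential_edge {s : W → ℤˣ} {e : E} {a b : W} (he : S.ends e = s(a, b))
    (hg : S.gain e = s a * s b) (c d : W) (h : S.ends e = s(c, d)) : S.gain e = s c * s d := by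
  rw [he, Sym2.eq_iff] at h
  rcases h with ⟨rfl, rfl⟩ | ⟨rfl, rfl⟩
  · exact hg
  · rw [hg, mul_comm]

theorem within_union [DecidableEq W] [DecidableEq E] {U U' : Finset W} {F F' : Finset E}
    (h : S.Within U F) (h' : S.Within U' F') : S.Within (U ∪ U') (F ∪ F') := by
  intro e he w hw
  rcases Finset.mem_union.1 he with he | he
  · exact Finset.mem_union_left _ (h e he w hw)
  · exact Finset.mem_union_right _ (h' e he w hw)

theorem within_inter [DecidableEq W] [DecidableEq E] {U U' : Finset W} {F F' : Finset E}
    (h : S.Within U F) (h' : S.Within U' F') : S.Within (U ∩ U') (F ∩ F') := by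
  intro e he w hw
  rw [Finset.mem_inter] at he ⊢
  exact ⟨h e he.1 w hw, h' e he.2 w hw⟩

theorem within_insert [DecidableEq E] {U : Finset W} {F : Finset E} {e : E} {a b : W}
    (h : S.Within U F) (he : S.ends e = s(a, b)) (ha : a ∈ U) (hb : b ∈ U) :
    S.Within U (insert e F) := by
  intro f hf w hw
  rcases Finset.mem_insert.1 hf with rfl | hf
  · rw [he, Sym2.mem_iff] at hw
    rcases hw with rfl | rfl <;> assumption
  · exact h f hf w hw

theorem Within.mem_left {U : Finset W} {F : Finset E} (h : S.Within U F) {e : E} (he : e ∈ F)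
    {a b : W} (hab : S.ends e = s(a, b)) : a ∈ U :=
  h e he a (by rw [hab]; exact Sym2.mem_mk_left a b)

theorem Within.mem_right {U : Finset W} {F : Finset E} (h : S.Within U F) {e : E} (he : e ∈ F)
    {a b : W} (hab : S.ends e = s(a, b)) : b ∈ U :=
  h e he b (by rw [hab]; exact Sym2.mem_mk_right a b)

theorem IsPotential.insert [DecidableEq E] {s : W → ℤˣ} {F : Finset E} {e : E} {a b : W}
    (h : S.IsPotential s F) (he : S.ends e = s(a, b)) (hg : S.gain e = s a * s b) :
    S.IsPotential s (insert e F) := by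
  intro f hf c d hcd
  rcases Finset.mem_insert.1 hf with rfl | hf
  · exact isPotential_edge he hg c d hcd
  · exact h f hf c d hcd

theorem IsPotential.congr {s t : W → ℤˣ} {F : Finset E} {U : Finset W} (h : S.IsPotential s F)
    (hU : S.Within U F) (hst : ∀ u ∈ U, t u = s u) : S.IsPotential t F := by
  intro f hf c d hcd
  rw [h f hf c d hcd, hst c (hU.mem_left hf hcd), hst d (hU.mem_right hf hcd)]

theorem IsPotential.smul {s : W → ℤˣ} {F : Finset E} (h : S.IsPotential s F) (ε : ℤˣ) :
    S.IsPotential (fun u => ε * s u) F := by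
  intro f hf c d hcd
  rw [h f hf c d hcd, mul_mul_mul_comm, Int.units_mul_self, one_mul]

theorem units_eq_of_ne {a b c : ℤˣ} (h : a ≠ c) (h' : b ≠ c) : a = b := by
  rcases Int.units_eq_one_or a with rfl | rfl <;> rcases Int.units_eq_one_or b with rfl | rfl <;>
    rcases Int.units_eq_one_or c with rfl | rfl <;> simp_all

theorem units_mul_eq {a b c : ℤˣ} (h : a * b = c) : a = c * b := by
  rw [← h, mul_assoc, Int.units_mul_self, mul_one]

/-- A potential for `F` forces all cycles in `F` to have gain `1`. -/
theorem IsPotential.balanced {s : W → ℤˣ} {F : Finset E} (h : S.IsPotential s F) :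
    S.Balanced F := by
  intro n x c hc hF
  have h1 : ∀ i, S.gain (c i) = s (x i) * s (x (i + 1)) :=
    fun i => h _ (hF i) _ _ (hc.2.2 i)
  rw [Finset.prod_congr rfl (fun i _ => h1 i), Finset.prod_mul_distrib,
    Fintype.prod_equiv (Equiv.addRight (1 : Fin (n + 1))) (fun i => s (x (i + 1)))
      (fun i => s (x i)) (fun i => rfl), Int.units_mul_self]

/-- The simple graph underlying an edge set. -/
def simpleGraph (F : Finset E) : SimpleGraph W where
  Adj u w := u ≠ w ∧ ∃ f ∈ F, S.ends f = s(u, w)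
  symm := ⟨fun u w ⟨h, f, hf, hfe⟩ => ⟨h.symm, f, hf, by rw [hfe, Sym2.eq_swap]⟩⟩
  loopless := ⟨fun u h => h.1 rfl⟩

/-- A path in `F` closed up by an edge outside of `F` is a cycle, so it has gain `1` if
everything is balanced. -/
theorem gain_eq_of_reachable [DecidableEq E] {s : W → ℤˣ} {F : Finset E}
    (hs : S.IsPotential s F) {e : E} (heF : e ∉ F) (hb : S.Balanced (insert e F)) {a b : W}
    (he : S.ends e = s(a, b)) (hr : (S.simpleGraph F).Reachable b a) :
    S.gain e = s a * s b := by
  classical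
  obtain ⟨p, hp⟩ := hr.exists_isPath
  obtain ⟨n, hn⟩ : ∃ n, n = p.length := ⟨_, rfl⟩
  have hadj : ∀ i, i < n → ∃ f ∈ F, S.ends f = s(p.getVert i, p.getVert (i + 1)) :=
    fun i hi => (p.adj_getVert_succ (hn ▸ hi)).2
  choose f hfF hf using hadj
  let x : Fin (n + 1) → W := fun i => p.getVert i
  let c : Fin (n + 1) → E := fun i => if h : (i : ℕ) < n then f i h else e
  have hx : Function.Injective x := by
    intro i j hij
    exact Fin.ext (hp.getVert_injOn (hn ▸ Nat.lt_succ_iff.1 i.2) (hn ▸ Nat.lt_succ_iff.1 j.2) hij)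
  have hsucc : ∀ i : Fin (n + 1), (i : ℕ) < n → ((i + 1 : Fin (n + 1)) : ℕ) = i + 1 :=
    fun i hi => by rw [Fin.val_add_one]; rw [if_neg]; rintro rfl; simp at hi
  have hlast : ∀ i : Fin (n + 1), ¬ (i : ℕ) < n → i = Fin.last n :=
    fun i hi => Fin.ext (by have := i.2; simp; omega)
  have hends : ∀ i, S.ends (c i) = s(x i, x (i + 1)) := by
    intro i
    by_cases hi : (i : ℕ) < n
    · simp only [c, x, dif_pos hi, hsucc i hi, hf]
    · obtain rfl := hlast i hi
      simp only [c, x, dif_neg hi, Fin.last_add_one, Fin.val_last, Fin.val_zero, he]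
      rw [hn, SimpleGraph.Walk.getVert_length, SimpleGraph.Walk.getVert_zero]
  have hc : Function.Injective c := by
    intro i j hij
    by_cases hi : (i : ℕ) < n <;> by_cases hj : (j : ℕ) < n
    · have h1 := hends i
      rw [hij, hends j, Sym2.eq_iff] at h1
      rcases h1 with ⟨h1, -⟩ | ⟨h1, h2⟩
      · exact (hx h1).symm
      · have h1 := congrArg Fin.val (hx h1)
        have h2 := congrArg Fin.val (hx h2)
        rw [hsucc i hi] at h1
        rw [hsucc j hj] at h2
        omega
    · simp only [c, dif_pos hi, dif_neg hj] at hij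
      exact absurd (hij ▸ hfF i hi) heF
    · simp only [c, dif_neg hi, dif_pos hj] at hij
      exact absurd (hij ▸ hfF j hj) heF
    · rw [hlast i hi, hlast j hj]
  have hprod := hb n x c ⟨hx, hc, hends⟩ (fun i => by
    by_cases hi : (i : ℕ) < n
    · simp only [c, dif_pos hi]; exact Finset.mem_insert_of_mem (hfF _ _)
    · simp only [c, dif_neg hi]; exact Finset.mem_insert_self _ _)
  have hall : ∏ i, s (x i) * s (x (i + 1)) = 1 := by
    rw [Finset.prod_mul_distrib,
      Fintype.prod_equiv (Equiv.addRight (1 : Fin (n + 1))) (fun i => s (x (i + 1)))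
      (fun i => s (x i)) (fun i => rfl), Int.units_mul_self]
  rw [Fin.prod_univ_castSucc] at hprod hall
  have h1 : ∀ i : Fin n, S.gain (c i.castSucc) = s (x i.castSucc) * s (x (i.castSucc + 1)) := by
    intro i
    refine hs _ ?_ _ _ (hends _)
    have hi : ((i.castSucc : Fin (n + 1)) : ℕ) < n := i.2
    simp only [c, dif_pos hi]
    exact hfF _ _
  rw [Finset.prod_congr rfl (fun i _ => h1 i)] at hprod
  have h2 := mul_left_cancel (hprod.trans hall.symm)
  have h3 : c (Fin.last n) = e := by simp [c]
  rw [h3] at h2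
  rw [h2]
  simp [x, hn]

/-- A balanced edge set has a potential. -/
theorem Balanced.exists_isPotential {F : Finset E} (hb : S.Balanced F) :
    ∃ s, S.IsPotential s F := by
  classical
  induction F using Finset.induction_on with
  | empty => exact ⟨fun _ => 1, by simp [IsPotential]⟩
  | insert e F heF ih =>
    obtain ⟨s, hs⟩ := ih (fun n x c hc h => hb n x c hc fun i => Finset.mem_insert_of_mem (h i))
    obtain ⟨⟨a, b⟩, hab⟩ := Quot.exists_rep (S.ends e)
    replace hab : S.ends e = s(a, b) := hab.symm
    by_cases hr : (S.simpleGraph F).Reachable b a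
    · exact ⟨s, hs.insert hab (gain_eq_of_reachable hs heF hb hab hr)⟩
    -- Otherwise the sign on the component of `b` can be chosen freely.
    · refine ⟨fun w => if (S.simpleGraph F).Reachable b w then S.gain e * s a * s b * s w else s w,
        IsPotential.insert ?_ hab ?_⟩
      · intro f hf c d hcd
        have hcd' : (S.simpleGraph F).Reachable b c ↔ (S.simpleGraph F).Reachable b d := by
          by_cases h : c = d
          · rw [h]
          · have : (S.simpleGraph F).Adj c d := ⟨h, f, hf, hcd⟩
            exact ⟨fun h => h.trans this.reachable, fun h => h.trans this.symm.reachable⟩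
        by_cases h : (S.simpleGraph F).Reachable b c
        · simp only [if_pos h, if_pos (hcd'.1 h)]
          rw [hs f hf c d hcd, mul_mul_mul_comm, Int.units_mul_self, one_mul]
        · simp only [if_neg h, if_neg (fun h' => h (hcd'.2 h'))]
          exact hs f hf c d hcd
      · simp only [if_neg hr, if_pos (SimpleGraph.Reachable.refl (G := S.simpleGraph F) b)]
        rw [mul_assoc _ (s b), Int.units_mul_self, mul_one, mul_comm, mul_assoc,
          Int.units_mul_self, mul_one]

variable (S) in
theorem support_finite [Finite W] (F : Finset E) : (S.support F).Finite := Set.toFinite _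

theorem GainSparse.sparse [Finite W] (h : S.GainSparse) : S.Sparse := by
  intro U F hU hF
  have hU' := hU.card_pos
  rcases F.eq_empty_or_nonempty with rfl | hne
  · simp only [Finset.card_empty]
    exact ⟨by omega, fun _ => by omega⟩
  have hsub : (S.support F).ncard ≤ U.card := by
    rw [← Set.ncard_coe_finset]
    exact Set.ncard_le_ncard (fun w ⟨e, he, hw⟩ => hF e he w hw)
  refine ⟨?_, ?_⟩
  · have := h.2 F hne
    omega
  · rintro ⟨s, hs⟩
    have := h.1 F hne hs.balanced
    omega

theorem Sparse.gainSparse [Finite W] (h : S.Sparse) : S.GainSparse := by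
  have key : ∀ F : Finset E, F.Nonempty → ∃ U : Finset W, U.Nonempty ∧ S.Within U F ∧
      U.card = (S.support F).ncard := by
    intro F ⟨e, he⟩
    refine ⟨(S.support_finite F).toFinset, ?_, ?_, ?_⟩
    · obtain ⟨⟨a, b⟩, hab⟩ := Quot.exists_rep (S.ends e)
      refine ⟨a, ?_⟩
      rw [Set.Finite.mem_toFinset]
      exact ⟨e, he, by rw [← hab]; exact Sym2.mem_mk_left a b⟩
    · intro e he w hw
      rw [Set.Finite.mem_toFinset]
      exact ⟨e, he, hw⟩
    · rw [Set.ncard_eq_toFinset_card _ (S.support_finite F)]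
  constructor
  · intro F hne hb
    obtain ⟨U, hU, hUF, hcard⟩ := key F hne
    have := (h U F hU hUF).2 hb.exists_isPotential
    omega
  · intro F hne
    obtain ⟨U, hU, hUF, hcard⟩ := key F hne
    have := (h U F hU hUF).1
    omega

end Potentials

/-! ### Uncrossing tight sets -/

section Uncrossing

variable {W E : Type*} {S : SignedGraph W E} [DecidableEq W] [DecidableEq E]

/-- The union of two unbalanced tight sets sharing a vertex is tight. -/
theorem Sparse.union_unbalanced (hS : S.Sparse) {U U' : Finset W} {F F' : Finset E}
    (hU : S.Within U F) (hU' : S.Within U' F') {x : W} (hx : x ∈ U) (hx' : x ∈ U')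
    (hF : 2 * U.card ≤ F.card + 1) (hF' : 2 * U'.card ≤ F'.card + 1) :
    2 * (U ∪ U').card ≤ (F ∪ F').card + 1 := by
  have h1 := (hS _ _ ⟨x, Finset.mem_inter.2 ⟨hx, hx'⟩⟩ (within_inter hU hU')).1
  have h2 := Finset.card_union_add_card_inter U U'
  have h3 := Finset.card_union_add_card_inter F F'
  omega

/-- The union of an unbalanced tight set and a balanced tight set sharing a vertex is tight. -/
theorem Sparse.union_balanced_right (hS : S.Sparse) {U U' : Finset W} {F F' : Finset E}
    {s' : W → ℤˣ}
    (hU : S.Within U F) (hU' : S.Within U' F') {x : W} (hx : x ∈ U) (hx' : x ∈ U')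
    (hs' : S.IsPotential s' F')
    (hF : 2 * U.card ≤ F.card + 1) (hF' : 2 * U'.card ≤ F'.card + 2) :
    2 * (U ∪ U').card ≤ (F ∪ F').card + 1 := by
  have h1 := (hS _ _ ⟨x, Finset.mem_inter.2 ⟨hx, hx'⟩⟩ (within_inter hU hU')).2
    ⟨s', hs'.mono Finset.inter_subset_right⟩
  have h2 := Finset.card_union_add_card_inter U U'
  have h3 := Finset.card_union_add_card_inter F F'
  omega

/-- The union of two balanced tight sets sharing a vertex is balanced and tight: if the two
potentials disagreed on `U ∩ U'` beyond a global sign, then `F ∩ F'` would split into two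
balanced pieces on disjoint vertex sets, and `F ∪ F'` would violate sparsity. -/
theorem Sparse.union_balanced (hS : S.Sparse) {U U' : Finset W} {F F' : Finset E}
    {s s' : W → ℤˣ} (hU : S.Within U F) (hU' : S.Within U' F') {x : W} (hx : x ∈ U)
    (hx' : x ∈ U') (hs : S.IsPotential s F) (hs' : S.IsPotential s' F')
    (hF : 2 * U.card ≤ F.card + 2) (hF' : 2 * U'.card ≤ F'.card + 2) :
    ∃ (t : W → ℤˣ) (ε : ℤˣ), S.IsPotential t (F ∪ F') ∧
      2 * (U ∪ U').card ≤ (F ∪ F').card + 2 ∧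
      (∀ u ∈ U, t u = s u) ∧ ∀ u ∈ U', t u = ε * s' u := by
  have hxx : x ∈ U ∩ U' := Finset.mem_inter.2 ⟨hx, hx'⟩
  have h2 := Finset.card_union_add_card_inter U U'
  have h3 := Finset.card_union_add_card_inter F F'
  by_cases hconst : ∀ u ∈ U ∩ U', s u * s' u = s x * s' x
  · have h1 := (hS _ _ ⟨x, hxx⟩ (within_inter hU hU')).2 ⟨s', hs'.mono Finset.inter_subset_right⟩
    have hr : ∀ u ∈ U', (if u ∈ U then s u else s x * s' x * s' u) = s x * s' x * s' u := by
      intro u hu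
      split_ifs with h
      · exact units_mul_eq (hconst u (Finset.mem_inter.2 ⟨h, hu⟩))
      · rfl
    have hl : ∀ u ∈ U, (if u ∈ U then s u else s x * s' x * s' u) = s u := fun u hu => if_pos hu
    refine ⟨fun u => if u ∈ U then s u else s x * s' x * s' u, s x * s' x, ?_, by omega, hl, hr⟩
    intro e he
    rcases Finset.mem_union.1 he with he | he
    · exact hs.congr hU hl e he
    · exact (hs'.smul (s x * s' x)).congr hU' hr e he
  · exfalso
    classical
    push Not at hconst
    obtain ⟨y, hy, hyx⟩ := hconst
    let P : W → Prop := fun u => s u * s' u = s x * s' x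
    have hW := within_inter hU hU'
    -- An edge of `F ∩ F'` does not leave the set where `s * s'` has a given value.
    have hedge : ∀ e ∈ F ∩ F', ∀ a b, S.ends e = s(a, b) → s a * s' a = s b * s' b := by
      intro e he a b hab
      rw [Finset.mem_inter] at he
      have h1 := hs e he.1 a b hab
      rw [hs' e he.2 a b hab] at h1
      calc s a * s' a = s a * (s' a * s' b) * s' b := by
            rw [← mul_assoc, mul_assoc _ (s' b), Int.units_mul_self, mul_one]
        _ = s b * s' b := by rw [h1, ← mul_assoc, Int.units_mul_self, one_mul]
    have hmem : ∀ e ∈ F ∩ F', ∀ a ∈ S.ends e, ∀ b ∈ S.ends e, P a → P b := by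
      intro e he a ha b hb hPa
      obtain ⟨⟨c, d⟩, hcd⟩ := Quot.exists_rep (S.ends e)
      have hcd : S.ends e = s(c, d) := hcd.symm
      have h := hedge e he c d hcd
      rw [hcd, Sym2.mem_iff] at ha hb
      simp only [P] at hPa ⊢
      rcases ha with rfl | rfl <;> rcases hb with rfl | rfl <;> simp_all
    let Q : E → Prop := fun e => ∀ a ∈ S.ends e, P a
    have h4 := Finset.card_filter_add_card_filter_not (s := U ∩ U') P
    have h5 := Finset.card_filter_add_card_filter_not (s := F ∩ F') Q
    have h6 := (hS ((U ∩ U').filter P) ((F ∩ F').filter Q)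
      ⟨x, Finset.mem_filter.2 ⟨hxx, rfl⟩⟩ (fun e he w hw => by
        rw [Finset.mem_filter] at he ⊢
        exact ⟨hW e he.1 w hw, he.2 w hw⟩)).2
      ⟨s', hs'.mono ((Finset.filter_subset _ _).trans Finset.inter_subset_right)⟩
    have h7 := (hS ((U ∩ U').filter (fun u => ¬ P u)) ((F ∩ F').filter (fun e => ¬ Q e))
      ⟨y, Finset.mem_filter.2 ⟨hy, hyx⟩⟩ (fun e he w hw => by
        rw [Finset.mem_filter] at he ⊢
        exact ⟨hW e he.1 w hw, fun hP => he.2 fun a ha => hmem e he.1 w hw a ha hP⟩)).2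
      ⟨s', hs'.mono ((Finset.filter_subset _ _).trans Finset.inter_subset_right)⟩
    have h8 := (hS (U ∪ U') (F ∪ F') ⟨x, Finset.mem_union_left _ hx⟩ (within_union hU hU')).1
    omega

end Uncrossing

/-! ### Restriction to a vertex subset -/

section Restrict

variable {W E : Type*}

/-- The signed graph obtained by removing a set `X` of isolated vertices. -/
def restrict (T : SignedGraph W E) (X : Finset W) (h : ∀ e, ∀ w ∈ T.ends e, w ∉ X) :
    SignedGraph {w // w ∉ X} E where
  ends e := (T.ends e).attachWith (h e)
  gain := T.gain
  gain_ne_of_parallel e f hef hends := by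
    refine T.gain_ne_of_parallel e f hef ?_
    rw [← Sym2.attachWith_map_subtypeVal (h e), hends,
      Sym2.attachWith_map_subtypeVal (h f)]
  gain_of_loop e he := by
    refine T.gain_of_loop e ?_
    rw [← Sym2.attachWith_map_subtypeVal (h e)]
    exact (Sym2.isDiag_map Subtype.val_injective).2 he

theorem restrict_ends {T : SignedGraph W E} {X : Finset W} (h : ∀ e, ∀ w ∈ T.ends e, w ∉ X)
    (e : E) : ((T.restrict X h).ends e).map Subtype.val = T.ends e :=
  Sym2.attachWith_map_subtypeVal (h e)

variable (S : SignedGraph W E)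

/-- `(2,2,1)`-gain-tightness in terms of potentials. -/
def Tight : Prop :=
  S.Sparse ∧ Nat.card E + 1 = 2 * Nat.card W

theorem restrict_sparse {T : SignedGraph W E} {X : Finset W} (h : ∀ e, ∀ w ∈ T.ends e, w ∉ X)
    (hT : ∀ (U : Finset W) (F : Finset E), U.Nonempty → (∀ u ∈ U, u ∉ X) → T.Within U F →
      F.card + 1 ≤ 2 * U.card ∧ ((∃ s, T.IsPotential s F) → F.card + 2 ≤ 2 * U.card)) :
    (T.restrict X h).Sparse := by
  classical
  intro U F hU hF
  have key := hT (U.map (Function.Embedding.subtype _)) F hU.map (by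
      intro u hu
      obtain ⟨u, -, rfl⟩ := Finset.mem_map.1 hu
      exact u.2) (by
      intro e he w hw
      rw [← restrict_ends h, Sym2.mem_map] at hw
      obtain ⟨w, hw, rfl⟩ := hw
      exact Finset.mem_map.2 ⟨w, hF e he w hw, rfl⟩)
  rw [Finset.card_map] at key
  refine ⟨key.1, fun ⟨s, hs⟩ => key.2 ?_⟩
  refine ⟨fun w => if hw : w ∉ X then s ⟨w, hw⟩ else 1, fun e he a b hab => ?_⟩
  have ha : a ∉ X := h e a (by rw [hab]; exact Sym2.mem_mk_left a b)
  have hb : b ∉ X := h e b (by rw [hab]; exact Sym2.mem_mk_right a b)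
  simp only [dif_pos ha, dif_pos hb]
  refine hs e he _ _ (Sym2.map.injective Subtype.val_injective ?_)
  rw [restrict_ends h, hab]
  rfl

theorem card_compl_add_card [Finite W] (X : Finset W) :
    Nat.card {w // w ∉ X} + X.card = Nat.card W := by
  classical
  have := Fintype.ofFinite W
  rw [Nat.card_eq_fintype_card, Nat.card_eq_fintype_card,
    Fintype.card_of_subtype Xᶜ (fun x => Finset.mem_compl), Finset.card_compl]
  have := X.card_le_univ
  omega

end Restrict

/-! ### Inverse Henneberg moves -/

section Star

variable {W E : Type*} {S : SignedGraph W E}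

variable (S) in
/-- The set of edges incident with `v`. -/
def star [Fintype E] [DecidableEq W] (v : W) : Finset E := Finset.univ.filter fun e => v ∈ S.ends e

theorem mem_star [Fintype E] [DecidableEq W] {v : W} {e : E} : e ∈ S.star v ↔ v ∈ S.ends e := by
  simp [star]

variable (S) in
/-- A tight set of edges that avoids `v`, spans `a` and `b`, and obstructs the insertion of an edge
`ab` with gain `g * h`. -/
def Blocks (v a b : W) (g h : ℤˣ) : Prop :=
  ∃ (U : Finset W) (F : Finset E), v ∉ U ∧ a ∈ U ∧ b ∈ U ∧ S.Within U F ∧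
    (2 * U.card ≤ F.card + 1 ∨
      ∃ s, S.IsPotential s F ∧ s a * g = s b * h ∧ 2 * U.card ≤ F.card + 2)

theorem Blocks.symm {v a b : W} {g h : ℤˣ} (hb : S.Blocks v a b g h) : S.Blocks v b a h g := by
  obtain ⟨U, F, hv, ha, hb, hF, h⟩ := hb
  exact ⟨U, F, hv, hb, ha, hF, h.imp_right fun ⟨s, hs, h, hc⟩ => ⟨s, hs, h.symm, hc⟩⟩

theorem gain_mul_eq_neg_one {e f : E} (hne : e ≠ f) (h : S.ends e = S.ends f) :
    S.gain e * S.gain f = -1 := by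
  have := S.gain_ne_of_parallel e f hne h
  rcases Int.units_eq_one_or (S.gain e) with h1 | h1 <;>
    rcases Int.units_eq_one_or (S.gain f) with h2 | h2 <;> simp_all

end Star

section InverseHenneberg

universe u

variable {W E : Type u} {S : SignedGraph W E} [Fintype W] [Fintype E] [DecidableEq W]
  [DecidableEq E]

theorem Tight.two_le_card_star (hS : S.Tight) (hW : 2 ≤ Nat.card W) (v : W) :
    2 ≤ (S.star v).card := by
  rw [Nat.card_eq_fintype_card] at hW
  have h := (hS.1 (Finset.univ.erase v) (S.star v)ᶜ ?_ ?_).1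
  · have h1 := hS.2
    rw [Nat.card_eq_fintype_card, Nat.card_eq_fintype_card] at h1
    rw [Finset.card_erase_of_mem (Finset.mem_univ v), Finset.card_compl, Finset.card_univ] at h
    omega
  · rw [← Finset.card_pos, Finset.card_erase_of_mem (Finset.mem_univ v), Finset.card_univ]
    omega
  · intro e he w hw
    refine Finset.mem_erase.2 ⟨?_, Finset.mem_univ w⟩
    rintro rfl
    exact Finset.mem_compl.1 he (mem_star.2 hw)

/-- Deleting a vertex incident with only two edges is the inverse of a Henneberg 1 move. -/
theorem Tight.exists_isH1 (hS : S.Tight) (hW : 2 ≤ Nat.card W) {v : W}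
    (hv : (S.star v).card ≤ 2) : ∃ (W₀ E₀ : Type u) (S₀ : SignedGraph W₀ E₀), Finite W₀ ∧
      Finite E₀ ∧ S₀.Tight ∧ Nat.card W₀ < Nat.card W ∧ S₀.IsH1 S := by
  obtain ⟨e₁, e₂, hne, hst⟩ := Finset.card_eq_two.1 (le_antisymm hv (hS.two_le_card_star hW v))
  let T : SignedGraph W {e // e ∉ S.star v} :=
    { ends := fun e => S.ends e.1
      gain := fun e => S.gain e.1
      gain_ne_of_parallel := fun e f hef h =>
        S.gain_ne_of_parallel _ _ (by simpa [Subtype.ext_iff] using hef) h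
      gain_of_loop := fun e h => S.gain_of_loop _ h }
  have hT : ∀ e, ∀ w ∈ T.ends e, w ∉ ({v} : Finset W) := by
    intro e w hw h
    rw [Finset.mem_singleton.1 h] at hw
    exact e.2 (mem_star.2 hw)
  have hcW := card_compl_add_card ({v} : Finset W)
  have hcE := card_compl_add_card (S.star v)
  rw [Finset.card_singleton] at hcW
  rw [hst, Finset.card_pair hne, ← hst] at hcE
  have h1 : e₁ ∈ S.star v := by rw [hst]; simp
  have h2 : e₂ ∈ S.star v := by rw [hst]; simp
  have hloop : ∀ e, v ∈ S.ends e → (S.ends e).IsDiag → S.ends e = s(v, v) := by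
    intro e hv hd
    obtain ⟨⟨a, b⟩, hab⟩ := Quot.exists_rep (S.ends e)
    have hab : S.ends e = s(a, b) := hab.symm
    rw [hab] at hd hv ⊢
    rw [Sym2.mk_isDiag_iff] at hd
    subst hd
    simp only [Sym2.mem_iff, or_self] at hv
    rw [hv]
  refine ⟨_, _, T.restrict {v} hT, inferInstance, inferInstance, ⟨restrict_sparse hT ?_, ?_⟩, ?_,
    Function.Embedding.subtype _, Function.Embedding.subtype _, v, e₁, e₂, hne, ?_, ?_, ?_,
    mem_star.1 h1, mem_star.1 h2, ?_⟩
  · intro U F hU hUX hF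
    have := hS.1 U (F.map (Function.Embedding.subtype _)) hU (by
      intro e he w hw
      obtain ⟨e, he', rfl⟩ := Finset.mem_map.1 he
      exact hF e he' w hw)
    rw [Finset.card_map] at this
    refine ⟨this.1, fun ⟨s, hs⟩ => this.2 ⟨s, ?_⟩⟩
    intro e he a b hab
    obtain ⟨e, he', rfl⟩ := Finset.mem_map.1 he
    exact hs e he' a b hab
  · have := hS.2
    omega
  · omega
  · ext w; simp
  · ext e; simp [hst]
  · exact fun e => ⟨(restrict_ends hT e).symm, rfl⟩
  · rintro ⟨hd₁, hd₂⟩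
    refine S.gain_ne_of_parallel e₁ e₂ hne ?_ ?_
    · rw [hloop e₁ (mem_star.1 h1) hd₁, hloop e₂ (mem_star.1 h2) hd₂]
    · rw [S.gain_of_loop e₁ hd₁, S.gain_of_loop e₂ hd₂]

/-- Inverse Henneberg 2 move at a vertex incident with three edges and no loop, inserting an edge
that is neither parallel to an edge of the same gain nor obstructed by a tight set. -/
theorem Tight.exists_isH2 (hS : S.Tight) {v a₁ a₂ a₃ : W} {e₁ e₂ e₃ : E}
    (h12 : e₁ ≠ e₂) (h13 : e₁ ≠ e₃) (h23 : e₂ ≠ e₃) (hst : S.star v = {e₁, e₂, e₃})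
    (h1 : S.ends e₁ = s(v, a₁)) (h2 : S.ends e₂ = s(v, a₂)) (h3 : S.ends e₃ = s(v, a₃))
    (hv1 : a₁ ≠ v) (hv2 : a₂ ≠ v) (hv3 : a₃ ≠ v)
    (hP : ∀ f, S.ends f = s(a₁, a₂) → S.gain f ≠ S.gain e₁ * S.gain e₂)
    (hB : ¬ S.Blocks v a₁ a₂ (S.gain e₁) (S.gain e₂)) :
    ∃ (W₀ E₀ : Type u) (S₀ : SignedGraph W₀ E₀), Finite W₀ ∧
      Finite E₀ ∧ S₀.Tight ∧ Nat.card W₀ < Nat.card W ∧ S₀.IsH2 S := by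
  let T : SignedGraph W (Option {e // e ∉ S.star v}) :=
    { ends := fun e => e.elim s(a₁, a₂) fun e => S.ends e.1
      gain := fun e => e.elim (S.gain e₁ * S.gain e₂) fun e => S.gain e.1
      gain_ne_of_parallel := by
        rintro (_ | e) (_ | f) hef h
        · exact absurd rfl hef
        · exact (hP f.1 h.symm).symm
        · exact hP e.1 h
        · exact S.gain_ne_of_parallel e.1 f.1 (fun h => hef (by rw [Subtype.ext h])) h
      gain_of_loop := by
        rintro (_ | e) h
        · have h : a₁ = a₂ := h
          exact gain_mul_eq_neg_one h12 (by rw [h1, h2, h])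
        · exact S.gain_of_loop e.1 h }
  have hT : ∀ e, ∀ w ∈ T.ends e, w ∉ ({v} : Finset W) := by
    rintro (_ | e) w hw h
    · have hw : w ∈ s(a₁, a₂) := hw
      rw [Finset.mem_singleton.1 h, Sym2.mem_iff] at hw
      rcases hw with hw | hw
      exacts [hv1 hw.symm, hv2 hw.symm]
    · have hw : w ∈ S.ends e.1 := hw
      rw [Finset.mem_singleton.1 h] at hw
      exact e.2 (mem_star.2 hw)
  have hcW := card_compl_add_card ({v} : Finset W)
  have hcE := card_compl_add_card (S.star v)
  rw [Finset.card_singleton] at hcW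
  have hc3 : (S.star v).card = 3 := by
    rw [hst]
    exact Finset.card_eq_three.2 ⟨_, _, _, h12, h13, h23, rfl⟩
  have hcO : Nat.card (Option {e // e ∉ S.star v}) = Nat.card {e // e ∉ S.star v} + 1 :=
    Finite.card_option
  have hr := restrict_ends hT
  have hmem : ∀ a, a ≠ v → a ∉ ({v} : Finset W) := by simp
  refine ⟨_, _, T.restrict {v} hT, inferInstance, inferInstance, ⟨restrict_sparse hT ?_, ?_⟩, ?_,
    none, ⟨a₁, hmem _ hv1⟩, ⟨a₂, hmem _ hv2⟩, ⟨a₃, hmem _ hv3⟩, Function.Embedding.subtype _,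
    ⟨fun f => (f.1.get (Option.isSome_iff_ne_none.2 f.2)).1, ?_⟩, v, e₁, e₂, e₃, h12, h13, h23,
    ?_, ?_, ?_, ?_, h1, h2, rfl, h3⟩
  · intro U F hU hUX hF
    have hvU : v ∉ U := fun h => hUX v h (Finset.mem_singleton_self v)
    have hW : S.Within U ((Finset.eraseNone F).map (Function.Embedding.subtype _)) := by
      intro e he w hw
      obtain ⟨e, he', rfl⟩ := Finset.mem_map.1 he
      exact hF (some e) (Finset.mem_eraseNone.1 he') w hw
    have hpot : ∀ s, T.IsPotential s F →
        S.IsPotential s ((Finset.eraseNone F).map (Function.Embedding.subtype _)) := by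
      intro s hs e he a b hab
      obtain ⟨e, he', rfl⟩ := Finset.mem_map.1 he
      exact hs (some e) (Finset.mem_eraseNone.1 he') a b hab
    have key := hS.1 U _ hU hW
    by_cases hnone : none ∈ F
    · have hc : ((Finset.eraseNone F).map
          (Function.Embedding.subtype fun e => e ∉ S.star v)).card + 1 = F.card := by
        rw [Finset.card_map, Finset.card_eraseNone_of_mem hnone]
        have := Finset.card_pos.2 ⟨_, hnone⟩
        omega
      have ha1 : a₁ ∈ U := hF none hnone a₁ (Sym2.mem_mk_left a₁ a₂)
      have ha2 : a₂ ∈ U := hF none hnone a₂ (Sym2.mem_mk_right a₁ a₂)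
      refine ⟨?_, fun ⟨s, hs⟩ => ?_⟩
      · by_contra hcon
        exact hB ⟨U, _, hvU, ha1, ha2, hW, Or.inl (by omega)⟩
      · by_contra hcon
        refine hB ⟨U, _, hvU, ha1, ha2, hW, Or.inr ⟨s, hpot s hs, ?_, by omega⟩⟩
        have : S.gain e₁ * S.gain e₂ = s a₁ * s a₂ := hs none hnone a₁ a₂ rfl
        rw [units_mul_eq this, mul_assoc, mul_comm (s a₂), ← mul_assoc, ← mul_assoc,
          Int.units_mul_self, one_mul, mul_comm]
    · rw [Finset.card_map, Finset.card_eraseNone_of_not_mem hnone] at key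
      exact ⟨key.1, fun ⟨s, hs⟩ => key.2 ⟨s, hpot s hs⟩⟩
  · have := hS.2
    omega
  · omega
  · rintro ⟨_ | f, hf⟩ ⟨_ | g, hg⟩ hfg
    · rfl
    · exact absurd rfl hf
    · exact absurd rfl hg
    · have : f = g := Subtype.ext hfg
      rw [Subtype.mk.injEq, this]
  · ext w; simp
  · have : ({e₁, e₂, e₃} : Set E) = (S.star v : Set E) := by rw [hst]; simp
    rw [this]
    ext e
    constructor
    · rintro ⟨⟨_ | f, hf⟩, rfl⟩
      · exact absurd rfl hf
      · exact f.2
    · intro he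
      exact ⟨⟨some ⟨e, he⟩, by simp⟩, rfl⟩
  · rintro ⟨_ | f, hf⟩
    · exact absurd rfl hf
    · exact ⟨(hr (some f)).symm, rfl⟩
  · exact Sym2.map.injective Subtype.val_injective (hr none)

end InverseHenneberg

/-! ### Vertices of degree three -/

section Claw

variable {W E : Type*} {S : SignedGraph W E}

/-- By the handshake lemma, some vertex is incident with at most two edges, or with three edges
none of which is a loop. -/
theorem Tight.exists_card_star_le [Fintype W] [Fintype E] [DecidableEq W] (hS : S.Tight) :
    ∃ v, (S.star v).card ≤ 2 ∨ ((S.star v).card = 3 ∧ ∀ e, S.ends e ≠ s(v, v)) := by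
  let L : W → Finset E := fun v => Finset.univ.filter fun e => S.ends e = s(v, v)
  have hsum : ∑ v, ((S.star v).card + (L v).card) = ∑ e : E, 2 := by
    have h1 := Finset.sum_card_bipartiteAbove_eq_sum_card_bipartiteBelow
      (s := (Finset.univ : Finset W)) (t := (Finset.univ : Finset E)) (fun v e => v ∈ S.ends e)
    have h2 := Finset.sum_card_bipartiteAbove_eq_sum_card_bipartiteBelow
      (s := (Finset.univ : Finset W)) (t := (Finset.univ : Finset E))
      (fun v e => S.ends e = s(v, v))
    have h1 : ∑ v, (S.star v).card = _ := h1
    have h2 : ∑ v, (L v).card = _ := h2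
    rw [Finset.sum_add_distrib, h1, h2, ← Finset.sum_add_distrib]
    refine Finset.sum_congr rfl fun e _ => ?_
    obtain ⟨⟨a, b⟩, hab⟩ := Quot.exists_rep (S.ends e)
    have hab : S.ends e = s(a, b) := hab.symm
    have h3 : Finset.univ.bipartiteBelow (fun v e => v ∈ S.ends e) e = {a, b} := by
      ext v; simp [Finset.mem_bipartiteBelow, hab]
    by_cases h : a = b
    · subst h
      have h4 : Finset.univ.bipartiteBelow (fun v e => S.ends e = s(v, v)) e = {a} := by
        ext v; simp [Finset.mem_bipartiteBelow, hab, eq_comm]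
      rw [h3, h4]
      simp
    · have h4 : Finset.univ.bipartiteBelow (fun v e => S.ends e = s(v, v)) e = ∅ := by
        ext v
        simp only [Finset.mem_bipartiteBelow, hab, Sym2.eq_iff, or_self, Finset.mem_univ, true_and,
          Finset.notMem_empty, iff_false]
        rintro ⟨rfl, rfl⟩
        exact h rfl
      rw [h3, h4, Finset.card_pair h]
      rfl
  have hcard := hS.2
  rw [Nat.card_eq_fintype_card, Nat.card_eq_fintype_card] at hcard
  obtain ⟨v, -, hv⟩ := Finset.exists_lt_of_sum_lt (s := Finset.univ)
    (f := fun v => (S.star v).card + (L v).card) (g := fun _ => 4) (by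
      rw [hsum]
      simp only [Finset.sum_const, Finset.card_univ, smul_eq_mul]
      omega)
  refine ⟨v, ?_⟩
  by_cases h : (S.star v).card ≤ 2
  · exact Or.inl h
  · refine Or.inr ⟨by omega, fun e he => ?_⟩
    have : 0 < (L v).card := Finset.card_pos.2 ⟨e, by simp [L, he]⟩
    omega

variable (S) in
/-- The edges at `v` are `e 0`, `e 1`, `e 2`, joining `v` to `a 0`, `a 1`, `a 2` (possibly with
repetitions), all different from `v`. -/
structure IsClaw (v : W) (e : Fin 3 → E) (a : Fin 3 → W) : Prop where
  injective : Function.Injective e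
  mem_iff : ∀ f, v ∈ S.ends f ↔ ∃ i, f = e i
  ends_eq : ∀ i, S.ends (e i) = s(v, a i)
  ne : ∀ i, a i ≠ v

variable {v : W} {e : Fin 3 → E} {a : Fin 3 → W}

theorem IsClaw.ne_of_eq (h : S.IsClaw v e a) {i j : Fin 3} (hij : i ≠ j) (ha : a i = a j) :
    S.gain (e i) ≠ S.gain (e j) :=
  S.gain_ne_of_parallel _ _ (h.injective.ne hij) (by rw [h.ends_eq, h.ends_eq, ha])

variable (S) in
/-- There is an edge `ab` with gain `g`. -/
def HasEdge (a b : W) (g : ℤˣ) : Prop := ∃ f, S.ends f = s(a, b) ∧ S.gain f = g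

theorem HasEdge.symm {a b : W} {g : ℤˣ} (h : S.HasEdge a b g) : S.HasEdge b a g := by
  obtain ⟨f, hf, hg⟩ := h
  exact ⟨f, by rw [hf, Sym2.eq_swap], hg⟩

section
variable [DecidableEq W] [DecidableEq E]

theorem IsClaw.extend (h : S.IsClaw v e a) {U : Finset W} {F : Finset E} (hv : v ∉ U)
    (ha : ∀ i, a i ∈ U) (hF : S.Within U F) :
    S.Within (insert v U) (F ∪ Finset.univ.image e) ∧
      (F ∪ Finset.univ.image e).card = F.card + 3 := by
  constructor
  · intro f hf w hw
    rcases Finset.mem_union.1 hf with hf | hf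
    · exact Finset.mem_insert_of_mem (hF f hf w hw)
    · obtain ⟨i, -, rfl⟩ := Finset.mem_image.1 hf
      rw [h.ends_eq, Sym2.mem_iff] at hw
      rcases hw with rfl | rfl
      exacts [Finset.mem_insert_self _ _, Finset.mem_insert_of_mem (ha i)]
  · rw [Finset.card_union_of_disjoint, Finset.card_image_of_injective _ h.injective,
      Finset.card_univ, Fintype.card_fin]
    rw [Finset.disjoint_right]
    intro f hf hfF
    obtain ⟨i, -, rfl⟩ := Finset.mem_image.1 hf
    exact hv (hF _ hfF v ((h.mem_iff _).2 ⟨i, rfl⟩))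

/-- No unbalanced tight set avoiding `v` spans all neighbours of `v`. -/
theorem IsClaw.card_le (h : S.IsClaw v e a) (hS : S.Sparse) {U : Finset W} {F : Finset E}
    (hv : v ∉ U) (ha : ∀ i, a i ∈ U) (hF : S.Within U F) : F.card + 2 ≤ 2 * U.card := by
  obtain ⟨hW, hc⟩ := h.extend hv ha hF
  have := (hS _ _ ⟨v, Finset.mem_insert_self _ _⟩ hW).1
  rw [hc, Finset.card_insert_of_notMem hv] at this
  omega

/-- No balanced tight set avoiding `v` spans all neighbours of `v`, with a potential that can be
extended to `v`. -/
theorem IsClaw.card_le_of_isPotential (h : S.IsClaw v e a) (hS : S.Sparse) {U : Finset W}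
    {F : Finset E} (hv : v ∉ U) (ha : ∀ i, a i ∈ U) (hF : S.Within U F) {s : W → ℤˣ}
    (hs : S.IsPotential s F) {ε : ℤˣ} (hε : ∀ i, s (a i) * S.gain (e i) = ε) :
    F.card + 3 ≤ 2 * U.card := by
  obtain ⟨hW, hc⟩ := h.extend hv ha hF
  have := (hS _ _ ⟨v, Finset.mem_insert_self _ _⟩ hW).2 ⟨Function.update s v ε, ?_⟩
  · rw [hc, Finset.card_insert_of_notMem hv] at this
    omega
  · intro f hf b c hbc
    rcases Finset.mem_union.1 hf with hf | hf
    · refine hs.congr hF (fun u hu => ?_) f hf b c hbc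
      rw [Function.update_of_ne]
      rintro rfl
      exact hv hu
    · obtain ⟨i, -, rfl⟩ := Finset.mem_image.1 hf
      refine isPotential_edge (h.ends_eq i) ?_ b c hbc
      rw [Function.update_self, Function.update_of_ne (h.ne i), ← hε i, mul_comm (s (a i)),
        mul_assoc, Int.units_mul_self, mul_one]

/-- Two of the three possible new edges cannot both be obstructed by tight sets. -/
theorem IsClaw.not_blocks_of_blocks (h : S.IsClaw v e a) (hS : S.Sparse) {i j k : Fin 3}
    (hijk : ∀ l, l = i ∨ l = j ∨ l = k)
    (h1 : S.Blocks v (a i) (a j) (S.gain (e i)) (S.gain (e j))) :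
    ¬ S.Blocks v (a j) (a k) (S.gain (e j)) (S.gain (e k)) := by
  obtain ⟨U, F, hv, hi, hj, hF, h1⟩ := h1
  rintro ⟨U', F', hv', hj', hk', hF', h2⟩
  have hvU : v ∉ U ∪ U' := by simp [hv, hv']
  have haU : ∀ l, a l ∈ U ∪ U' := by
    intro l
    rcases hijk l with rfl | rfl | rfl <;> simp [hi, hj, hk']
  have hW := within_union hF hF'
  have key := h.card_le hS hvU haU hW
  rcases h1 with h1 | ⟨s, hs, hse, h1⟩ <;> rcases h2 with h2 | ⟨s', hs', hse', h2⟩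
  · have := hS.union_unbalanced hF hF' hj hj' h1 h2
    omega
  · have := hS.union_balanced_right hF hF' hj hj' hs' h1 h2
    omega
  · have := hS.union_balanced_right hF' hF hj' hj hs h2 h1
    rw [Finset.union_comm, Finset.union_comm F'] at this
    omega
  · obtain ⟨t, ε, ht, hc, htU, htU'⟩ := hS.union_balanced hF hF' hj hj' hs hs' h1 h2
    have := h.card_le_of_isPotential hS hvU haU hW ht (ε := t (a j) * S.gain (e j)) (by
      intro l
      rcases hijk l with rfl | rfl | rfl
      · rw [htU _ hi, htU _ hj, hse]
      · rfl
      · rw [htU' _ hk', htU' _ hj', mul_assoc, mul_assoc, hse'])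
    omega

/-- A new edge at one pair of neighbours cannot be obstructed by a tight set if the two other
possible new edges are present already. -/
theorem IsClaw.not_blocks_of_hasEdge (h : S.IsClaw v e a) (hS : S.Sparse) {i j k : Fin 3}
    (hijk : ∀ l, l = i ∨ l = j ∨ l = k) (hik : i ≠ k) (hij : a i ≠ a j) (hjk : a j ≠ a k)
    (h1 : S.HasEdge (a i) (a j) (S.gain (e i) * S.gain (e j)))
    (h2 : S.HasEdge (a j) (a k) (S.gain (e j) * S.gain (e k))) :
    ¬ S.Blocks v (a i) (a k) (S.gain (e i)) (S.gain (e k)) := by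
  rintro ⟨U, F, hv, hi, hk, hF, hb⟩
  obtain ⟨f, hf, hfg⟩ := h1
  obtain ⟨f', hf', hfg'⟩ := h2
  by_cases hj : a j ∈ U
  · have haU : ∀ l, a l ∈ U := by
      intro l
      rcases hijk l with rfl | rfl | rfl <;> assumption
    have key := h.card_le hS hv haU hF
    rcases hb with hb | ⟨s, hs, hse, hb⟩
    · omega
    · by_cases hsj : s (a j) * S.gain (e j) = s (a i) * S.gain (e i)
      · have := h.card_le_of_isPotential hS hv haU hF hs (ε := s (a i) * S.gain (e i)) (by
          intro l
          rcases hijk l with rfl | rfl | rfl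
          exacts [rfl, hsj, hse.symm])
        omega
      · -- The edge `f` is inconsistent with the potential, so it can be added.
        have hfF : f ∉ F := by
          intro hfF
          have := hs f hfF _ _ hf
          rw [hfg] at this
          apply hsj
          rw [units_mul_eq this, mul_assoc, ← mul_assoc (s (a i)), Int.units_mul_self,
            one_mul]
        have := h.card_le hS hv haU (within_insert hF hf hi hj)
        rw [Finset.card_insert_of_notMem hfF] at this
        omega
  · have hff' : f ≠ f' := by
      rintro rfl
      rw [hf, Sym2.eq_iff] at hf'
      rcases hf' with ⟨h', -⟩ | ⟨h', -⟩
      · exact hij h'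
      · rw [hfg, mul_comm] at hfg'
        exact h.ne_of_eq hik h' (mul_left_cancel hfg')
    have hfF : f ∉ F := fun hfF => hj (hF.mem_right hfF hf)
    have hfF' : f' ∉ F := fun hfF => hj (hF.mem_left hfF hf')
    have hvU : v ∉ insert (a j) U := by
      rw [Finset.mem_insert, not_or]
      exact ⟨(h.ne j).symm, hv⟩
    have haU : ∀ l, a l ∈ insert (a j) U := by
      intro l
      rcases hijk l with rfl | rfl | rfl <;> simp [hi, hk]
    have hW : S.Within (insert (a j) U) (insert f (insert f' F)) :=
      within_insert (within_insert (hF.mono (Finset.subset_insert _ _) subset_rfl) hf' (haU j)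
        (haU k)) hf (haU i) (haU j)
    have hc : (insert f (insert f' F)).card = F.card + 2 := by
      rw [Finset.card_insert_of_notMem, Finset.card_insert_of_notMem hfF']
      simp [hff', hfF]
    have hcU := Finset.card_insert_of_notMem hj
    have key := h.card_le hS hvU haU hW
    rcases hb with hb | ⟨s, hs, hse, hb⟩
    · omega
    · have hiU : a i ≠ a j := hij
      have := h.card_le_of_isPotential hS hvU haU hW
        (s := Function.update s (a j) (s (a i) * S.gain (e i) * S.gain (e j)))
        (ε := s (a i) * S.gain (e i)) ?_ ?_
      · omega
      · refine IsPotential.insert (IsPotential.insert (hs.congr hF ?_) hf' ?_) hf ?_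
        · intro u hu
          rw [Function.update_of_ne]
          rintro rfl
          exact hj hu
        · rw [Function.update_self, Function.update_of_ne hjk.symm, hse, hfg',
            show s (a k) * S.gain (e k) * S.gain (e j) * s (a k) =
              s (a k) * s (a k) * (S.gain (e j) * S.gain (e k)) by ac_rfl,
            Int.units_mul_self, one_mul]
        · rw [Function.update_self, Function.update_of_ne hij, hfg, ← mul_assoc, ← mul_assoc,
            Int.units_mul_self, one_mul]
      · intro l
        rcases hijk l with rfl | rfl | rfl
        · rw [Function.update_of_ne hij]
        · rw [Function.update_self, mul_assoc, Int.units_mul_self, mul_one]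
        · rw [Function.update_of_ne hjk.symm, hse]

variable (S) in
/-- The vertices in `K` span a copy of `K₄`, and `s` is a potential for it. -/
def IsK4 (s : W → ℤˣ) (K : Finset W) : Prop :=
  K.card = 4 ∧ ∀ y ∈ K, ∀ z ∈ K, y ≠ z → S.HasEdge y z (s y * s z)

/-- A vertex with three edges and no loop admits an inverse Henneberg 2 move or lies in a
balanced `K₄`. -/
theorem IsClaw.exists_not_blocks_or_isK4 (h : S.IsClaw v e a) (hS : S.Sparse) :
    (∃ i j, i ≠ j ∧ ¬ S.Blocks v (a i) (a j) (S.gain (e i)) (S.gain (e j)) ∧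
      ¬ S.HasEdge (a i) (a j) (S.gain (e i) * S.gain (e j))) ∨ ∃ s K, S.IsK4 s K := by
  by_contra hcon
  push Not at hcon
  obtain ⟨hcon, hK⟩ := hcon
  -- A loop at a neighbour is itself an obstructing tight set.
  have hne : ∀ i j, i ≠ j → ¬ S.Blocks v (a i) (a j) (S.gain (e i)) (S.gain (e j)) →
      a i ≠ a j := by
    intro i j hij hb hij'
    obtain ⟨f, hf, -⟩ := hcon i j hij hb
    refine hb ⟨{a i}, {f}, ?_, ?_, ?_, ?_, Or.inl (by simp)⟩
    · simpa using (h.ne i).symm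
    · simp
    · simp [hij']
    · intro f' hf' w hw
      rw [Finset.mem_singleton.1 hf', hf, ← hij', Sym2.mem_iff, or_self] at hw
      simpa using hw
  have hnb : ∀ i j, i ≠ j → ¬ S.Blocks v (a i) (a j) (S.gain (e i)) (S.gain (e j)) := by
    intro i k hik hb
    obtain ⟨j, hji, hjk⟩ : ∃ j, j ≠ i ∧ j ≠ k := by
      clear hb; revert i k; decide
    have hijk : ∀ l, l = i ∨ l = j ∨ l = k := by
      clear hb; revert i j k; decide
    have hijk' : ∀ l, l = j ∨ l = i ∨ l = k := fun l => by
      rcases hijk l with h | h | h <;> simp [h]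
    have hijk'' : ∀ l, l = i ∨ l = k ∨ l = j := fun l => by
      rcases hijk l with h | h | h <;> simp [h]
    have h1 : ¬ S.Blocks v (a i) (a j) (S.gain (e i)) (S.gain (e j)) := fun h1 =>
      h.not_blocks_of_blocks hS hijk' h1.symm hb
    have h2 : ¬ S.Blocks v (a j) (a k) (S.gain (e j)) (S.gain (e k)) := fun h2 =>
      h.not_blocks_of_blocks hS hijk'' hb h2.symm
    exact h.not_blocks_of_hasEdge hS hijk hik (hne i j hji.symm h1) (hne j k hjk h2)
      (hcon i j hji.symm h1) (hcon j k hjk h2) hb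
  have hinj : Function.Injective a := by
    intro i j hij
    by_contra hij'
    exact hne i j hij' (hnb i j hij') hij
  have hvn : v ∉ Finset.univ.image a := by
    intro hv
    obtain ⟨i, -, hi⟩ := Finset.mem_image.1 hv
    exact h.ne i hi
  let s : W → ℤˣ := fun w => if h : ∃ i, a i = w then S.gain (e h.choose) else 1
  have hsa : ∀ i, s (a i) = S.gain (e i) := by
    intro i
    have hi : ∃ j, a j = a i := ⟨i, rfl⟩
    have : hi.choose = i := hinj hi.choose_spec
    simp only [s, dif_pos hi, this]
  have hsv : s v = 1 := dif_neg fun ⟨i, hi⟩ => h.ne i hi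
  have hva : ∀ i, S.HasEdge v (a i) (s v * s (a i)) := fun i =>
    ⟨e i, h.ends_eq i, by rw [hsv, hsa, one_mul]⟩
  refine hK s (insert v (Finset.univ.image a)) ⟨?_, ?_⟩
  · rw [Finset.card_insert_of_notMem hvn, Finset.card_image_of_injective _ hinj]
    rfl
  · intro y hy z hz hyz
    rw [Finset.mem_insert, Finset.mem_image] at hy hz
    rcases hy with rfl | ⟨i, -, rfl⟩ <;> rcases hz with rfl | ⟨j, -, rfl⟩
    · exact absurd rfl hyz
    · exact hva j
    · rw [mul_comm]; exact (hva i).symm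
    · rw [hsa, hsa]
      have hij : i ≠ j := fun hij => hyz (by rw [hij])
      exact hcon i j hij (hnb i j hij)

end

end Claw

/-! ### Switching along a sign function -/

section Switch

universe u

variable {W E : Type*}

theorem eq_of_ends_of_gain {S S' : SignedGraph W E} (h : ∀ e, S.ends e = S'.ends e)
    (h' : ∀ e, S.gain e = S'.gain e) : S = S' := by
  cases S
  cases S'
  congr
  exacts [funext h, funext h']

/-- The product of the signs of the two end-vertices. -/
def signProd (s : W → ℤˣ) : Sym2 W → ℤˣ :=
  Sym2.lift ⟨fun a b => s a * s b, fun a b => mul_comm (s a) (s b)⟩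

theorem signProd_mk (s : W → ℤˣ) (a b : W) : signProd s s(a, b) = s a * s b := rfl

theorem signProd_of_isDiag (s : W → ℤˣ) {z : Sym2 W} (hz : z.IsDiag) : signProd s z = 1 := by
  induction z using Sym2.inductionOn with
  | hf a b =>
    rw [Sym2.mk_isDiag_iff] at hz
    rw [hz, signProd_mk, Int.units_mul_self]

/-- Switch all vertices with `s w = -1` simultaneously. -/
def switch (S : SignedGraph W E) (s : W → ℤˣ) : SignedGraph W E where
  ends := S.ends
  gain e := S.gain e * signProd s (S.ends e)
  gain_ne_of_parallel e f hef h hg := by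
    rw [h] at hg
    exact S.gain_ne_of_parallel e f hef h (mul_right_cancel hg)
  gain_of_loop e he := by
    rw [signProd_of_isDiag s he, mul_one, S.gain_of_loop e he]

theorem switch_gain (S : SignedGraph W E) (s : W → ℤˣ) {e : E} {a b : W}
    (h : S.ends e = s(a, b)) : (S.switch s).gain e = S.gain e * (s a * s b) := by
  change S.gain e * signProd s (S.ends e) = _
  rw [h, signProd_mk]

theorem switch_switch (S : SignedGraph W E) (s t : W → ℤˣ) :
    (S.switch s).switch t = S.switch (fun w => s w * t w) := by
  refine eq_of_ends_of_gain (fun e => rfl) fun e => ?_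
  obtain ⟨⟨a, b⟩, hab⟩ := Quot.exists_rep (S.ends e)
  have hab : S.ends e = s(a, b) := hab.symm
  rw [switch_gain (S.switch s) t hab, switch_gain S s hab, switch_gain S _ hab, mul_assoc,
    mul_mul_mul_comm (s a)]

theorem switch_one (S : SignedGraph W E) : S.switch (fun _ => 1) = S := by
  refine eq_of_ends_of_gain (fun e => rfl) fun e => ?_
  obtain ⟨⟨a, b⟩, hab⟩ := Quot.exists_rep (S.ends e)
  have hab : S.ends e = s(a, b) := hab.symm
  rw [switch_gain _ _ hab, mul_one, mul_one]

theorem switch_switch_self (S : SignedGraph W E) (s : W → ℤˣ) : (S.switch s).switch s = S := by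
  rw [switch_switch]
  simp only [Int.units_mul_self]
  exact S.switch_one

open Classical in
theorem isSwitching_switch (S : SignedGraph W E) (v : W) :
    S.IsSwitching (S.switch (Pi.mulSingle v (-1))) := by
  refine ⟨v, fun e => ⟨rfl, ?_⟩⟩
  obtain ⟨⟨a, b⟩, hab⟩ := Quot.exists_rep (S.ends e)
  have hab : S.ends e = s(a, b) := hab.symm
  rw [switch_gain _ _ hab, hab]
  by_cases h : a = b
  · subst h
    simp [Int.units_mul_self]
  · by_cases ha : v = a
    · subst ha
      simp [Ne.symm h, h]
    · by_cases hb : v = b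
      · subst hb
        simp [h]
      · simp [ha, hb, Ne.symm ha, Ne.symm hb]

theorem Constructible.switch {W E : Type u} [Finite W] {S : SignedGraph W E}
    (hS : S.Constructible) (s : W → ℤˣ) : (S.switch s).Constructible := by
  classical
  have := Fintype.ofFinite W
  have key : ∀ (A : Finset W) (s : W → ℤˣ), (∀ w, s w ≠ 1 → w ∈ A) →
      (S.switch s).Constructible := by
    intro A
    induction A using Finset.induction_on with
    | empty =>
      intro s hs
      have : s = fun _ => 1 := by
        funext w
        by_contra h
        exact absurd (hs w h) (Finset.notMem_empty w)
      rw [this, switch_one]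
      exact hS
    | insert v A hv ih =>
      intro s hs
      rcases Int.units_eq_one_or (s v) with h1 | h1
      · refine ih s fun w hw => ?_
        rcases Finset.mem_insert.1 (hs w hw) with rfl | h
        exacts [absurd h1 hw, h]
      · have h2 := ih (fun w => s w * (Pi.mulSingle v (-1) : W → ℤˣ) w) ?_
        · have h3 := Constructible.switching h2 (isSwitching_switch _ v)
          rw [switch_switch] at h3
          simpa only [mul_assoc, Int.units_mul_self, mul_one] using h3
        · intro w hw
          by_cases hwv : w = v
          · subst hwv
            simp [h1] at hw
          · rw [Pi.mulSingle_eq_of_ne hwv, mul_one] at hw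
            exact (Finset.mem_insert.1 (hs w hw)).resolve_left hwv
  exact key Finset.univ s fun w _ => Finset.mem_univ w

variable {S : SignedGraph W E}

theorem IsPotential.of_switch {s t : W → ℤˣ} {F : Finset E}
    (h : (S.switch s).IsPotential t F) : S.IsPotential (fun w => s w * t w) F := by
  intro e he a b hab
  have := h e he a b hab
  rw [switch_gain _ _ hab] at this
  rw [units_mul_eq this, mul_mul_mul_comm, mul_comm (t a), mul_comm (t b)]

theorem Tight.switch (hS : S.Tight) (s : W → ℤˣ) : (S.switch s).Tight :=
  ⟨fun U F hU hF => ⟨(hS.1 U F hU hF).1, fun ⟨_, ht⟩ => (hS.1 U F hU hF).2 ⟨_, ht.of_switch⟩⟩,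
    hS.2⟩

theorem IsPotential.switch {s : W → ℤˣ} {F : Finset E} (h : S.IsPotential s F) {e : E}
    (he : e ∈ F) : (S.switch s).gain e = 1 := by
  obtain ⟨⟨a, b⟩, hab⟩ := Quot.exists_rep (S.ends e)
  have hab : S.ends e = s(a, b) := hab.symm
  rw [switch_gain _ _ hab, h e he a b hab, Int.units_mul_self]

end Switch

/-! ### Contractions -/

section Contraction

universe u

variable {W E : Type u}

/-- Delete the edges in `D` and map the vertices by `π`. -/
def collapse (S : SignedGraph W E) (π : W → W) (D : Finset E)
    (hpar : ∀ e f, e ∉ D → f ∉ D → e ≠ f → (S.ends e).map π = (S.ends f).map π →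
      S.gain e ≠ S.gain f)
    (hloop : ∀ e, e ∉ D → ((S.ends e).map π).IsDiag → S.gain e = -1) :
    SignedGraph W {e // e ∉ D} where
  ends e := (S.ends e.1).map π
  gain e := S.gain e.1
  gain_ne_of_parallel e f hef h := hpar e.1 f.1 e.2 f.2 (fun h => hef (Subtype.ext h)) h
  gain_of_loop e he := hloop e.1 e.2 he

variable {S : SignedGraph W E}

theorem exists_ends_eq (S : SignedGraph W E) (e : E) : ∃ a b, S.ends e = s(a, b) := by
  obtain ⟨⟨a, b⟩, hab⟩ := Quot.exists_rep (S.ends e)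
  exact ⟨a, b, hab.symm⟩

theorem IsK4.exists_edges [DecidableEq W] [Fintype E] {K : Finset W} (hS : S.Sparse)
    (hK : S.IsK4 (fun _ => 1) K) :
    ∃ D : Finset E, D.card = 6 ∧ S.Within K D ∧ (∀ e ∈ D, S.gain e = 1) ∧
      (∀ e ∈ D, ¬ (S.ends e).IsDiag) ∧
      ∀ y ∈ K, ∀ z ∈ K, y ≠ z → ∃ f ∈ D, S.ends f = s(y, z) := by
  classical
  let D : Finset E := Finset.univ.filter fun e => (∀ w ∈ S.ends e, w ∈ K) ∧ S.gain e = 1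
  have hD : S.Within K D := fun e he => (Finset.mem_filter.1 he).2.1
  have hg : ∀ e ∈ D, S.gain e = 1 := fun e he => (Finset.mem_filter.1 he).2.2
  have hsurj : ∀ y ∈ K, ∀ z ∈ K, y ≠ z → ∃ f ∈ D, S.ends f = s(y, z) := by
    intro y hy z hz hyz
    obtain ⟨f, hf, hfg⟩ := hK.2 y hy z hz hyz
    refine ⟨f, Finset.mem_filter.2 ⟨Finset.mem_univ f, ?_, by simpa using hfg⟩, hf⟩
    intro w hw
    rw [hf, Sym2.mem_iff] at hw
    rcases hw with rfl | rfl <;> assumption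
  refine ⟨D, ?_, hD, hg, ?_, hsurj⟩
  · have h1 := (hS K D (Finset.card_pos.1 (by rw [hK.1]; norm_num)) hD).2
      ⟨fun _ => 1, fun e he a b _ => by rw [hg e he]; rfl⟩
    have h2 := Finset.card_le_card_of_surjOn (s := D)
      (t := K.offDiag.image (fun p : W × W => s(p.1, p.2))) S.ends (by
        intro z hz
        obtain ⟨⟨y, w⟩, hyw, rfl⟩ := Finset.mem_image.1 (Finset.mem_coe.1 hz)
        rw [Finset.mem_offDiag] at hyw
        obtain ⟨f, hf, hfe⟩ := hsurj y hyw.1 w hyw.2.1 hyw.2.2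
        exact ⟨f, hf, hfe⟩)
    have h3 : (K.offDiag.image (fun p : W × W => s(p.1, p.2))).card = K.card.choose 2 :=
      Sym2.card_image_offDiag K
    rw [h3, hK.1] at h2
    have : Nat.choose 4 2 = 6 := rfl
    have := hK.1
    omega
  · intro e he hd
    have := S.gain_of_loop e hd
    rw [hg e he] at this
    exact absurd this (by decide)

variable [DecidableEq W] [DecidableEq E]

/-- Contracting a `K₄` with trivial gains is the inverse of a vertex-to-`K₄` move, provided that
no vertex outside is joined to two vertices of the `K₄` by edges of equal gain. -/
theorem Tight.exists_isVertexToK4 [Fintype W] [Fintype E] (hS : S.Tight) {K : Finset W}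
    (hK : S.IsK4 (fun _ => 1) K)
    (hx : ∀ x ∉ K, ∀ y ∈ K, ∀ z ∈ K, ∀ f g, f ≠ g → S.ends f = s(x, y) → S.ends g = s(x, z) →
      S.gain f ≠ S.gain g) :
    ∃ (W₀ E₀ : Type u) (S₀ : SignedGraph W₀ E₀), Finite W₀ ∧
      Finite E₀ ∧ S₀.Tight ∧ Nat.card W₀ < Nat.card W ∧ S₀.IsVertexToK4 S := by
  obtain ⟨D, hD6, hDK, hDg, hDd, hDs⟩ := hK.exists_edges hS.1
  obtain ⟨v, hv⟩ : K.Nonempty := Finset.card_pos.1 (by rw [hK.1]; norm_num)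
  let π : W → W := fun w => if w ∈ K then v else w
  have hπK : ∀ w ∈ K, π w = v := fun w hw => if_pos hw
  have hπ : ∀ w, w ∉ K → π w = w := fun w hw => if_neg hw
  have hπv : ∀ w, π w = v ↔ w ∈ K := by
    intro w
    refine ⟨fun h => ?_, hπK w⟩
    by_contra hw
    rw [hπ w hw] at h
    exact hw (h ▸ hv)
  have hπX : ∀ w, π w ∉ K.erase v := by
    intro w
    by_cases hw : w ∈ K
    · simp [hπK w hw]
    · rw [hπ w hw]; exact fun h => hw (Finset.mem_of_mem_erase h)
  have hπeq : ∀ a c, π a = π c → a = c ∨ (a ∈ K ∧ c ∈ K) := by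
    intro a c h
    by_cases ha : a ∈ K
    · rw [hπK a ha, eq_comm, hπv] at h
      exact Or.inr ⟨ha, h⟩
    · by_cases hc : c ∈ K
      · rw [hπK c hc, hπv] at h
        exact absurd h ha
      · rw [hπ a ha, hπ c hc] at h
        exact Or.inl h
  -- The remaining edges within `K` have gain `-1`.
  have hin : ∀ e, e ∉ D → ∀ a b, S.ends e = s(a, b) → a ∈ K → b ∈ K → S.gain e = -1 := by
    intro e he a b hab ha hb
    by_cases h : a = b
    · exact S.gain_of_loop e (by rw [hab, h]; exact Sym2.diag_isDiag b)
    · obtain ⟨f, hf, hfe⟩ := hDs a ha b hb h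
      have := S.gain_ne_of_parallel e f (fun h => he (h ▸ hf)) (by rw [hab, hfe])
      rw [hDg f hf] at this
      exact (Int.units_eq_one_or _).resolve_left this
  -- There is at most one of them.
  have hone : ∀ e f, e ∉ D → f ∉ D → e ≠ f → (∀ w ∈ S.ends e, w ∈ K) →
      ¬ ∀ w ∈ S.ends f, w ∈ K := by
    intro e f he hf hef heK hfK
    have := (hS.1 K (insert e (insert f D)) ⟨v, hv⟩ (by
      intro g hg
      rcases Finset.mem_insert.1 hg with rfl | hg
      · exact heK
      · rcases Finset.mem_insert.1 hg with rfl | hg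
        exacts [hfK, hDK g hg])).1
    rw [Finset.card_insert_of_notMem (by simp [hef, he]), Finset.card_insert_of_notMem hf, hD6,
      hK.1] at this
    omega
  have hpar : ∀ e f, e ∉ D → f ∉ D → e ≠ f → (S.ends e).map π = (S.ends f).map π →
      S.gain e ≠ S.gain f := by
    intro e f he hf hef h
    obtain ⟨a, b, hab⟩ := S.exists_ends_eq e
    obtain ⟨c, d, hcd⟩ := S.exists_ends_eq f
    obtain ⟨c, d, hcd, hac, hbd⟩ : ∃ c d, S.ends f = s(c, d) ∧ π a = π c ∧ π b = π d := by
      rw [hab, hcd, Sym2.map_mk, Sym2.map_mk, Sym2.eq_iff] at h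
      rcases h with ⟨h1, h2⟩ | ⟨h1, h2⟩
      · exact ⟨c, d, hcd, h1, h2⟩
      · exact ⟨d, c, by rw [hcd, Sym2.eq_swap], h1, h2⟩
    rcases hπeq a c hac with rfl | ⟨ha, hc⟩ <;> rcases hπeq b d hbd with rfl | ⟨hb, hd⟩
    · exact S.gain_ne_of_parallel e f hef (by rw [hab, hcd])
    · by_cases ha : a ∈ K
      · refine absurd ?_ (hone e f he hf hef ?_)
        · simp [hcd, ha, hd]
        · simp [hab, ha, hb]
      · exact hx a ha b hb d hd e f hef hab hcd
    · by_cases hb : b ∈ K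
      · refine absurd ?_ (hone e f he hf hef ?_)
        · simp [hcd, hb, hc]
        · simp [hab, ha, hb]
      · exact hx b hb a ha c hc e f hef (by rw [hab, Sym2.eq_swap]) (by rw [hcd, Sym2.eq_swap])
    · refine absurd ?_ (hone e f he hf hef ?_)
      · simp [hcd, hc, hd]
      · simp [hab, ha, hb]
  have hloop : ∀ e, e ∉ D → ((S.ends e).map π).IsDiag → S.gain e = -1 := by
    intro e he h
    obtain ⟨a, b, hab⟩ := S.exists_ends_eq e
    rw [hab, Sym2.map_mk, Sym2.mk_isDiag_iff] at h
    rcases hπeq a b h with rfl | ⟨ha, hb⟩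
    · exact S.gain_of_loop e (by rw [hab]; exact Sym2.diag_isDiag a)
    · exact hin e he a b hab ha hb
  let T := S.collapse π D hpar hloop
  have hT : ∀ e, ∀ w ∈ T.ends e, w ∉ K.erase v := by
    intro e w hw
    have hw : w ∈ (S.ends e.1).map π := hw
    obtain ⟨u, -, rfl⟩ := Sym2.mem_map.1 hw
    exact hπX u
  have hcW := card_compl_add_card (K.erase v)
  have hcE := card_compl_add_card D
  rw [Finset.card_erase_of_mem hv, hK.1] at hcW
  let π' : W → {w // w ∉ K.erase v} := fun w => ⟨π w, hπX w⟩
  have hr : ∀ e, (S.ends e.1).map π' = (T.restrict (K.erase v) hT).ends e := by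
    intro e
    apply Sym2.map.injective Subtype.val_injective
    rw [restrict_ends hT, Sym2.map_map]
    rfl
  have hvX : v ∉ K.erase v := by simp
  have hπ'v : ∀ w, π' w = ⟨v, hvX⟩ ↔ w ∈ K := fun w => by rw [Subtype.mk.injEq]; exact hπv w
  refine ⟨_, _, T.restrict (K.erase v) hT, inferInstance, inferInstance,
    ⟨restrict_sparse hT ?_, ?_⟩, ?_, ⟨v, hvX⟩, π', Function.Embedding.subtype _,
    ⟨?_, ?_⟩, fun e => ⟨hr e, rfl⟩, ?_, ?_⟩
  -- Sparsity after the contraction: an edge set at `v` is lifted and enlarged by the `K₄`.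
  · intro U F hU hUX hF
    let F' := F.map (Function.Embedding.subtype fun e => e ∉ D)
    have hF' : ∀ e ∈ F', ∀ w ∈ S.ends e, π w ∈ U := by
      intro e he w hw
      obtain ⟨e, he', rfl⟩ := Finset.mem_map.1 he
      exact hF e he' _ (Sym2.mem_map.2 ⟨w, hw, rfl⟩)
    have hpot : ∀ s, T.IsPotential s F → S.IsPotential (s ∘ π) F' := by
      intro s hs e he a b hab
      obtain ⟨e, he', rfl⟩ := Finset.mem_map.1 he
      refine hs e he' (π a) (π b) ?_
      change (S.ends e.1).map π = _
      have hab : S.ends e.1 = s(a, b) := hab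
      rw [hab, Sym2.map_mk]
    have hc' : F'.card = F.card := Finset.card_map _
    by_cases hvU : v ∈ U
    · have hdis : Disjoint F' D := by
        rw [Finset.disjoint_left]
        intro e he
        obtain ⟨e, -, rfl⟩ := Finset.mem_map.1 he
        exact e.2
      have hUK : U ∩ K = {v} := by
        ext u
        rw [Finset.mem_inter, Finset.mem_singleton]
        constructor
        · rintro ⟨hu, huK⟩
          by_contra h
          exact hUX u hu (Finset.mem_erase.2 ⟨h, huK⟩)
        · rintro rfl
          exact ⟨hvU, hv⟩
      have hcU := Finset.card_union_add_card_inter U K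
      rw [hUK, hK.1, Finset.card_singleton] at hcU
      have hcF := Finset.card_union_of_disjoint hdis
      have key := hS.1 (U ∪ K) (F' ∪ D) (hU.mono Finset.subset_union_left) (by
        intro e he w hw
        rcases Finset.mem_union.1 he with he | he
        · by_cases hwK : w ∈ K
          · exact Finset.mem_union_right _ hwK
          · have := hF' e he w hw
            rw [hπ w hwK] at this
            exact Finset.mem_union_left _ this
        · exact Finset.mem_union_right _ (hDK e he w hw))
      refine ⟨by omega, fun ⟨s, hs⟩ => ?_⟩
      have := key.2 ⟨s ∘ π, fun e he => ?_⟩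
      · omega
      · rcases Finset.mem_union.1 he with he | he
        · exact hpot s hs e he
        · intro a b hab
          simp only [Function.comp]
          rw [hDg e he, hπK a (hDK.mem_left he hab), hπK b (hDK.mem_right he hab),
            Int.units_mul_self]
    · have key := hS.1 U F' hU (by
        intro e he w hw
        have := hF' e he w hw
        by_cases hwK : w ∈ K
        · rw [hπK w hwK] at this
          exact absurd this hvU
        · rwa [hπ w hwK] at this)
      exact ⟨by omega, fun ⟨s, hs⟩ => by have := key.2 ⟨_, hpot s hs⟩; omega⟩
  · have := hS.2
    omega
  · omega
  · have : π' ⁻¹' {⟨v, hvX⟩} = (K : Set W) := by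
      ext w
      exact hπ'v w
    rw [this, Set.ncard_coe_finset, hK.1]
  · rintro ⟨w, hw⟩ hne
    have hwK : w ∉ K := fun h => hw (Finset.mem_erase.2 ⟨fun h => hne (Subtype.ext h), h⟩)
    refine ⟨w, Subtype.ext (hπ w hwK), fun u hu => ?_⟩
    have hu : π u = w := congrArg Subtype.val hu
    by_cases huK : u ∈ K
    · rw [hπK u huK] at hu
      exact absurd (hu ▸ hv) hwK
    · rwa [hπ u huK] at hu
  · intro f hf
    have hfD : f ∈ D := by
      by_contra h
      exact hf ⟨⟨f, h⟩, rfl⟩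
    obtain ⟨a, b, hab⟩ := S.exists_ends_eq f
    refine ⟨a, b, ?_, (hπ'v a).2 (hDK.mem_left hfD hab), (hπ'v b).2 (hDK.mem_right hfD hab), hab,
      hDg f hfD⟩
    rintro rfl
    exact hDd f hfD (by rw [hab]; exact Sym2.diag_isDiag a)
  · intro y z hyz hy hz
    obtain ⟨f, hf, hfe⟩ := hDs y ((hπ'v y).1 hy) z ((hπ'v z).1 hz) hyz
    refine ⟨f, ?_, hfe⟩
    rintro ⟨g, rfl⟩
    exact g.2 hf

end Contraction

/-! ### Contracting an edge of a triangle -/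

section EdgeContraction

universe u

variable {W E : Type u} {S : SignedGraph W E} [DecidableEq W] [DecidableEq E]

/-- Let a vertex `w` be attached to an edge `f = yy'` of a balanced tight set by a triangle, all
gains being trivial. Contracting `h = wy` is the inverse of a vertex splitting, provided that no
edge is parallel to `h` and that `h` lies in no other balanced triangle with a third vertex
outside of the tight set. -/
theorem Tight.exists_isVertexSplitting [Fintype W] [Fintype E] (hS : S.Tight)
    {U : Finset W} {F : Finset E} (hF : S.Within U F) (hF1 : ∀ e ∈ F, S.gain e = 1)
    (hUF : 2 * U.card ≤ F.card + 2) {w y y' : W} {f h h' : E} (hf : f ∈ F)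
    (hfe : S.ends f = s(y, y')) (hw : w ∉ U) (hhe : S.ends h = s(w, y)) (hh1 : S.gain h = 1)
    (hhe' : S.ends h' = s(w, y')) (hh1' : S.gain h' = 1)
    (hnp : ∀ k, k ≠ h → S.ends k ≠ s(w, y))
    (hmax : ∀ z, z ∉ U → z ≠ w → ∀ k k', S.ends k = s(w, z) → S.ends k' = s(y, z) →
      S.gain k ≠ S.gain k') :
    ∃ (W₀ E₀ : Type u) (S₀ : SignedGraph W₀ E₀), Finite W₀ ∧
      Finite E₀ ∧ S₀.Tight ∧ Nat.card W₀ < Nat.card W ∧ S₀.IsVertexSplitting S := by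
  have hy : y ∈ U := hF.mem_left hf hfe
  have hy' : y' ∈ U := hF.mem_right hf hfe
  have hwy : w ≠ y := fun h => hw (h ▸ hy)
  have hwy' : w ≠ y' := fun h => hw (h ▸ hy')
  have hyy' : y ≠ y' := by
    rintro rfl
    have := S.gain_of_loop f (by rw [hfe]; exact Sym2.diag_isDiag y)
    rw [hF1 f hf] at this
    exact absurd this (by decide)
  have hhh' : h ≠ h' := by
    rintro rfl
    rw [hhe, Sym2.eq_iff] at hhe'
    rcases hhe' with ⟨-, h⟩ | ⟨h, -⟩
    exacts [hyy' h, hwy' h]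
  have hwF : ∀ e z, S.ends e = s(w, z) → e ∉ F := fun e z he heF => hw (hF.mem_left heF he)
  -- The tight set obtained by adding `w`.
  have hMc : (insert h (insert h' F)).card = F.card + 2 := by
    rw [Finset.card_insert_of_notMem (by simp [hhh', hwF h y hhe]),
      Finset.card_insert_of_notMem (hwF h' y' hhe')]
  have hAc := Finset.card_insert_of_notMem hw
  have hwA := Finset.mem_insert_self w U
  have hMW : S.Within (insert w U) (insert h (insert h' F)) :=
    within_insert (within_insert (hF.mono (Finset.subset_insert _ _) subset_rfl) hhe' hwA
      (Finset.mem_insert_of_mem hy')) hhe hwA (Finset.mem_insert_of_mem hy)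
  have hM1 : ∀ e ∈ insert h (insert h' F), S.gain e = 1 := by
    intro e he
    rcases Finset.mem_insert.1 he with rfl | he
    · exact hh1
    · rcases Finset.mem_insert.1 he with rfl | he
      exacts [hh1', hF1 e he]
  have hextra2 : ∀ k k' a b c d, k ∉ insert h (insert h' F) → k' ∉ insert h (insert h' F) →
      k ≠ k' → S.ends k = s(a, b) → S.ends k' = s(c, d) → a ∈ insert w U → b ∈ insert w U →
      c ∈ insert w U → d ∈ insert w U → False := by
    intro k k' a b c d hk hk' hkk' hab hcd ha hb hc hd
    have := (hS.1 _ _ ⟨w, hwA⟩ (within_insert (within_insert hMW hcd hc hd) hab ha hb)).1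
    rw [Finset.card_insert_of_notMem (by rw [Finset.mem_insert, not_or]; exact ⟨hkk', hk⟩),
      Finset.card_insert_of_notMem hk'] at this
    omega
  have hextra1 : ∀ k a b, k ∉ insert h (insert h' F) → S.ends k = s(a, b) → a ∈ insert w U →
      b ∈ insert w U → S.gain k ≠ 1 := by
    intro k a b hk hab ha hb hg
    have := (hS.1 _ _ ⟨w, hwA⟩ (within_insert hMW hab ha hb)).2 ⟨fun _ => 1, fun e he _ _ _ => by
      rcases Finset.mem_insert.1 he with rfl | he
      exacts [hg, hM1 e he]⟩
    rw [Finset.card_insert_of_notMem hk] at this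
    omega
  let π : W → W := fun x => if x = w then y else x
  have hπw : π w = y := if_pos rfl
  have hπ : ∀ x, x ≠ w → π x = x := fun x hx => if_neg hx
  have hπX : ∀ x, π x ∉ ({w} : Finset W) := by
    intro x
    rw [Finset.mem_singleton]
    by_cases hx : x = w
    · rw [hx, hπw]; exact hwy.symm
    · rw [hπ x hx]; exact hx
  have hπeq : ∀ a c, π a = π c → a = c ∨ (a = w ∧ c = y) ∨ (a = y ∧ c = w) := by
    intro a c hac
    by_cases ha : a = w <;> by_cases hc : c = w
    · exact Or.inl (ha.trans hc.symm)
    · rw [ha, hπw, hπ c hc] at hac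
      exact Or.inr (Or.inl ⟨ha, hac.symm⟩)
    · rw [hc, hπw, hπ a ha] at hac
      exact Or.inr (Or.inr ⟨hac, hc⟩)
    · rw [hπ a ha, hπ c hc] at hac
      exact Or.inl hac
  have hD : ∀ e, e ∉ ({h, h'} : Finset E) ↔ e ≠ h ∧ e ≠ h' := by simp
  have hDM : ∀ e z, e ∉ ({h, h'} : Finset E) → S.ends e = s(w, z) →
      e ∉ insert h (insert h' F) := by
    intro e z he hez
    rw [hD] at he
    rw [Finset.mem_insert, Finset.mem_insert]
    rintro (h | h | h)
    exacts [he.1 h, he.2 h, hwF e z hez h]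
  have key : ∀ z k k', k ∉ ({h, h'} : Finset E) → k' ∉ ({h, h'} : Finset E) →
      S.ends k = s(w, z) → S.ends k' = s(y, z) → S.gain k ≠ S.gain k' := by
    intro z k k' hk hk' hkz hkz' hg
    by_cases hzw : z = w
    · exact hnp k' ((hD k').1 hk').1 (by rw [hkz', hzw, Sym2.eq_swap])
    by_cases hzy : z = y
    · exact hnp k ((hD k).1 hk).1 (by rw [hkz, hzy])
    by_cases hzU : z ∈ U
    · have hkM := hDM k z hk hkz
      have h1 := hextra1 k w z hkM hkz hwA (Finset.mem_insert_of_mem hzU)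
      refine hextra2 k k' w z y z hkM (fun h => h1 (hg.trans (hM1 k' h))) ?_ hkz hkz' hwA
        (Finset.mem_insert_of_mem hzU) (Finset.mem_insert_of_mem hy)
        (Finset.mem_insert_of_mem hzU)
      rintro rfl
      rw [hkz, Sym2.eq_iff] at hkz'
      rcases hkz' with ⟨h, -⟩ | ⟨h, -⟩
      exacts [hwy h, hzw h.symm]
    · exact hmax z hzU hzw k k' hkz hkz' hg
  have hpar : ∀ e f, e ∉ ({h, h'} : Finset E) → f ∉ ({h, h'} : Finset E) → e ≠ f →
      (S.ends e).map π = (S.ends f).map π → S.gain e ≠ S.gain f := by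
    intro e f he hf hef hmap
    obtain ⟨a, b, hab⟩ := S.exists_ends_eq e
    obtain ⟨c, d, hcd⟩ := S.exists_ends_eq f
    obtain ⟨c, d, hcd, hac, hbd⟩ : ∃ c d, S.ends f = s(c, d) ∧ π a = π c ∧ π b = π d := by
      rw [hab, hcd, Sym2.map_mk, Sym2.map_mk, Sym2.eq_iff] at hmap
      rcases hmap with ⟨h1, h2⟩ | ⟨h1, h2⟩
      · exact ⟨c, d, hcd, h1, h2⟩
      · exact ⟨d, c, by rw [hcd, Sym2.eq_swap], h1, h2⟩
    have hloops : ∀ k k', k ∉ ({h, h'} : Finset E) → k' ∉ ({h, h'} : Finset E) →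
        S.ends k = s(w, w) → S.ends k' = s(y, y) → False := by
      intro k k' hk hk' hkw hky
      have hg := S.gain_of_loop k' (by rw [hky]; exact Sym2.diag_isDiag y)
      refine hextra2 k k' w w y y (hDM k w hk hkw) ?_ ?_ hkw hky hwA hwA
        (Finset.mem_insert_of_mem hy) (Finset.mem_insert_of_mem hy)
      · intro h
        rw [hM1 k' h] at hg
        exact absurd hg (by decide)
      · rintro rfl
        rw [hkw, Sym2.eq_iff] at hky
        simp [hwy] at hky
    have he1 := ((hD e).1 he).1
    rcases hπeq a c hac with rfl | ⟨rfl, rfl⟩ | ⟨rfl, rfl⟩ <;>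
      rcases hπeq b d hbd with rfl | ⟨rfl, rfl⟩ | ⟨rfl, rfl⟩
    · exact S.gain_ne_of_parallel e f hef (by rw [hab, hcd])
    · exact key a e f he hf (by rw [hab, Sym2.eq_swap]) (by rw [hcd, Sym2.eq_swap])
    · exact (key a f e hf he (by rw [hcd, Sym2.eq_swap]) (by rw [hab, Sym2.eq_swap])).symm
    · exact key b e f he hf hab hcd
    · exact (hloops e f he hf hab hcd).elim
    · exact absurd hab (hnp e he1)
    · exact (key b f e hf he hcd hab).symm
    · exact absurd (by rw [hab, Sym2.eq_swap]) (hnp e he1)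
    · exact (hloops f e hf he hcd hab).elim
  have hdiag : ∀ e, e ∉ ({h, h'} : Finset E) → ((S.ends e).map π).IsDiag → (S.ends e).IsDiag := by
    intro e he hd
    obtain ⟨a, b, hab⟩ := S.exists_ends_eq e
    have he1 := ((hD e).1 he).1
    rw [hab, Sym2.map_mk, Sym2.mk_isDiag_iff] at hd
    rcases hπeq a b hd with rfl | ⟨rfl, rfl⟩ | ⟨rfl, rfl⟩
    · rw [hab]; exact Sym2.diag_isDiag a
    · exact absurd hab (hnp e he1)
    · exact absurd (by rw [hab, Sym2.eq_swap]) (hnp e he1)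
  let T := S.collapse π {h, h'} hpar (fun e he hd => S.gain_of_loop e (hdiag e he hd))
  have hT : ∀ e, ∀ x ∈ T.ends e, x ∉ ({w} : Finset W) := by
    intro e x hx
    have hx : x ∈ (S.ends e.1).map π := hx
    obtain ⟨u, -, rfl⟩ := Sym2.mem_map.1 hx
    exact hπX u
  have hcW := card_compl_add_card ({w} : Finset W)
  have hcE := card_compl_add_card ({h, h'} : Finset E)
  rw [Finset.card_singleton] at hcW
  rw [Finset.card_pair hhh'] at hcE
  let π' : W → {x // x ∉ ({w} : Finset W)} := fun x => ⟨π x, hπX x⟩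
  have hr : ∀ e, (S.ends e.1).map π' = (T.restrict {w} hT).ends e := by
    intro e
    apply Sym2.map.injective Subtype.val_injective
    rw [restrict_ends hT, Sym2.map_map]
    rfl
  have hfD : f ∉ ({h, h'} : Finset E) := by
    rw [hD]
    constructor <;> rintro rfl
    exacts [hwF f y hhe hf, hwF f y' hhe' hf]
  have hπ'y : π' y = ⟨y, by simpa using hwy.symm⟩ := Subtype.ext (hπ y hwy.symm)
  refine ⟨_, _, T.restrict {w} hT, inferInstance, inferInstance, ⟨restrict_sparse hT ?_, ?_⟩, ?_,
    π' y, π' y', ⟨f, hfD⟩, π', Function.Embedding.subtype _, y, w, y', h, h', ?_, hF1 f hf,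
    ⟨?_, ?_⟩, hwy.symm, rfl, ?_, rfl, fun e => ⟨hr e, rfl, ?_⟩, hfe, hhh', ?_,
    by rw [hhe, Sym2.eq_swap], hh1, hhe', hh1'⟩
  · intro U₀ F₀ hU₀ hUX hF₀
    have hwU : w ∉ U₀ := fun h => hUX w h (Finset.mem_singleton_self w)
    obtain ⟨F', hF'⟩ : ∃ F', F' =
        F₀.map (Function.Embedding.subtype fun e => e ∉ ({h, h'} : Finset E)) := ⟨_, rfl⟩
    have hFπ : ∀ e ∈ F', ∀ x ∈ S.ends e, π x ∈ U₀ := by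
      intro e he x hx
      rw [hF'] at he
      obtain ⟨e, he', rfl⟩ := Finset.mem_map.1 he
      exact hF₀ e he' _ (Sym2.mem_map.2 ⟨x, hx, rfl⟩)
    have hpot : ∀ s, T.IsPotential s F₀ → S.IsPotential (s ∘ π) F' := by
      intro s hs e he a b hab
      rw [hF'] at he
      obtain ⟨e, he', rfl⟩ := Finset.mem_map.1 he
      refine hs e he' (π a) (π b) ?_
      change (S.ends e.1).map π = _
      have hab : S.ends e.1 = s(a, b) := hab
      rw [hab, Sym2.map_mk]
    have hc' : F'.card = F₀.card := by rw [hF']; exact Finset.card_map _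
    have hF'D : ∀ e ∈ F', e ≠ h ∧ e ≠ h' := by
      intro e he
      rw [hF'] at he
      obtain ⟨e, -, rfl⟩ := Finset.mem_map.1 he
      exact (hD e.1).1 e.2
    have hhF' : h ∉ F' := fun hh => (hF'D h hh).1 rfl
    have hhF'' : h' ∉ F' := fun hh => (hF'D h' hh).2 rfl
    by_cases hyU : y ∈ U₀
    · have hcA := Finset.card_insert_of_notMem hwU
      have hwA₀ := Finset.mem_insert_self w U₀
      have hyA₀ : y ∈ insert w U₀ := Finset.mem_insert_of_mem hyU
      have hW₀ : S.Within (insert w U₀) F' := by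
        intro e he x hx
        by_cases hxw : x = w
        · rw [hxw]; exact hwA₀
        · have := hFπ e he x hx
          rw [hπ x hxw] at this
          exact Finset.mem_insert_of_mem this
      have hsh : ∀ s : W → ℤˣ, S.gain h = (s ∘ π) w * (s ∘ π) y := by
        intro s
        simp only [Function.comp]
        rw [hπw, hπ y hwy.symm, Int.units_mul_self, hh1]
      by_cases hyU' : y' ∈ U₀
      · -- Both new edges can be added to the preimage.
        have hyA₀' : y' ∈ insert w U₀ := Finset.mem_insert_of_mem hyU'
        have hW₁ : S.Within (insert w U₀) (insert h (insert h' F')) :=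
          within_insert (within_insert hW₀ hhe' hwA₀ hyA₀') hhe hwA₀ hyA₀
        have hc₁ : (insert h (insert h' F')).card = F'.card + 2 := by
          rw [Finset.card_insert_of_notMem (by simp [hhh', hhF']),
            Finset.card_insert_of_notMem hhF'']
        have key₁ := hS.1 _ _ ⟨w, hwA₀⟩ hW₁
        refine ⟨by omega, fun ⟨s, hs⟩ => ?_⟩
        by_cases hsy : s y = s y'
        · have := key₁.2 ⟨s ∘ π, ((hpot s hs).insert hhe' ?_).insert hhe (hsh s)⟩
          · omega
          · simp only [Function.comp]
            rw [hπw, hπ y' hwy'.symm, hsy, Int.units_mul_self, hh1']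
        · -- If the potential is inconsistent with `f`, then `f` can be added, too.
          have hfF' : f ∉ F' := by
            intro hfF'
            have := hpot s hs f hfF' y y' hfe
            simp only [Function.comp] at this
            rw [hπ y hwy.symm, hπ y' hwy'.symm, hF1 f hf] at this
            exact hsy (by rw [units_mul_eq this.symm, one_mul])
          have := (hS.1 _ _ ⟨w, hwA₀⟩ (within_insert hW₁ hfe hyA₀ hyA₀')).1
          rw [Finset.card_insert_of_notMem] at this
          · omega
          · have := (hD f).1 hfD
            simp [this.1, this.2, hfF']
      · -- Otherwise an obstruction could be enlarged by the tight set and `h'`.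
        have hW₁ : S.Within (insert w U₀) (insert h F') := within_insert hW₀ hhe hwA₀ hyA₀
        have hc₁ := Finset.card_insert_of_notMem hhF'
        have hW₂ := within_insert (within_union hW₁ hF) hhe' (Finset.mem_union_left U hwA₀)
          (Finset.mem_union_right _ hy')
        have hc₂ : (insert h' (insert h F' ∪ F)).card = (insert h F' ∪ F).card + 1 := by
          rw [Finset.card_insert_of_notMem]
          simp [hhh'.symm, hhF'', hwF h' y' hhe']
        have hpot1 : S.IsPotential (fun _ => 1) F := fun e he _ _ _ => by
          rw [hF1 e he]; rfl
        have key₂ := hS.1 _ _ ⟨w, Finset.mem_union_left U hwA₀⟩ hW₂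
        refine ⟨?_, fun ⟨s, hs⟩ => ?_⟩
        · by_contra hcon
          have := hS.1.union_balanced_right hW₁ hF hyA₀ hy hpot1 (by omega) hUF
          omega
        · by_contra hcon
          obtain ⟨t, ε, ht, hct, htA, htU⟩ := hS.1.union_balanced hW₁ hF hyA₀ hy
            ((hpot s hs).insert hhe (hsh s)) hpot1 (by omega) hUF
          have := key₂.2 ⟨t, ht.insert hhe' ?_⟩
          · omega
          · have h1 := htA y hyA₀
            have h2 := htA w hwA₀
            simp only [Function.comp] at h1 h2
            rw [hπ y hwy.symm] at h1
            rw [hπw, ← h1, htU y hy] at h2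
            rw [h2, htU y' hy', Int.units_mul_self, hh1']
    · have key₀ := hS.1 U₀ F' hU₀ (by
        intro e he x hx
        have := hFπ e he x hx
        by_cases hxw : x = w
        · rw [hxw, hπw] at this
          exact absurd this hyU
        · rwa [hπ x hxw] at this)
      exact ⟨by omega, fun ⟨s, hs⟩ => by have := key₀.2 ⟨_, hpot s hs⟩; omega⟩
  · have := hS.2
    omega
  · omega
  · rw [← hr, hfe, Sym2.map_mk]
  · have : π' ⁻¹' {π' y} = {w, y} := by
      ext x
      rw [Set.mem_preimage, Set.mem_singleton_iff, hπ'y, Subtype.mk.injEq]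
      by_cases hx : x = w
      · simp [hx, hπw]
      · simp [hπ x hx, hx]
    rw [this, Set.ncard_pair hwy]
  · rintro ⟨x, hx⟩ hne
    have hxw : x ≠ w := by simpa using hx
    refine ⟨x, Subtype.ext (hπ x hxw), fun u hu => ?_⟩
    have hu : π u = x := congrArg Subtype.val hu
    by_cases huw : u = w
    · rw [huw, hπw] at hu
      exact absurd (by rw [hπ'y]; exact Subtype.ext hu.symm) hne
    · rwa [hπ u huw] at hu
  · exact Subtype.ext (hπw.trans (hπ y hwy.symm).symm)
  · intro hd
    refine hdiag e.1 e.2 ?_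
    change (T.ends e).IsDiag
    rw [← restrict_ends hT]
    exact (Sym2.isDiag_map Subtype.val_injective).2 hd
  · ext e
    simp

end EdgeContraction

/-! ### Gain-tight signed graphs are constructible -/

section Construction

universe u

variable {W E : Type u} {S : SignedGraph W E}

/-- There is a balanced tight set with vertex set `U`, and a vertex `w` outside of `U` that is
attached to an edge `yy'` of it by a balanced triangle. -/
def HasAttachedTriangle (S : SignedGraph W E) (U : Finset W) : Prop :=
  ∃ (F : Finset E) (s : W → ℤˣ) (w y y' : W) (f h h' : E), S.Within U F ∧ S.IsPotential s F ∧
    2 * U.card ≤ F.card + 2 ∧ f ∈ F ∧ S.ends f = s(y, y') ∧ w ∉ U ∧ S.ends h = s(w, y) ∧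
    S.gain h = s w * s y ∧ S.ends h' = s(w, y') ∧ S.gain h' = s w * s y'

/-- A signed graph containing a balanced tight set with an attached balanced triangle is obtained
by vertex splitting, up to switching: take such a tight set of maximal size. -/
theorem Tight.constructible_of_hasAttachedTriangle [Fintype W] [Fintype E]
    (hS : S.Tight) {U : Finset W} (hU : S.HasAttachedTriangle U)
    (ih : ∀ (W₀ E₀ : Type u) (S₀ : SignedGraph W₀ E₀), Finite W₀ → Finite E₀ → S₀.Tight →
      Nat.card W₀ < Nat.card W → S₀.Constructible) : S.Constructible := by
  classical
  obtain ⟨U, hU, hmax⟩ := Finset.exists_max_image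
    (Finset.univ.filter fun U => S.HasAttachedTriangle U) Finset.card
    ⟨U, Finset.mem_filter.2 ⟨Finset.mem_univ U, hU⟩⟩
  have hmax : ∀ U', S.HasAttachedTriangle U' → U'.card ≤ U.card := fun U' h =>
    hmax U' (Finset.mem_filter.2 ⟨Finset.mem_univ U', h⟩)
  obtain ⟨F, s, w, y, y', f, h, h', hF, hs, hUF, hf, hfe, hw, hhe, hhg, hhe', hhg'⟩ :=
    (Finset.mem_filter.1 hU).2
  -- The statement for `h`; it is also applied with `h` and `h'` exchanged.
  have main : ∀ (y y' : W) (h h' : E), S.ends f = s(y, y') → S.ends h = s(w, y) →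
      S.gain h = s w * s y → S.ends h' = s(w, y') → S.gain h' = s w * s y' →
      (∀ k, k ≠ h → S.ends k ≠ s(w, y)) → S.Constructible := by
    intro y y' h h' hfe hhe hhg hhe' hhg' hnp
    have hy : y ∈ U := hF.mem_left hf hfe
    have hy' : y' ∈ U := hF.mem_right hf hfe
    have hsw : ∀ {e a b}, S.ends e = s(a, b) → S.gain e = s a * s b → (S.switch s).gain e = 1 := by
      intro e a b he hg
      rw [switch_gain S s he, hg, Int.units_mul_self]
    have hyy' : y ≠ y' := by
      rintro rfl
      have h1 := S.gain_of_loop f (by rw [hfe]; exact Sym2.diag_isDiag y)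
      rw [hs f hf _ _ hfe, Int.units_mul_self] at h1
      exact absurd h1 (by decide)
    have hhh' : h ≠ h' := by
      rintro rfl
      rw [hhe, Sym2.eq_iff] at hhe'
      rcases hhe' with ⟨-, h⟩ | ⟨h, -⟩
      exacts [hyy' h, hw (h ▸ hy')]
    obtain ⟨W₀, E₀, S₀, hW₀, hE₀, hS₀, hlt, hmove⟩ := (hS.switch s).exists_isVertexSplitting
      (U := U) (F := F) hF (fun e he => hs.switch he) hUF hf hfe hw hhe (hsw hhe hhg) hhe'
      (hsw hhe' hhg') hnp (by
        -- Another balanced triangle on `h` would be attached to the tight set enlarged by `w`.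
        intro z hz hzw k k' hk hk' hg
        rw [switch_gain S s hk, switch_gain S s hk'] at hg
        have hzA : z ∉ insert w U := by simp [hz, hzw]
        have hwF : ∀ e x, S.ends e = s(w, x) → e ∉ F := fun e x he heF => hw (hF.mem_left heF he)
        have hle := hmax (insert w U) ⟨insert h (insert h' F),
          Function.update s z (s w * S.gain k), z, w, y, h, k, k', ?_, ?_, ?_,
          Finset.mem_insert_self _ _, hhe, hzA, hk.trans Sym2.eq_swap, ?_,
          hk'.trans Sym2.eq_swap, ?_⟩
        · rw [Finset.card_insert_of_notMem hw] at hle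
          omega
        · exact within_insert (within_insert (hF.mono (Finset.subset_insert _ _) subset_rfl) hhe'
            (Finset.mem_insert_self _ _) (Finset.mem_insert_of_mem hy')) hhe
            (Finset.mem_insert_self _ _) (Finset.mem_insert_of_mem hy)
        · refine IsPotential.congr (U := insert w U) (s := s)
            ((hs.insert hhe' hhg').insert hhe hhg) ?_ ?_
          · exact within_insert (within_insert (hF.mono (Finset.subset_insert _ _) subset_rfl)
              hhe' (Finset.mem_insert_self _ _) (Finset.mem_insert_of_mem hy')) hhe
              (Finset.mem_insert_self _ _) (Finset.mem_insert_of_mem hy)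
          · intro u hu
            rw [Function.update_of_ne]
            rintro rfl
            exact hzA hu
        · rw [Finset.card_insert_of_notMem hw, Finset.card_insert_of_notMem
            (by simp [hhh', hwF h y hhe]), Finset.card_insert_of_notMem (hwF h' y' hhe')]
          omega
        · rw [Function.update_self, Function.update_of_ne (Ne.symm hzw), mul_right_comm,
            Int.units_mul_self, one_mul]
        · have hzy : y ≠ z := fun h => hz (h ▸ hy)
          rw [Function.update_self, Function.update_of_ne hzy]
          have h1 : S.gain k * s w = S.gain k' * s y := by
            rw [← mul_assoc, ← mul_assoc] at hg
            exact mul_right_cancel hg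
          rw [mul_comm (s w), h1, mul_assoc, Int.units_mul_self, mul_one])
    have h1 := (Constructible.vertexSplitting (ih W₀ E₀ S₀ hW₀ hE₀ hS₀ hlt) hmove).switch s
    rwa [switch_switch_self] at h1
  have hy : y ∈ U := hF.mem_left hf hfe
  have hy' : y' ∈ U := hF.mem_right hf hfe
  have hyy' : y ≠ y' := by
    rintro rfl
    have h1 := S.gain_of_loop f (by rw [hfe]; exact Sym2.diag_isDiag y)
    rw [hs f hf _ _ hfe, Int.units_mul_self] at h1
    exact absurd h1 (by decide)
  by_cases hnp : ∀ k, k ≠ h → S.ends k ≠ s(w, y)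
  · exact main y y' h h' hfe hhe hhg hhe' hhg' hnp
  by_cases hnp' : ∀ k, k ≠ h' → S.ends k ≠ s(w, y')
  · exact main y' y h' h (by rw [hfe, Sym2.eq_swap]) hhe' hhg' hhe hhg hnp'
  -- Two pairs of parallel edges at `w` violate sparsity.
  exfalso
  push Not at hnp hnp'
  obtain ⟨k, hk, hke⟩ := hnp
  obtain ⟨k', hk', hke'⟩ := hnp'
  have hwA := Finset.mem_insert_self w U
  have hyA : y ∈ insert w U := Finset.mem_insert_of_mem hy
  have hyA' : y' ∈ insert w U := Finset.mem_insert_of_mem hy'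
  have hne : ∀ {a b}, S.ends a = s(w, y) → S.ends b = s(w, y') → a ≠ b := by
    rintro a b ha hb rfl
    rw [ha, Sym2.eq_iff] at hb
    rcases hb with ⟨-, h⟩ | ⟨h, -⟩
    exacts [hyy' h, hw (h ▸ hy')]
  have hwF : ∀ e x, S.ends e = s(w, x) → e ∉ F := fun e x he heF => hw (hF.mem_left heF he)
  have := (hS.1 _ _ ⟨w, hwA⟩ (within_insert (within_insert (within_insert (within_insert
    (hF.mono (Finset.subset_insert w U) subset_rfl) hhe' hwA hyA') hke' hwA hyA') hhe hwA hyA)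
      hke hwA hyA)).1
  rw [Finset.card_insert_of_notMem hw, Finset.card_insert_of_notMem, Finset.card_insert_of_notMem,
    Finset.card_insert_of_notMem, Finset.card_insert_of_notMem] at this
  · omega
  · exact hwF _ _ hhe'
  · simp [hk', hwF _ _ hke']
  · simp [hne hhe hke', hne hhe hhe', hwF _ _ hhe]
  · simp [hk, hne hke hke', hne hke hhe', hwF _ _ hke]

/-- A signed graph containing a balanced `K₄` is obtained by a vertex-to-`K₄` move or by vertex
splitting, up to switching. -/
theorem Tight.constructible_of_isK4 [Fintype W] [Fintype E]
    (hS : S.Tight) {s : W → ℤˣ} {K : Finset W} (hK : S.IsK4 s K)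
    (ih : ∀ (W₀ E₀ : Type u) (S₀ : SignedGraph W₀ E₀), Finite W₀ → Finite E₀ → S₀.Tight →
      Nat.card W₀ < Nat.card W → S₀.Constructible) : S.Constructible := by
  classical
  have hS' := hS.switch s
  have hK' : (S.switch s).IsK4 (fun _ => 1) K := by
    refine ⟨hK.1, fun y hy z hz hyz => ?_⟩
    obtain ⟨f, hf, hfg⟩ := hK.2 y hy z hz hyz
    exact ⟨f, hf, by rw [switch_gain S s hf, hfg, Int.units_mul_self, mul_one]⟩
  suffices h : (S.switch s).Constructible by
    have := h.switch s
    rwa [switch_switch_self] at this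
  by_cases hx : ∀ x ∉ K, ∀ y ∈ K, ∀ z ∈ K, ∀ f g, f ≠ g → (S.switch s).ends f = s(x, y) →
      (S.switch s).ends g = s(x, z) → (S.switch s).gain f ≠ (S.switch s).gain g
  · obtain ⟨W₀, E₀, S₀, hW₀, hE₀, hS₀, hlt, hmove⟩ := hS'.exists_isVertexToK4 hK' hx
    exact Constructible.vertexToK4 (ih W₀ E₀ S₀ hW₀ hE₀ hS₀ hlt) hmove
  -- Otherwise a balanced triangle is attached to an edge of the `K₄`.
  · push Not at hx
    obtain ⟨x, hxK, y, hy, z, hz, h, h', hne, hhe, hhe', hg⟩ := hx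
    obtain ⟨D, hD6, hDK, hDg, -, hDs⟩ := hK'.exists_edges hS'.1
    have hyz : y ≠ z := by
      rintro rfl
      exact (S.switch s).gain_ne_of_parallel h h' hne (by rw [hhe, hhe']) hg
    obtain ⟨f, hf, hfe⟩ := hDs y hy z hz hyz
    have hsne : ∀ u ∈ K, u ≠ x := fun u hu h => hxK (h ▸ hu)
    refine hS'.constructible_of_hasAttachedTriangle (U := K) ⟨D,
      Function.update (fun _ => 1) x ((S.switch s).gain h), x, y, z, f, h, h', hDK, ?_, ?_, hf,
      hfe, hxK, hhe, ?_, hhe', ?_⟩ ih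
    · refine IsPotential.congr (U := K) (s := fun _ => 1)
        (fun e he _ _ _ => by rw [hDg e he]; rfl) hDK fun u hu => ?_
      rw [Function.update_of_ne (hsne u hu)]
    · rw [hK.1, hD6]
    · rw [Function.update_self, Function.update_of_ne (hsne y hy), mul_one]
    · rw [Function.update_self, Function.update_of_ne (hsne z hz), mul_one, hg]

theorem Tight.isSingleLoop (hS : S.Tight) (hW : Nat.card W = 1) : S.IsSingleLoop := by
  have hE : Nat.card E = 1 := by have := hS.2; omega
  rw [Nat.card_eq_one_iff_exists] at hW hE
  obtain ⟨v, hv⟩ := hW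
  obtain ⟨e, he⟩ := hE
  obtain ⟨a, b, hab⟩ := S.exists_ends_eq e
  exact ⟨v, e, hv, he, by rw [hab, hv a, hv b]⟩

/-- By induction on the number of vertices: every tight signed graph with more than one vertex
arises from a smaller one by one of the four kinds of moves, up to switching. -/
theorem Tight.constructible_of_card : ∀ (n : ℕ) (W E : Type u) (S : SignedGraph W E), Finite W →
    Finite E → S.Tight → Nat.card W = n → S.Constructible := by
  classical
  intro n
  induction n using Nat.strong_induction_on with
  | _ n ih =>
  intro W E S hWf hEf hS hn
  have := Fintype.ofFinite W
  have := Fintype.ofFinite E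
  have ih : ∀ (W₀ E₀ : Type u) (S₀ : SignedGraph W₀ E₀), Finite W₀ → Finite E₀ → S₀.Tight →
      Nat.card W₀ < Nat.card W → S₀.Constructible :=
    fun W₀ E₀ S₀ hW₀ hE₀ hS₀ hlt => ih _ (hn ▸ hlt) W₀ E₀ S₀ hW₀ hE₀ hS₀ rfl
  rcases Nat.lt_or_ge 1 (Nat.card W) with hW | hW
  · obtain ⟨v, hv⟩ := hS.exists_card_star_le
    rcases hv with hv | ⟨hv, hloop⟩
    · obtain ⟨W₀, E₀, S₀, hW₀, hE₀, hS₀, hlt, hmove⟩ := hS.exists_isH1 hW hv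
      exact Constructible.henneberg1 (ih W₀ E₀ S₀ hW₀ hE₀ hS₀ hlt) hmove
    · let φ := (S.star v).equivFinOfCardEq hv
      let e : Fin 3 → E := fun i => (φ.symm i).1
      have hev : ∀ i, v ∈ S.ends (e i) := fun i => mem_star.1 (φ.symm i).2
      have hea : ∀ i, ∃ a, S.ends (e i) = s(v, a) := fun i => by
        obtain ⟨a, ha⟩ := hev i
        exact ⟨a, ha⟩
      choose a ha using hea
      have hmem : ∀ f, v ∈ S.ends f ↔ ∃ i, f = e i := by
        intro f
        constructor
        · intro hf
          exact ⟨φ ⟨f, mem_star.2 hf⟩, by simp [e]⟩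
        · rintro ⟨i, rfl⟩
          exact hev i
      have hclaw : S.IsClaw v e a := ⟨Subtype.val_injective.comp φ.symm.injective, hmem, ha,
        fun i hi => hloop (e i) (by rw [ha, hi])⟩
      rcases hclaw.exists_not_blocks_or_isK4 hS.1 with ⟨i, j, hij, hb, hP⟩ | ⟨s, K, hK⟩
      · obtain ⟨k, hki, hkj, hijk⟩ : ∃ k, k ≠ i ∧ k ≠ j ∧ ∀ l, l = i ∨ l = j ∨ l = k := by
          clear hb hP; revert i j; decide
        obtain ⟨W₀, E₀, S₀, hW₀, hE₀, hS₀, hlt, hmove⟩ := hS.exists_isH2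
          (hclaw.injective.ne hij) (hclaw.injective.ne hki.symm) (hclaw.injective.ne hkj.symm)
          (by
            ext f
            rw [mem_star, hmem]
            simp only [Finset.mem_insert, Finset.mem_singleton]
            constructor
            · rintro ⟨l, rfl⟩
              rcases hijk l with rfl | rfl | rfl <;> simp
            · rintro (rfl | rfl | rfl) <;> exact ⟨_, rfl⟩)
          (ha i) (ha j) (ha k) (hclaw.ne i) (hclaw.ne j) (hclaw.ne k)
          (fun f hf hg => hP ⟨f, hf, hg⟩) hb
        exact Constructible.henneberg2 (ih W₀ E₀ S₀ hW₀ hE₀ hS₀ hlt) hmove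
      · exact hS.constructible_of_isK4 hK ih
  · have h1 : Nat.card W = 1 := by
      have := hS.2
      omega
    exact Constructible.loop (hS.isSingleLoop h1)

theorem GainTight.constructible [Finite W] [Finite E] (hS : S.GainTight) : S.Constructible :=
  Tight.constructible_of_card _ W E S inferInstance inferInstance
    ⟨hS.1.sparse, by have := hS.2; omega⟩ rfl

end Construction

end SignedGraph

/-! ### Realisations of signed graphs in the plane -/

/-- A sign as a real number. -/
def signReal (g : ℤˣ) : ℝ := ((g : ℤ) : ℝ)

theorem signReal_one : signReal 1 = 1 := by simp [signReal]

theorem signReal_neg_one : signReal (-1) = -1 := by simp [signReal]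

theorem signReal_mul (g h : ℤˣ) : signReal (g * h) = signReal g * signReal h := by
  simp [signReal]

theorem signReal_mul_self (g : ℤˣ) : signReal g * signReal g = 1 := by
  rw [← signReal_mul, Int.units_mul_self, signReal_one]

theorem signReal_mul_self_mul (g : ℤˣ) (r : ℝ) : signReal g * (signReal g * r) = r := by
  rw [← mul_assoc, signReal_mul_self, one_mul]

theorem abs_signReal (g : ℤˣ) : |signReal g| = 1 := by
  rcases Int.units_eq_one_or g with rfl | rfl <;> simp [signReal]

theorem signReal_eq_neg_of_ne {g h : ℤˣ} (hgh : g ≠ h) : signReal g = -signReal h := by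
  rcases Int.units_eq_one_or g with rfl | rfl <;> rcases Int.units_eq_one_or h with rfl | rfl <;>
    simp_all [signReal]

theorem signReal_ne_zero (g : ℤˣ) : signReal g ≠ 0 := fun h => by
  have := signReal_mul_self g
  rw [h, mul_zero] at this
  exact zero_ne_one this

theorem abs_sub_signReal_mul (g : ℤˣ) (r s : ℝ) : |s - signReal g * r| = |r - signReal g * s| := by
  rw [show s - signReal g * r = -(signReal g * (r - signReal g * s)) by
    rw [mul_sub, signReal_mul_self_mul]; ring, abs_neg, abs_mul, abs_signReal, one_mul]

namespace SignedGraph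

section Realization

variable {W E : Type*}

/-- The horizontal length of the edges in the orbit `e` of the covering framework in which the
orbit representatives are placed at the points `(x w, y w)`, and `ℤ₂` acts by `(ξ, η) ↦ (-ξ, η)`. -/
def hlen (S : SignedGraph W E) (x : W → ℝ) (e : E) : ℝ :=
  Sym2.lift ⟨fun a b => |x a - signReal (S.gain e) * x b|,
    fun a b => abs_sub_signReal_mul (S.gain e) (x b) (x a)⟩ (S.ends e)

/-- The vertical length of an edge. -/
def vlen (S : SignedGraph W E) (y : W → ℝ) (e : E) : ℝ :=
  Sym2.lift ⟨fun a b => |y a - y b|, fun a b => abs_sub_comm (y a) (y b)⟩ (S.ends e)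

variable {S : SignedGraph W E}

theorem hlen_eq {e : E} {a b : W} (h : S.ends e = s(a, b)) (x : W → ℝ) :
    S.hlen x e = |x a - signReal (S.gain e) * x b| := by
  rw [hlen, h]; rfl

theorem vlen_eq {e : E} {a b : W} (h : S.ends e = s(a, b)) (y : W → ℝ) :
    S.vlen y e = |y a - y b| := by
  rw [vlen, h]; rfl

theorem hlen_map {W' E' : Type*} {S' : SignedGraph W' E'} {e : E} {e' : E'} {f : W → W'}
    (h : S'.ends e' = (S.ends e).map f) (hg : S'.gain e' = S.gain e) (x : W' → ℝ) :
    S'.hlen x e' = S.hlen (x ∘ f) e := by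
  obtain ⟨a, b, hab⟩ : ∃ a b, S.ends e = s(a, b) := by
    obtain ⟨⟨a, b⟩, hab⟩ := Quot.exists_rep (S.ends e)
    exact ⟨a, b, hab.symm⟩
  rw [hab, Sym2.map_mk] at h
  rw [hlen_eq h, hlen_eq hab, hg]
  rfl

theorem vlen_map {W' E' : Type*} {S' : SignedGraph W' E'} {e : E} {e' : E'} {f : W → W'}
    (h : S'.ends e' = (S.ends e).map f) (y : W' → ℝ) :
    S'.vlen y e' = S.vlen (y ∘ f) e := by
  obtain ⟨a, b, hab⟩ : ∃ a b, S.ends e = s(a, b) := by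
    obtain ⟨⟨a, b⟩, hab⟩ := Quot.exists_rep (S.ends e)
    exact ⟨a, b, hab.symm⟩
  rw [hab, Sym2.map_mk] at h
  rw [vlen_eq h, vlen_eq hab]
  rfl

theorem continuous_hlen (S : SignedGraph W E) (e : E) : Continuous fun x => S.hlen x e := by
  obtain ⟨⟨a, b⟩, hab⟩ := Quot.exists_rep (S.ends e)
  have hab : S.ends e = s(a, b) := hab.symm
  simp only [hlen_eq hab]
  fun_prop

theorem continuous_vlen (S : SignedGraph W E) (e : E) : Continuous fun y => S.vlen y e := by
  obtain ⟨⟨a, b⟩, hab⟩ := Quot.exists_rep (S.ends e)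
  have hab : S.ends e = s(a, b) := hab.symm
  simp only [vlen_eq hab]
  fun_prop

/-- `(u₁, u₂)` is a symmetric infinitesimal flex for the edges in `D`, where the edges with `c`
constrain the first coordinate and the other edges constrain the second coordinate. -/
def IsFlex (S : SignedGraph W E) (c : E → Prop) (D : Set E) (u₁ u₂ : W → ℝ) : Prop :=
  ∀ e ∈ D, ∀ a b, S.ends e = s(a, b) →
    (c e → u₁ a = signReal (S.gain e) * u₁ b) ∧ (¬ c e → u₂ a = u₂ b)

/-- The only flexes are translations in the second coordinate. -/
def IsRigid (S : SignedGraph W E) (c : E → Prop) (D : Set E) : Prop :=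
  ∀ u₁ u₂ : W → ℝ, S.IsFlex c D u₁ u₂ → (∀ a, u₁ a = 0) ∧ ∀ a b, u₂ a = u₂ b

/-- The points `(x w, y w)` are the positions of the orbit representatives in a well-positioned
and symmetrically infinitesimally rigid covering framework. -/
structure IsRealization (S : SignedGraph W E) (x y : W → ℝ) : Prop where
  hlen_ne_vlen : ∀ e, S.hlen x e ≠ S.vlen y e
  isRigid : S.IsRigid (fun e => S.vlen y e < S.hlen x e) Set.univ

/-- It suffices to check the flex condition for one orientation of each edge. -/
theorem flex_edge {e : E} {a b : W} (h : S.ends e = s(a, b)) {c : Prop} {u₁ u₂ : W → ℝ}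
    (h₁ : c → u₁ a = signReal (S.gain e) * u₁ b) (h₂ : ¬ c → u₂ a = u₂ b) (a' b' : W)
    (h' : S.ends e = s(a', b')) :
    (c → u₁ a' = signReal (S.gain e) * u₁ b') ∧ (¬ c → u₂ a' = u₂ b') := by
  rw [h, Sym2.eq_iff] at h'
  rcases h' with ⟨rfl, rfl⟩ | ⟨rfl, rfl⟩
  · exact ⟨h₁, h₂⟩
  · exact ⟨fun hc => by rw [h₁ hc, signReal_mul_self_mul], fun hc => (h₂ hc).symm⟩

variable {x y : W → ℝ}

/-- Being a realisation is an open condition. -/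
theorem IsRealization.eventually [Finite E] (h : S.IsRealization x y) {ι : Type*} {l : Filter ι}
    {x' y' : ι → W → ℝ} (hx : Tendsto x' l (𝓝 x)) (hy : Tendsto y' l (𝓝 y)) :
    ∀ᶠ t in l, S.IsRealization (x' t) (y' t) := by
  have hx' : ∀ e, Tendsto (fun t => S.hlen (x' t) e) l (𝓝 (S.hlen x e)) :=
    fun e => ((S.continuous_hlen e).tendsto x).comp hx
  have hy' : ∀ e, Tendsto (fun t => S.vlen (y' t) e) l (𝓝 (S.vlen y e)) :=
    fun e => ((S.continuous_vlen e).tendsto y).comp hy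
  have key : ∀ᶠ t in l, ∀ e, S.hlen (x' t) e ≠ S.vlen (y' t) e ∧
      (S.vlen (y' t) e < S.hlen (x' t) e ↔ S.vlen y e < S.hlen x e) := by
    rw [eventually_all]
    intro e
    rcases lt_or_gt_of_ne (h.hlen_ne_vlen e) with h1 | h1
    · filter_upwards [(hx' e).eventually_lt (hy' e) h1] with t ht
      exact ⟨ht.ne, iff_of_false ht.not_gt h1.not_gt⟩
    · filter_upwards [(hy' e).eventually_lt (hx' e) h1] with t ht
      exact ⟨ht.ne', iff_of_true ht h1⟩
  filter_upwards [key] with t ht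
  refine ⟨fun e => (ht e).1, ?_⟩
  have : (fun e => S.vlen (y' t) e < S.hlen (x' t) e) = fun e => S.vlen y e < S.hlen x e :=
    funext fun e => propext (ht e).2
  rw [this]
  exact h.isRigid

theorem eventually_affine_ne_zero (α : ℝ) {β : ℝ} (hβ : β ≠ 0) :
    ∀ᶠ t in 𝓝[≠] (0 : ℝ), α + t * β ≠ 0 := by
  by_cases hα : α = 0
  · filter_upwards [self_mem_nhdsWithin] with t ht
    rw [hα, zero_add]
    exact mul_ne_zero ht hβ
  · have hc : Continuous fun t : ℝ => α + t * β := by fun_prop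
    have : Tendsto (fun t : ℝ => α + t * β) (𝓝[≠] 0) (𝓝 α) := by
      have := hc.tendsto 0
      simp only [zero_mul, add_zero] at this
      exact this.mono_left nhdsWithin_le_nhds
    exact this.eventually_ne hα

theorem tendsto_add_smul {ι : Type*} (x k : ι → ℝ) (s : Set ℝ) :
    Tendsto (fun (t : ℝ) w => x w + t * k w) (𝓝[s] 0) (𝓝 x) := by
  have hc : Continuous fun (t : ℝ) w => x w + t * k w := by fun_prop
  have := hc.tendsto 0
  simp only [zero_mul, add_zero] at this
  exact this.mono_left nhdsWithin_le_nhds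

/-- A realisation can be perturbed into one in which the points of the covering framework are in
general position with respect to both coordinates. -/
theorem IsRealization.exists_generic [Finite W] [Finite E] (h : S.IsRealization x y) :
    ∃ x y, S.IsRealization x y ∧ (∀ a, x a ≠ 0) ∧
      (∀ a b, a ≠ b → ∀ g h : ℤˣ, signReal g * x a ≠ signReal h * x b) ∧
      ∀ a b, a ≠ b → y a ≠ y b := by
  have := Fintype.ofFinite W
  let k : W → ℝ := fun w => ((Fintype.equivFin W w : ℕ) : ℝ) + 1
  have hk0 : ∀ w, 0 < k w := fun w => by positivity
  have hkinj : ∀ a b, a ≠ b → k a ≠ k b := by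
    intro a b hab hk
    apply hab
    apply (Fintype.equivFin W).injective
    apply Fin.ext
    simpa [k] using hk
  have h1 := h.eventually (tendsto_add_smul x k {0}ᶜ) (tendsto_add_smul y k {0}ᶜ)
  have h2 : ∀ᶠ t in 𝓝[≠] (0 : ℝ), ∀ a, x a + t * k a ≠ 0 :=
    eventually_all.2 fun a => eventually_affine_ne_zero _ (hk0 a).ne'
  have h3 : ∀ᶠ t in 𝓝[≠] (0 : ℝ), ∀ a b, a ≠ b → ∀ g h : ℤˣ,
      signReal g * (x a + t * k a) ≠ signReal h * (x b + t * k b) := by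
    simp only [eventually_all]
    intro a b hab g h
    have hne : signReal g * k a - signReal h * k b ≠ 0 := by
      intro h0
      have h0 := congrArg abs (sub_eq_zero.1 h0)
      rw [abs_mul, abs_mul, abs_signReal, abs_signReal, one_mul, one_mul, abs_of_pos (hk0 a),
        abs_of_pos (hk0 b)] at h0
      exact hkinj a b hab h0
    filter_upwards [eventually_affine_ne_zero (signReal g * x a - signReal h * x b) hne]
      with t ht ht'
    exact ht (by linear_combination ht')
  have h4 : ∀ᶠ t in 𝓝[≠] (0 : ℝ), ∀ a b, a ≠ b → y a + t * k a ≠ y b + t * k b := by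
    simp only [eventually_all]
    intro a b hab
    filter_upwards [eventually_affine_ne_zero (y a - y b) (sub_ne_zero.2 (hkinj a b hab))]
      with t ht ht'
    exact ht (by linear_combination ht')
  obtain ⟨t, h1, h2, h3, h4⟩ := (h1.and (h2.and (h3.and h4))).exists
  exact ⟨_, _, h1, h2, h3, h4⟩

end Realization

/-! ### Henneberg moves preserve realisability -/

section Henneberg

variable {W E W' E' : Type*} {S : SignedGraph W E} {S' : SignedGraph W' E'}

/-- The horizontal double cone at one point meets the vertical double cone at another point. -/
theorem exists_mem_cones {p q r s : ℝ} (h : p ≠ r ∨ q ≠ s) :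
    ∃ ξ η : ℝ, |η - q| < |ξ - p| ∧ |ξ - r| < |η - s| := by
  -- The two coordinate reflections reduce the claim to `r ≤ p` and `s ≤ q`.
  have base : ∀ p q r s : ℝ, (p ≠ r ∨ q ≠ s) → r ≤ p → s ≤ q →
      ∃ ξ η : ℝ, |η - q| < |ξ - p| ∧ |ξ - r| < |η - s| := by
    intro p q r s h hr hs
    have hd : 0 < (p - r) + (q - s) := by
      rcases h with h | h
      · have := lt_of_le_of_ne hr h.symm; linarith
      · have := lt_of_le_of_ne hs h.symm; linarith
    -- A point to the left of `p` and above `q`, at distance slightly larger horizontally.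
    refine ⟨p - ((p - r) + 1 + ((p - r) + (q - s)) / 2), q + ((p - r) + 1), ?_, ?_⟩
    · rw [abs_of_pos (by linarith), abs_of_neg (by linarith)]
      linarith
    · rw [abs_of_neg (by linarith), abs_of_pos (by linarith)]
      linarith
  have step : ∀ p q r s : ℝ, (p ≠ r ∨ q ≠ s) → r ≤ p →
      ∃ ξ η : ℝ, |η - q| < |ξ - p| ∧ |ξ - r| < |η - s| := by
    intro p q r s h hr
    rcases le_total s q with hs | hs
    · exact base p q r s h hr hs
    · obtain ⟨ξ, η, h1, h2⟩ := base p (-q) r (-s) (by simpa using h) hr (by linarith)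
      refine ⟨ξ, -η, ?_, ?_⟩
      · rwa [show -η - q = -(η - -q) by ring, abs_neg]
      · rwa [show -η - s = -(η - -s) by ring, abs_neg]
  rcases le_total r p with hr | hr
  · exact step p q r s h hr
  · obtain ⟨ξ, η, h1, h2⟩ := step (-p) q (-r) s (by simpa using h) (by linarith)
    refine ⟨-ξ, η, ?_, ?_⟩
    · rwa [show -ξ - p = -(ξ - -p) by ring, abs_neg]
    · rwa [show -ξ - r = -(ξ - -r) by ring, abs_neg]

theorem exists_extension (i : W ↪ W') {v : W'} (hv : Set.range i = {v}ᶜ) (x : W → ℝ) (ξ : ℝ) :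
    ∃ x' : W' → ℝ, x' ∘ i = x ∧ x' v = ξ := by
  refine ⟨Function.extend i x fun _ => ξ, funext fun w => i.injective.extend_apply _ _ _,
    Function.extend_apply' _ _ _ ?_⟩
  rintro ⟨w, hw⟩
  have : v ∈ ({v}ᶜ : Set W') := hv ▸ ⟨w, hw⟩
  exact this rfl

theorem eq_or_exists_of_range {i : W ↪ W'} {v : W'} (hv : Set.range i = {v}ᶜ) (w : W') :
    w = v ∨ ∃ u, i u = w := by
  by_cases h : w = v
  · exact Or.inl h
  · have : w ∈ Set.range i := by rw [hv]; exact h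
    exact Or.inr this

theorem mem_or_exists_of_range {j : E ↪ E'} {A : Set E'} (hj : Set.range j = Aᶜ) (f : E') :
    f ∈ A ∨ ∃ e, j e = f := by
  by_cases h : f ∈ A
  · exact Or.inl h
  · have : f ∈ Set.range j := by rw [hj]; exact h
    exact Or.inr this

theorem exists_eq_of_mem_ends {v : W'} {e : E'} (h : v ∈ S'.ends e) : ∃ w, S'.ends e = s(v, w) := by
  obtain ⟨w, hw⟩ := h
  exact ⟨w, hw⟩

/-- A Henneberg 1 move, with the new vertex placed such that one new edge is horizontal and the
other one is vertical. -/
theorem IsH1.exists_isRealization [Finite W] [Finite E] (h : S.IsH1 S') {x y : W → ℝ}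
    (hxy : S.IsRealization x y) : ∃ x' y', S'.IsRealization x' y' := by
  obtain ⟨i, j, v, e₁, e₂, hne, hi, hj, hij, hv₁, hv₂, hnd⟩ := h
  obtain ⟨x, y, hxy, hx0, -, hy⟩ := hxy.exists_generic
  have main : ∀ e₁ e₂ : E', e₁ ≠ e₂ → Set.range j = {e₁, e₂}ᶜ → v ∈ S'.ends e₁ →
      v ∈ S'.ends e₂ → ¬ (S'.ends e₂).IsDiag → ∃ x' y', S'.IsRealization x' y' := by
    intro e₁ e₂ hne hj hv₁ hv₂ hd
    obtain ⟨w₁, hw₁⟩ := exists_eq_of_mem_ends hv₁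
    obtain ⟨w₂, hw₂⟩ := exists_eq_of_mem_ends hv₂
    have hw₂v : w₂ ≠ v := by
      rintro rfl
      exact hd (by rw [hw₂]; exact Sym2.diag_isDiag w₂)
    obtain ⟨b, rfl⟩ := (eq_or_exists_of_range hi w₂).resolve_left hw₂v
    obtain ⟨x', y', hx', hy', hh, hv⟩ : ∃ x' y' : W' → ℝ, x' ∘ i = x ∧ y' ∘ i = y ∧
        S'.vlen y' e₁ < S'.hlen x' e₁ ∧ S'.hlen x' e₂ < S'.vlen y' e₂ := by
      rcases eq_or_exists_of_range hi w₁ with rfl | ⟨a, rfl⟩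
      · obtain ⟨x', hx', hx'v⟩ := exists_extension i hi x 1
        obtain ⟨y', hy', hy'v⟩ := exists_extension i hi y
          (y b + |1 - signReal (S'.gain e₂) * x b| + 1)
        have hg := S'.gain_of_loop e₁ (by rw [hw₁]; exact Sym2.diag_isDiag w₁)
        refine ⟨x', y', hx', hy', ?_, ?_⟩
        · rw [vlen_eq hw₁, hlen_eq hw₁, hx'v, hg, signReal_neg_one, sub_self]
          norm_num
        · rw [vlen_eq hw₂, hlen_eq hw₂, hx'v, hy'v, ← hx', ← hy']
          simp only [Function.comp]
          refine lt_of_lt_of_le ?_ (le_abs_self _)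
          linarith
      · obtain ⟨ξ, η, h1, h2⟩ := exists_mem_cones (p := signReal (S'.gain e₁) * x a) (q := y a)
          (r := signReal (S'.gain e₂) * x b) (s := y b) (by
            by_cases hab : a = b
            · left
              subst hab
              rw [signReal_eq_neg_of_ne (S'.gain_ne_of_parallel e₁ e₂ hne (by rw [hw₁, hw₂]))]
              intro h0
              have : signReal (S'.gain e₂) * x a = 0 := by linarith
              exact mul_ne_zero (signReal_ne_zero _) (hx0 a) this
            · exact Or.inr (hy a b hab))
        obtain ⟨x', hx', hx'v⟩ := exists_extension i hi x ξ
        obtain ⟨y', hy', hy'v⟩ := exists_extension i hi y η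
        refine ⟨x', y', hx', hy', ?_, ?_⟩
        · rw [vlen_eq hw₁, hlen_eq hw₁, hx'v, hy'v]
          rwa [← hx', ← hy'] at h1
        · rw [vlen_eq hw₂, hlen_eq hw₂, hx'v, hy'v]
          rwa [← hx', ← hy'] at h2
    have hjh : ∀ e, S'.hlen x' (j e) = S.hlen x e := fun e => by
      rw [hlen_map (hij e).1 (hij e).2, hx']
    have hjv : ∀ e, S'.vlen y' (j e) = S.vlen y e := fun e => by
      rw [vlen_map (hij e).1, hy']
    refine ⟨x', y', fun f => ?_, fun u₁ u₂ hu => ?_⟩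
    · rcases mem_or_exists_of_range hj f with (rfl | rfl) | ⟨e, rfl⟩
      · exact hh.ne'
      · exact hv.ne
      · rw [hjh, hjv]; exact hxy.hlen_ne_vlen e
    · obtain ⟨h1, h2⟩ := hxy.isRigid (u₁ ∘ i) (u₂ ∘ i) (fun e _ a b hab => by
        have := hu (j e) trivial (i a) (i b) (by rw [(hij e).1, hab, Sym2.map_mk])
        beta_reduce at this
        rwa [hjh, hjv, (hij e).2] at this)
      have h1v : u₁ v = 0 := by
        have := (hu e₁ trivial v w₁ hw₁).1 hh
        rcases eq_or_exists_of_range hi w₁ with rfl | ⟨a, rfl⟩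
        · rw [S'.gain_of_loop e₁ (by rw [hw₁]; exact Sym2.diag_isDiag w₁), signReal_neg_one] at this
          linarith
        · rw [this, show u₁ (i a) = 0 from h1 a, mul_zero]
      have h2v : u₂ v = u₂ (i b) := (hu e₂ trivial v _ hw₂).2 hv.not_gt
      have h2b : ∀ w, u₂ w = u₂ (i b) := by
        intro w
        rcases eq_or_exists_of_range hi w with rfl | ⟨a, rfl⟩
        exacts [h2v, h2 a b]
      refine ⟨fun w => ?_, fun w w' => by rw [h2b w, h2b w']⟩
      rcases eq_or_exists_of_range hi w with rfl | ⟨a, rfl⟩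
      exacts [h1v, h1 a]
  by_cases hd : (S'.ends e₂).IsDiag
  · exact main e₂ e₁ hne.symm (by rw [hj, Set.pair_comm]) hv₂ hv₁ fun h => hnd ⟨h, hd⟩
  · exact main e₁ e₂ hne hj hv₁ hv₂ hd

theorem eventually_ne_nhdsNE (s₀ c : ℝ) : ∀ᶠ s in 𝓝[≠] s₀, s ≠ c := by
  by_cases h : s₀ = c
  · rw [← h]; exact self_mem_nhdsWithin
  · exact (eventually_ne_nhds h).filter_mono nhdsWithin_le_nhds

/-- If the point `(p, q)` is not on the line through `(α, β)` and `(α', β')`, then this line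
contains points near its intersection with the vertical line through `(p, q)`. -/
theorem exists_on_line {α α' β β' p q : ℝ} (hα : α' ≠ α)
    (hdet : (β - q) * (α' - α) + (p - α) * (β' - β) ≠ 0) :
    ∃ s : ℝ, s ≠ 0 ∧ s ≠ 1 ∧ |α + s * (α' - α) - p| < |β + s * (β' - β) - q| := by
  have hα' := sub_ne_zero.2 hα
  obtain ⟨s₀, hs₀⟩ : ∃ s₀, s₀ = (p - α) / (α' - α) := ⟨_, rfl⟩
  have h1 : α + s₀ * (α' - α) - p = 0 := by rw [hs₀]; field_simp; ring
  have h2 : 0 < |β + s₀ * (β' - β) - q| := by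
    rw [abs_pos]
    intro h0
    apply hdet
    linear_combination (α' - α) * h0 - (β' - β) * h1
  have hlt : |α + s₀ * (α' - α) - p| < |β + s₀ * (β' - β) - q| := by rwa [h1, abs_zero]
  have hc1 : Continuous fun s : ℝ => |α + s * (α' - α) - p| := by fun_prop
  have hc2 : Continuous fun s : ℝ => |β + s * (β' - β) - q| := by fun_prop
  have h3 := ((hc1.tendsto s₀).eventually_lt (hc2.tendsto s₀) hlt).filter_mono
    (nhdsWithin_le_nhds (s := {s₀}ᶜ))
  obtain ⟨s, h4, h5, h6⟩ := (h3.and ((eventually_ne_nhdsNE s₀ 0).and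
    (eventually_ne_nhdsNE s₀ 1))).exists
  exact ⟨s, h5, h6, h4⟩

/-- A Henneberg 2 move, with the new vertex placed on the line through the ends of the deleted
edge, such that the third new edge has a different direction. -/
theorem IsH2.exists_isRealization [Finite W] [Finite E] (h : S.IsH2 S') {x y : W → ℝ}
    (hxy : S.IsRealization x y) : ∃ x' y', S'.IsRealization x' y' := by
  classical
  obtain ⟨e, a, b, z, i, j, v, e₁, e₂, e₃, h12, h13, h23, hi, hj, hij, he, he₁, he₂, hg, he₃⟩ := h
  obtain ⟨x, y, hxy, hdet⟩ : ∃ x y, S.IsRealization x y ∧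
      (y a - y z) * (signReal (S'.gain e₂) * x b - signReal (S'.gain e₁) * x a) +
      (signReal (S'.gain e₃) * x z - signReal (S'.gain e₁) * x a) * (y b - y a) ≠ 0 := by
    obtain ⟨x, y, hxy, hx0, hx, hy⟩ := hxy.exists_generic
    by_cases hza : z = a
    · subst hza
      have hs := signReal_eq_neg_of_ne (S'.gain_ne_of_parallel e₁ e₃ h13 (by rw [he₁, he₃]))
      have hzb : b ≠ z := by
        rintro rfl
        have h1 := S'.gain_ne_of_parallel e₁ e₂ h12 (by rw [he₁, he₂])
        have h2 := S'.gain_ne_of_parallel e₁ e₃ h13 (by rw [he₁, he₃])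
        have h3 := S'.gain_ne_of_parallel e₂ e₃ h23 (by rw [he₂, he₃])
        exact h3 (units_eq_of_ne h1.symm h2.symm)
      refine ⟨x, y, hxy, ?_⟩
      rw [hs, sub_self, zero_mul, zero_add]
      refine mul_ne_zero ?_ (sub_ne_zero.2 (hy b z hzb))
      rw [show signReal (S'.gain e₃) * x z - -signReal (S'.gain e₃) * x z =
        2 * (signReal (S'.gain e₃) * x z) by ring]
      exact mul_ne_zero two_ne_zero (mul_ne_zero (signReal_ne_zero _) (hx0 z))
    by_cases hzb : z = b
    · subst hzb
      have hs := signReal_eq_neg_of_ne (S'.gain_ne_of_parallel e₂ e₃ h23 (by rw [he₂, he₃]))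
      refine ⟨x, y, hxy, ?_⟩
      rw [hs, show (y a - y z) * (-signReal (S'.gain e₃) * x z - signReal (S'.gain e₁) * x a) +
        (signReal (S'.gain e₃) * x z - signReal (S'.gain e₁) * x a) * (y z - y a) =
        (-2 * (y a - y z)) * (signReal (S'.gain e₃) * x z) by ring]
      exact mul_ne_zero (mul_ne_zero (by norm_num) (sub_ne_zero.2 (hy a z (Ne.symm hza))))
        (mul_ne_zero (signReal_ne_zero _) (hx0 z))
    -- Otherwise `z` can be moved off the line.
    have hcoef : signReal (S'.gain e₂) * x b - signReal (S'.gain e₁) * x a ≠ 0 := by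
      by_cases hab : a = b
      · subst hab
        rw [signReal_eq_neg_of_ne (S'.gain_ne_of_parallel e₁ e₂ h12 (by rw [he₁, he₂])),
          show signReal (S'.gain e₂) * x a - -signReal (S'.gain e₂) * x a =
            2 * (signReal (S'.gain e₂) * x a) by ring]
        exact mul_ne_zero two_ne_zero (mul_ne_zero (signReal_ne_zero _) (hx0 a))
      · exact sub_ne_zero.2 (hx b a (Ne.symm hab) _ _)
    obtain ⟨t, ht, ht'⟩ := ((hxy.eventually (tendsto_const_nhds (x := x))
      (tendsto_add_smul y (Pi.single z 1) {0}ᶜ)).and (eventually_affine_ne_zero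
        ((y a - y z) * (signReal (S'.gain e₂) * x b - signReal (S'.gain e₁) * x a) +
        (signReal (S'.gain e₃) * x z - signReal (S'.gain e₁) * x a) * (y b - y a))
        (neg_ne_zero.2 hcoef))).exists
    refine ⟨_, _, ht, ?_⟩
    intro h0
    apply ht'
    rw [Pi.single_eq_of_ne (Ne.symm hza), Pi.single_eq_of_ne (Ne.symm hzb), Pi.single_eq_same] at h0
    linear_combination h0
  have hgain : signReal (S.gain e) = signReal (S'.gain e₁) * signReal (S'.gain e₂) := by
    rw [← hg, signReal_mul]
  have hhe : S.hlen x e = |signReal (S'.gain e₂) * x b - signReal (S'.gain e₁) * x a| := by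
    rw [hlen_eq he, hgain, show signReal (S'.gain e₂) * x b - signReal (S'.gain e₁) * x a =
      -(signReal (S'.gain e₁) * (x a - signReal (S'.gain e₁) * signReal (S'.gain e₂) * x b)) by
        rw [mul_sub, mul_assoc, signReal_mul_self_mul]; ring, abs_neg, abs_mul, abs_signReal,
      one_mul]
  have hve : S.vlen y e = |y b - y a| := by rw [vlen_eq he, abs_sub_comm]
  -- The position of `v` is parametrised by `s`.
  obtain ⟨s, hs0, hs1, hs⟩ : ∃ s : ℝ, s ≠ 0 ∧ s ≠ 1 ∧
      ((S.vlen y e < S.hlen x e ∧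
      |signReal (S'.gain e₁) * x a + s * (signReal (S'.gain e₂) * x b - signReal (S'.gain e₁) * x a)
        - signReal (S'.gain e₃) * x z| < |y a + s * (y b - y a) - y z|) ∨
      (S.hlen x e < S.vlen y e ∧ |y a + s * (y b - y a) - y z| <
      |signReal (S'.gain e₁) * x a + s * (signReal (S'.gain e₂) * x b - signReal (S'.gain e₁) * x a)
        - signReal (S'.gain e₃) * x z|)) := by
    rcases lt_or_gt_of_ne (hxy.hlen_ne_vlen e) with hlt | hlt
    · obtain ⟨s, hs0, hs1, hs⟩ := exists_on_line (α := y a) (α' := y b)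
        (β := signReal (S'.gain e₁) * x a) (β' := signReal (S'.gain e₂) * x b) (p := y z)
        (q := signReal (S'.gain e₃) * x z) (by
          intro h0
          rw [hve, h0, sub_self, abs_zero, hhe] at hlt
          exact absurd hlt (abs_nonneg _).not_gt) (by
          intro h0
          apply hdet
          linear_combination -h0)
      exact ⟨s, hs0, hs1, Or.inr ⟨hlt, hs⟩⟩
    · obtain ⟨s, hs0, hs1, hs⟩ := exists_on_line (β := y a) (β' := y b)
        (α := signReal (S'.gain e₁) * x a) (α' := signReal (S'.gain e₂) * x b) (q := y z)
        (p := signReal (S'.gain e₃) * x z) (by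
          intro h0
          rw [hhe, h0, sub_self, abs_zero, hve] at hlt
          exact absurd hlt (abs_nonneg _).not_gt) hdet
      exact ⟨s, hs0, hs1, Or.inl ⟨hlt, hs⟩⟩
  obtain ⟨x', hx', hx'v⟩ := exists_extension i hi x (signReal (S'.gain e₁) * x a +
    s * (signReal (S'.gain e₂) * x b - signReal (S'.gain e₁) * x a))
  obtain ⟨y', hy', hy'v⟩ := exists_extension i hi y (y a + s * (y b - y a))
  have hxi : ∀ w, x' (i w) = x w := fun w => congrFun hx' w
  have hyi : ∀ w, y' (i w) = y w := fun w => congrFun hy' w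
  have hjh : ∀ f, S'.hlen x' (j f) = S.hlen x f.1 := fun f => by
    rw [hlen_map (hij f).1 (hij f).2, hx']
  have hjv : ∀ f, S'.vlen y' (j f) = S.vlen y f.1 := fun f => by
    rw [vlen_map (hij f).1, hy']
  have hh₁ : S'.hlen x' e₁ = |s| * S.hlen x e := by
    rw [hlen_eq he₁, hx'v, hxi, hhe, ← abs_mul]; ring_nf
  have hv₁ : S'.vlen y' e₁ = |s| * S.vlen y e := by
    rw [vlen_eq he₁, hy'v, hyi, hve, ← abs_mul]; ring_nf
  have hh₂ : S'.hlen x' e₂ = |s - 1| * S.hlen x e := by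
    rw [hlen_eq he₂, hx'v, hxi, hhe, ← abs_mul]; ring_nf
  have hv₂ : S'.vlen y' e₂ = |s - 1| * S.vlen y e := by
    rw [vlen_eq he₂, hy'v, hyi, hve, ← abs_mul]; ring_nf
  have hh₃ := hlen_eq he₃ x'
  have hv₃ := vlen_eq he₃ y'
  rw [hx'v, hxi] at hh₃
  rw [hy'v, hyi] at hv₃
  rw [← hh₃, ← hv₃] at hs
  have hpos := abs_pos.2 hs0
  have hpos' := abs_pos.2 (sub_ne_zero.2 hs1)
  refine ⟨x', y', fun f => ?_, fun u₁ u₂ hu => ?_⟩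
  · rcases mem_or_exists_of_range hj f with (rfl | rfl | rfl) | ⟨e, rfl⟩
    · rw [hh₁, hv₁]
      exact fun h => hxy.hlen_ne_vlen e (mul_left_cancel₀ hpos.ne' h)
    · rw [hh₂, hv₂]
      exact fun h => hxy.hlen_ne_vlen e (mul_left_cancel₀ hpos'.ne' h)
    · rcases hs with ⟨-, hs⟩ | ⟨-, hs⟩
      exacts [hs.ne, hs.ne']
    · rw [hjh, hjv]; exact hxy.hlen_ne_vlen e.1
  · have hu₁ := hu e₁ trivial _ _ he₁
    have hu₂ := hu e₂ trivial _ _ he₂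
    have hu₃ := hu e₃ trivial _ _ he₃
    beta_reduce at hu₁ hu₂ hu₃
    rw [hh₁, hv₁, mul_lt_mul_iff_right₀ hpos] at hu₁
    rw [hh₂, hv₂, mul_lt_mul_iff_right₀ hpos'] at hu₂
    obtain ⟨h1, h2⟩ := hxy.isRigid (u₁ ∘ i) (u₂ ∘ i) (fun f _ c d hcd => by
      by_cases hfe : f = e
      · subst hfe
        refine flex_edge he (fun hc => ?_) (fun hc => ?_) c d hcd
        · have := (hu₁.1 hc).symm.trans (hu₂.1 hc)
          simp only [Function.comp]
          rw [hgain, mul_assoc, ← this, signReal_mul_self_mul]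
        · exact (hu₁.2 hc).symm.trans (hu₂.2 hc)
      · have := hu (j ⟨f, hfe⟩) trivial (i c) (i d) (by
          rw [(hij ⟨f, hfe⟩).1, hcd, Sym2.map_mk])
        beta_reduce at this
        rwa [hjh, hjv, (hij ⟨f, hfe⟩).2] at this)
    have h1i : ∀ w, u₁ (i w) = 0 := h1
    have h2i : ∀ w w', u₂ (i w) = u₂ (i w') := h2
    obtain ⟨h1v, h2v⟩ : u₁ v = 0 ∧ u₂ v = u₂ (i a) := by
      rcases hs with ⟨hs, hs'⟩ | ⟨hs, hs'⟩
      · exact ⟨by rw [hu₁.1 hs, h1i, mul_zero], by rw [hu₃.2 hs'.not_gt, h2i z a]⟩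
      · exact ⟨by rw [hu₃.1 hs', h1i, mul_zero], hu₁.2 hs.not_gt⟩
    have h2b : ∀ w, u₂ w = u₂ (i a) := by
      intro w
      rcases eq_or_exists_of_range hi w with rfl | ⟨c, rfl⟩
      exacts [h2v, h2i c a]
    refine ⟨fun w => ?_, fun w w' => by rw [h2b w, h2b w']⟩
    rcases eq_or_exists_of_range hi w with rfl | ⟨c, rfl⟩
    exacts [h1v, h1i c]

end Henneberg

/-! ### Vertex-to-`K₄` moves and vertex splitting preserve realisability -/

section Collapse

variable {W E W' E' : Type*} {S : SignedGraph W E} {S' : SignedGraph W' E'}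

/-- Replace each vertex of a realisation by a cluster of nearby vertices, whose shape is given by
`k` and `l`. The old edges keep their directions, so the result is a realisation if the new edges
are not degenerate and force flexes to be constant on clusters. -/
theorem IsRealization.exists_of_collapse [Finite E] {x y : W → ℝ} (h : S.IsRealization x y)
    (π : W' → W) (hπ : Function.Surjective π) (j : E ↪ E')
    (hj : ∀ e, (S'.ends (j e)).map π = S.ends e ∧ S'.gain (j e) = S.gain e) (k l : W' → ℝ)
    (hnew : ∀ᶠ t in 𝓝[>] (0 : ℝ),
      (∀ e, (S'.vlen (fun w => y (π w) + t * l w) (j e) < S'.hlen (fun w => x (π w) + t * k w) (j e)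
        ↔ S.vlen y e < S.hlen x e)) →
      (∀ f ∉ Set.range j, S'.hlen (fun w => x (π w) + t * k w) f ≠
        S'.vlen (fun w => y (π w) + t * l w) f) ∧
      ∀ u₁ u₂, S'.IsFlex (fun f => S'.vlen (fun w => y (π w) + t * l w) f <
        S'.hlen (fun w => x (π w) + t * k w) f) Set.univ u₁ u₂ →
        ∀ a b, π a = π b → u₁ a = u₁ b ∧ u₂ a = u₂ b) :
    ∃ x' y', S'.IsRealization x' y' := by
  have hold : ∀ᶠ t in 𝓝[>] (0 : ℝ), ∀ e,
      S'.hlen (fun w => x (π w) + t * k w) (j e) ≠ S'.vlen (fun w => y (π w) + t * l w) (j e) ∧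
      (S'.vlen (fun w => y (π w) + t * l w) (j e) < S'.hlen (fun w => x (π w) + t * k w) (j e)
        ↔ S.vlen y e < S.hlen x e) := by
    rw [eventually_all]
    intro e
    have hx := ((S'.continuous_hlen (j e)).tendsto _).comp
      (tendsto_add_smul (x ∘ π) k (Set.Ioi 0))
    have hy := ((S'.continuous_vlen (j e)).tendsto _).comp
      (tendsto_add_smul (y ∘ π) l (Set.Ioi 0))
    rw [← hlen_map (hj e).1.symm (hj e).2.symm x] at hx
    rw [← vlen_map (hj e).1.symm y] at hy
    rcases lt_or_gt_of_ne (h.hlen_ne_vlen e) with h1 | h1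
    · filter_upwards [hx.eventually_lt hy h1] with t ht
      exact ⟨ht.ne, iff_of_false ht.not_gt h1.not_gt⟩
    · filter_upwards [hy.eventually_lt hx h1] with t ht
      exact ⟨ht.ne', iff_of_true ht h1⟩
  obtain ⟨t, hold, hnew⟩ := (hold.and hnew).exists
  obtain ⟨hnew, hfac⟩ := hnew fun e => (hold e).2
  refine ⟨fun w => x (π w) + t * k w, fun w => y (π w) + t * l w, fun f => ?_, fun u₁ u₂ hu => ?_⟩
  · by_cases hf : f ∈ Set.range j
    · obtain ⟨e, rfl⟩ := hf
      exact (hold e).1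
    · exact hnew f hf
  · have hfac := hfac u₁ u₂ hu
    obtain ⟨σ, hσ⟩ := hπ.hasRightInverse
    have h1 : ∀ w, u₁ (σ (π w)) = u₁ w ∧ u₂ (σ (π w)) = u₂ w := fun w => hfac _ _ (hσ (π w))
    obtain ⟨h2, h3⟩ := h.isRigid (u₁ ∘ σ) (u₂ ∘ σ) (fun e _ a b hab => by
      obtain ⟨⟨a', b'⟩, hab'⟩ := Quot.exists_rep (S'.ends (j e))
      have hab' : S'.ends (j e) = s(a', b') := hab'.symm
      have he := (hj e).1
      rw [hab', Sym2.map_mk] at he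
      have := hu (j e) trivial a' b' hab'
      beta_reduce at this
      rw [(hold e).2, (hj e).2, ← (h1 a').1, ← (h1 a').2, ← (h1 b').1, ← (h1 b').2] at this
      exact flex_edge he.symm this.1 this.2 a b hab)
    refine ⟨fun w => ?_, fun w w' => ?_⟩
    · rw [← (h1 w).1]; exact h2 (π w)
    · rw [← (h1 w).2, ← (h1 w').2]; exact h3 (π w) (π w')

theorem IsCollapse.surjective {π : W' → W} {v : W} {k : ℕ} (h : IsCollapse π v k) (hk : k ≠ 0) :
    Function.Surjective π := by
  intro w
  by_cases hw : w = v
  · subst hw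
    obtain ⟨w', hw'⟩ := Set.nonempty_of_ncard_ne_zero (by rw [h.1]; exact hk)
    exact ⟨w', hw'⟩
  · obtain ⟨w', hw', -⟩ := h.2 w hw
    exact ⟨w', hw'⟩

/-- A vertex-to-`K₄` move: the points `(0, 0)`, `(3, 1)`, `(1/2, 3)`, `(7/2, 4)` span a `K₄` in
which the horizontal edges and the vertical edges both form a Hamiltonian path. -/
theorem IsVertexToK4.exists_isRealization [Finite W] [Finite E] (h : S.IsVertexToK4 S')
    {x y : W → ℝ} (hxy : S.IsRealization x y) : ∃ x' y', S'.IsRealization x' y' := by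
  obtain ⟨v, π, j, hπ, hj, hK, hK'⟩ := h
  have hfin : (π ⁻¹' {v}).Finite := Set.finite_of_ncard_ne_zero (by rw [hπ.1]; norm_num)
  have := hfin.fintype
  have hcard : Fintype.card (π ⁻¹' {v}) = 4 := by
    rw [← Nat.card_eq_fintype_card, Nat.card_coe_set_eq, hπ.1]
  let φ := Fintype.equivFinOfCardEq hcard
  let q : Fin 4 → W' := fun i => (φ.symm i).1
  have hqinj : Function.Injective q := Subtype.val_injective.comp φ.symm.injective
  have hqv : ∀ i, π (q i) = v := fun i => (φ.symm i).2
  have hqs : ∀ w, π w = v → ∃ i, q i = w := fun w hw => ⟨φ ⟨w, hw⟩, by simp [q]⟩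
  let k : W' → ℝ := Function.extend q ![0, 3, 1 / 2, 7 / 2] 0
  let l : W' → ℝ := Function.extend q ![0, 1, 3, 4] 0
  have hk : ∀ i, k (q i) = ![0, 3, 1 / 2, 7 / 2] i := fun i => hqinj.extend_apply _ _ i
  have hl : ∀ i, l (q i) = ![0, 1, 3, 4] i := fun i => hqinj.extend_apply _ _ i
  have hlen : ∀ t : ℝ, 0 < t → ∀ f i i', S'.ends f = s(q i, q i') → S'.gain f = 1 →
      S'.hlen (fun w => x (π w) + t * k w) f =
        t * |(![0, 3, 1 / 2, 7 / 2] : Fin 4 → ℝ) i - (![0, 3, 1 / 2, 7 / 2] : Fin 4 → ℝ) i'| ∧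
      S'.vlen (fun w => y (π w) + t * l w) f =
        t * |(![0, 1, 3, 4] : Fin 4 → ℝ) i - (![0, 1, 3, 4] : Fin 4 → ℝ) i'| := by
    intro t ht f i i' hf hg
    rw [hlen_eq hf, vlen_eq hf, hg, signReal_one, hqv, hqv, hk, hk, hl, hl]
    constructor
    all_goals
      rw [← abs_of_pos ht, ← abs_mul, abs_of_pos ht]
      ring_nf
  refine hxy.exists_of_collapse π (hπ.surjective (by norm_num)) j hj k l ?_
  filter_upwards [self_mem_nhdsWithin] with t (ht : 0 < t) _
  have hedge : ∀ i i', i ≠ i' → ∃ f, S'.ends f = s(q i, q i') ∧ S'.gain f = 1 := by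
    intro i i' hii'
    obtain ⟨f, hf, hfe⟩ := hK' (q i) (q i') (hqinj.ne hii') (hqv i) (hqv i')
    obtain ⟨-, -, -, -, -, -, hg⟩ := hK f hf
    exact ⟨f, hfe, hg⟩
  refine ⟨?_, ?_⟩
  · intro f hf
    obtain ⟨a, b, hab, ha, hb, hfe, hg⟩ := hK f hf
    obtain ⟨i, rfl⟩ := hqs a ha
    obtain ⟨i', rfl⟩ := hqs b hb
    have hii' : i ≠ i' := fun h => hab (by rw [h])
    obtain ⟨h1, h2⟩ := hlen t ht f i i' hfe hg
    rw [h1, h2]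
    intro h0
    have h0 := mul_left_cancel₀ ht.ne' h0
    revert h0
    clear h1 h2 hfe hab ha hb
    fin_cases i <;> fin_cases i' <;>
      first | exact absurd rfl hii' | norm_num [abs_of_pos, abs_of_neg]
  · intro u₁ u₂ hu
    have hh : ∀ i i', i ≠ i' →
        |(![0, 1, 3, 4] : Fin 4 → ℝ) i - (![0, 1, 3, 4] : Fin 4 → ℝ) i'| <
        |(![0, 3, 1 / 2, 7 / 2] : Fin 4 → ℝ) i - (![0, 3, 1 / 2, 7 / 2] : Fin 4 → ℝ) i'| →
        u₁ (q i) = u₁ (q i') := by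
      intro i i' hii' hlt
      obtain ⟨f, hf, hg⟩ := hedge i i' hii'
      obtain ⟨h1, h2⟩ := hlen t ht f i i' hf hg
      have := (hu f trivial _ _ hf).1 (by
        beta_reduce
        rw [h1, h2]
        exact mul_lt_mul_of_pos_left hlt ht)
      rwa [hg, signReal_one, one_mul] at this
    have hv : ∀ i i', i ≠ i' →
        |(![0, 3, 1 / 2, 7 / 2] : Fin 4 → ℝ) i - (![0, 3, 1 / 2, 7 / 2] : Fin 4 → ℝ) i'| <
        |(![0, 1, 3, 4] : Fin 4 → ℝ) i - (![0, 1, 3, 4] : Fin 4 → ℝ) i'| →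
        u₂ (q i) = u₂ (q i') := by
      intro i i' hii' hlt
      obtain ⟨f, hf, hg⟩ := hedge i i' hii'
      obtain ⟨h1, h2⟩ := hlen t ht f i i' hf hg
      exact (hu f trivial _ _ hf).2 (by
        beta_reduce
        rw [h1, h2]
        exact (mul_lt_mul_of_pos_left hlt ht).not_gt)
    have h01 := hh 0 1 (by decide) (by norm_num [abs_of_pos, abs_of_neg])
    have h12 := hh 1 2 (by decide) (by
      change |(1:ℝ) - 3| < |(3:ℝ) - 1 / 2|
      norm_num [abs_of_pos, abs_of_neg])
    have h23 := hh 2 3 (by decide) (by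
      change |(3:ℝ) - 4| < |(1 / 2 : ℝ) - 7 / 2|
      norm_num [abs_of_pos, abs_of_neg])
    have v02 := hv 0 2 (by decide) (by
      change |(0:ℝ) - 1 / 2| < |(0:ℝ) - 3|
      norm_num [abs_of_pos, abs_of_neg])
    have v03 := hv 0 3 (by decide) (by
      change |(0:ℝ) - 7 / 2| < |(0:ℝ) - 4|
      norm_num [abs_of_pos, abs_of_neg])
    have v13 := hv 1 3 (by decide) (by
      change |(3:ℝ) - 7 / 2| < |(1:ℝ) - 4|
      norm_num [abs_of_pos, abs_of_neg])
    have hall : ∀ i, u₁ (q i) = u₁ (q 0) ∧ u₂ (q i) = u₂ (q 0) := by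
      intro i
      fin_cases i
      · exact ⟨rfl, rfl⟩
      · exact ⟨h01.symm, v13.trans v03.symm⟩
      · exact ⟨(h01.trans h12).symm, v02.symm⟩
      · exact ⟨(h01.trans (h12.trans h23)).symm, v03.symm⟩
    intro a b hab
    by_cases ha : π a = v
    · obtain ⟨i, rfl⟩ := hqs a ha
      obtain ⟨i', rfl⟩ := hqs b (hab ▸ ha)
      rw [(hall i).1, (hall i).2, (hall i').1, (hall i').2]
      exact ⟨rfl, rfl⟩
    · rw [(hπ.2 _ ha).unique rfl hab.symm]
      exact ⟨rfl, rfl⟩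

/-- Vertex splitting: the two new vertices are placed close to each other, on a line whose
direction is different from that of the edges joining them to their common neighbour. -/
theorem IsVertexSplitting.exists_isRealization [Finite W] [Finite E] (h : S.IsVertexSplitting S')
    {x y : W → ℝ} (hxy : S.IsRealization x y) : ∃ x' y', S'.IsRealization x' y' := by
  classical
  obtain ⟨v, u, e₀, π, j, v₀, v₁, u', f₁, f₂, he₀, hg₀, hπ, hv, hv₀, hv₁, hu', hj, hj₀, hf,
    hjr, hf₁, hg₁, hf₂, hg₂⟩ := h
  have hj' : ∀ e, (S'.ends (j e)).map π = S.ends e ∧ S'.gain (j e) = S.gain e :=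
    fun e => ⟨(hj e).1, (hj e).2.1⟩
  have hpre : ∀ w, π w = v → w = v₀ ∨ w = v₁ := by
    have hfin : (π ⁻¹' {v}).Finite := Set.finite_of_ncard_ne_zero (by rw [hπ.1]; norm_num)
    have : ({v₀, v₁} : Set W') = π ⁻¹' {v} := by
      refine Set.eq_of_subset_of_ncard_le ?_ ?_ hfin
      · rintro w (rfl | rfl)
        exacts [hv₀, hv₁]
      · rw [hπ.1, Set.ncard_pair hv]
    intro w hw
    have : w ∈ ({v₀, v₁} : Set W') := by rw [this]; exact hw
    exact this
  -- It suffices that flexes agree on the two new vertices.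
  have hfac : ∀ u₁ u₂ : W' → ℝ, (u₁ v₀ = u₁ v₁ ∧ u₂ v₀ = u₂ v₁) →
      ∀ a b, π a = π b → u₁ a = u₁ b ∧ u₂ a = u₂ b := by
    intro u₁ u₂ huv a b hab
    by_cases ha : π a = v
    · rcases hpre a ha with rfl | rfl <;> rcases hpre b (hab ▸ ha) with rfl | rfl
      exacts [⟨rfl, rfl⟩, huv, ⟨huv.1.symm, huv.2.symm⟩, ⟨rfl, rfl⟩]
    · rw [(hπ.2 _ ha).unique rfl hab.symm]
      exact ⟨rfl, rfl⟩
  have hnew : ∀ f, f ∉ Set.range j → f = f₁ ∨ f = f₂ := by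
    intro f hf
    rw [hjr] at hf
    exact or_iff_not_imp_left.2 (by simpa using hf)
  have hlen₂ : ∀ k : W' → ℝ, Tendsto (fun t : ℝ => S'.hlen (fun w => x (π w) + t * k w) f₂)
      (𝓝[>] 0) (𝓝 (S.hlen x e₀)) := by
    intro k
    have := ((S'.continuous_hlen f₂).tendsto _).comp (tendsto_add_smul (x ∘ π) k (Set.Ioi 0))
    rw [hlen_eq hf₂, hg₂] at this
    rw [hlen_eq he₀, hg₀, ← hv₁, ← hu']
    exact this
  have vlen₂ : ∀ l : W' → ℝ, Tendsto (fun t : ℝ => S'.vlen (fun w => y (π w) + t * l w) f₂)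
      (𝓝[>] 0) (𝓝 (S.vlen y e₀)) := by
    intro l
    have := ((S'.continuous_vlen f₂).tendsto _).comp (tendsto_add_smul (y ∘ π) l (Set.Ioi 0))
    rw [vlen_eq hf₂] at this
    rw [vlen_eq he₀, ← hv₁, ← hu']
    exact this
  have hlen₁ : ∀ (k : W' → ℝ) (t : ℝ), 0 < t → S'.hlen (fun w => x (π w) + t * k w) f₁ =
      t * |k v₀ - k v₁| := by
    intro k t ht
    rw [hlen_eq hf₁, hg₁, hv₀, hv₁, signReal_one, ← abs_of_pos ht, ← abs_mul, abs_of_pos ht]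
    ring_nf
  have vlen₁ : ∀ (l : W' → ℝ) (t : ℝ), 0 < t → S'.vlen (fun w => y (π w) + t * l w) f₁ =
      t * |l v₀ - l v₁| := by
    intro l t ht
    rw [vlen_eq hf₁, hv₀, hv₁, ← abs_of_pos ht, ← abs_mul, abs_of_pos ht]
    ring_nf
  -- If `e₀` is vertical, then `j e₀` and `f₂` are vertical and `f₁` is made horizontal; and vice
  -- versa.
  rcases lt_or_gt_of_ne (hxy.hlen_ne_vlen e₀) with hlt | hlt
  · refine hxy.exists_of_collapse π (hπ.surjective (by norm_num)) j hj' (Pi.single v₁ 1) 0 ?_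
    filter_upwards [self_mem_nhdsWithin,
      (hlen₂ (Pi.single v₁ 1)).eventually_lt (vlen₂ 0) hlt] with t (ht : 0 < t) hlt₂ hold
    have hlt₁ : S'.vlen (fun w => y (π w) + t * (0 : W' → ℝ) w) f₁ <
        S'.hlen (fun w => x (π w) + t * (Pi.single v₁ 1 : W' → ℝ) w) f₁ := by
      rw [vlen₁ _ t ht, hlen₁ _ t ht, Pi.single_eq_same, Pi.single_eq_of_ne hv]
      simpa using ht
    refine ⟨?_, fun u₁ u₂ hu => hfac u₁ u₂ ⟨?_, ?_⟩⟩
    · intro f hf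
      rcases hnew f hf with rfl | rfl
      exacts [hlt₁.ne', hlt₂.ne]
    · have := (hu f₁ trivial _ _ hf₁).1 hlt₁
      rwa [hg₁, signReal_one, one_mul] at this
    · have h1 := (hu (j e₀) trivial _ _ hj₀).2 (fun h => hlt.not_gt ((hold e₀).1 h))
      have h2 := (hu f₂ trivial _ _ hf₂).2 hlt₂.not_gt
      exact h1.trans h2.symm
  · refine hxy.exists_of_collapse π (hπ.surjective (by norm_num)) j hj' 0 (Pi.single v₁ 1) ?_
    filter_upwards [self_mem_nhdsWithin,
      (vlen₂ (Pi.single v₁ 1)).eventually_lt (hlen₂ 0) hlt] with t (ht : 0 < t) hlt₂ hold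
    have hlt₁ : S'.hlen (fun w => x (π w) + t * (0 : W' → ℝ) w) f₁ <
        S'.vlen (fun w => y (π w) + t * (Pi.single v₁ 1 : W' → ℝ) w) f₁ := by
      rw [vlen₁ _ t ht, hlen₁ _ t ht, Pi.single_eq_same, Pi.single_eq_of_ne hv]
      simpa using ht
    refine ⟨?_, fun u₁ u₂ hu => hfac u₁ u₂ ⟨?_, ?_⟩⟩
    · intro f hf
      rcases hnew f hf with rfl | rfl
      exacts [hlt₁.ne, hlt₂.ne']
    · have h1 := (hu (j e₀) trivial _ _ hj₀).1 ((hold e₀).2 hlt)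
      have h2 := (hu f₂ trivial _ _ hf₂).1 hlt₂
      rw [(hj e₀).2.1, hg₀, signReal_one, one_mul] at h1
      rw [hg₂, signReal_one, one_mul] at h2
      exact h1.trans h2.symm
    · exact (hu f₁ trivial _ _ hf₁).2 hlt₁.not_gt

end Collapse

/-! ### Constructible signed graphs are realisable -/

section Realizable

/-- Finitely many vertices, at most `2 |W| - 1` edges, and a realisation. By rigidity, such a
signed graph has exactly `2 |W| - 1` edges. -/
structure IsRealizable {W E : Type*} (S : SignedGraph W E) : Prop where
  finite_left : Finite W
  finite_right : Finite E
  card_le : Nat.card E + 1 ≤ 2 * Nat.card W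
  exists_isRealization : ∃ x y, S.IsRealization x y

theorem card_of_range_eq_compl {E E' : Type*} [Finite E] (j : E ↪ E') {A : Set E'}
    (hA : A.Finite) (hj : Set.range j = Aᶜ) : Finite E' ∧ Nat.card E' = Nat.card E + A.ncard := by
  have h : (Set.univ : Set E') = A ∪ Set.range j := by rw [hj, Set.union_compl_self]
  have : Finite E' := by
    rw [← Set.finite_univ_iff, h]
    exact hA.union (Set.finite_range j)
  refine ⟨this, ?_⟩
  rw [← Set.ncard_add_ncard_compl A, ← hj, ← Set.image_univ,
    Set.ncard_image_of_injective _ j.injective, Set.ncard_univ, add_comm]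

theorem IsCollapse.card {W W' : Type*} [Finite W] {π : W' → W} {v : W} {k : ℕ}
    (h : IsCollapse π v (k + 1)) : Finite W' ∧ Nat.card W' = Nat.card W + k := by
  obtain ⟨σ, hσ⟩ := (h.surjective k.succ_ne_zero).hasRightInverse
  have hfin : (π ⁻¹' {v}).Finite := Set.finite_of_ncard_ne_zero (by rw [h.1]; exact k.succ_ne_zero)
  have hmem : σ v ∈ π ⁻¹' {v} := hσ v
  have := card_of_range_eq_compl (A := π ⁻¹' {v} \ {σ v}) ⟨σ, hσ.injective⟩ hfin.sdiff (by
    ext w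
    simp only [Function.Embedding.coeFn_mk, Set.mem_range, Set.mem_compl_iff, Set.mem_sdiff,
      Set.mem_preimage, Set.mem_singleton_iff, not_and, not_not]
    constructor
    · rintro ⟨u, rfl⟩ hu
      rw [hσ u] at hu
      rw [hu]
    · intro hw
      by_cases hwv : π w = v
      · exact ⟨v, (hw hwv).symm⟩
      · exact ⟨π w, (h.2 _ hwv).unique (hσ (π w)) rfl⟩)
  rwa [Set.ncard_sdiff_singleton_of_mem hmem, h.1, Nat.add_sub_cancel] at this

variable {W E W' E' : Type*} {S : SignedGraph W E} {S' : SignedGraph W' E'}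

theorem IsSingleLoop.isRealizable (h : S.IsSingleLoop) : S.IsRealizable := by
  obtain ⟨v, e, hv, he, hve⟩ := h
  have hW : Nat.card W = 1 := Nat.card_eq_one_iff_exists.2 ⟨v, hv⟩
  have hE : Nat.card E = 1 := Nat.card_eq_one_iff_exists.2 ⟨e, he⟩
  have hg : S.gain e = -1 := S.gain_of_loop e (by rw [hve]; exact Sym2.diag_isDiag v)
  have hh : S.hlen (fun _ => 1) e = 2 := by
    rw [hlen_eq hve, hg, signReal_neg_one]; norm_num
  have hvl : S.vlen (fun _ => 0) e = 0 := by rw [vlen_eq hve]; norm_num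
  refine ⟨Nat.finite_of_card_ne_zero (by omega), Nat.finite_of_card_ne_zero (by omega), by omega,
    fun _ => 1, fun _ => 0, fun f => ?_, fun u₁ u₂ hu => ⟨fun a => ?_, fun a b => ?_⟩⟩
  · rw [he f, hh, hvl]; norm_num
  · have := (hu e trivial v v hve).1 (by beta_reduce; rw [hh, hvl]; norm_num)
    rw [hg, signReal_neg_one] at this
    rw [hv a]
    linarith
  · rw [hv a, hv b]

theorem IsSwitching.isRealizable {S' : SignedGraph W E} (h : S.IsSwitching S')
    (hS : S.IsRealizable) : S'.IsRealizable := by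
  classical
  obtain ⟨v, hv⟩ := h
  obtain ⟨hW, hE, hc, x, y, hxy⟩ := hS
  -- The sign by which the first coordinate at `w` is multiplied.
  let σ : W → ℤˣ := Pi.mulSingle v (-1)
  have hg : ∀ e a b, S.ends e = s(a, b) → S'.gain e = σ a * σ b * S.gain e := by
    intro e a b hab
    rw [(hv e).2, hab]
    by_cases h : a = b
    · subst h
      simp [Int.units_mul_self]
    · by_cases ha : v = a
      · subst ha
        simp [σ, Ne.symm h, h]
      · by_cases hb : v = b
        · subst hb
          simp [σ, h]
        · simp [σ, ha, hb, Ne.symm ha, Ne.symm hb]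
  have hσ : ∀ (u : W → ℝ) e a b, S.ends e = s(a, b) →
      signReal (S'.gain e) * (signReal (σ b) * u b) =
        signReal (σ a) * (signReal (S.gain e) * u b) := by
    intro u e a b hab
    rw [hg e a b hab, signReal_mul, signReal_mul]
    linear_combination signReal (σ a) * signReal (S.gain e) * u b * signReal_mul_self (σ b)
  have hh : ∀ e, S'.hlen (fun w => signReal (σ w) * x w) e = S.hlen x e := by
    intro e
    obtain ⟨⟨a, b⟩, hab⟩ := Quot.exists_rep (S.ends e)
    have hab : S.ends e = s(a, b) := hab.symm
    rw [hlen_eq ((hv e).1.trans hab), hlen_eq hab, hσ x e a b hab, ← mul_sub, abs_mul,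
      abs_signReal, one_mul]
  have hvl : ∀ e, S'.vlen y e = S.vlen y e := fun e => by rw [vlen, vlen, (hv e).1]
  refine ⟨hW, hE, hc, fun w => signReal (σ w) * x w, y, fun e => ?_, fun u₁ u₂ hu => ?_⟩
  · rw [hh, hvl]; exact hxy.hlen_ne_vlen e
  · obtain ⟨h1, h2⟩ := hxy.isRigid (fun w => signReal (σ w) * u₁ w) u₂ (fun e _ a b hab => by
      have := hu e trivial a b ((hv e).1.trans hab)
      beta_reduce at this
      rw [hh, hvl] at this
      refine ⟨fun hlt => ?_, this.2⟩
      have h3 := hσ (fun w => signReal (σ w) * u₁ w) e a b hab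
      beta_reduce at h3
      rw [signReal_mul_self_mul] at h3
      beta_reduce
      rw [this.1 hlt, h3, signReal_mul_self_mul])
    refine ⟨fun a => ?_, h2⟩
    exact (mul_eq_zero.1 (h1 a)).resolve_left (signReal_ne_zero _)

theorem IsH1.isRealizable (h : S.IsH1 S') (hS : S.IsRealizable) : S'.IsRealizable := by
  obtain ⟨hW, hE, hc, x, y, hxy⟩ := hS
  have hreal := h.exists_isRealization hxy
  obtain ⟨i, j, v, e₁, e₂, hne, hi, hj, -⟩ := h
  obtain ⟨hW', hcW⟩ := card_of_range_eq_compl i (Set.finite_singleton v) hi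
  obtain ⟨hE', hcE⟩ := card_of_range_eq_compl j (Set.toFinite _) hj
  rw [Set.ncard_singleton] at hcW
  rw [Set.ncard_pair hne] at hcE
  exact ⟨hW', hE', by omega, hreal⟩

theorem IsH2.isRealizable (h : S.IsH2 S') (hS : S.IsRealizable) : S'.IsRealizable := by
  obtain ⟨hW, hE, hc, x, y, hxy⟩ := hS
  have hreal := h.exists_isRealization hxy
  obtain ⟨e, a, b, z, i, j, v, e₁, e₂, e₃, h12, h13, h23, hi, hj, -⟩ := h
  obtain ⟨hW', hcW⟩ := card_of_range_eq_compl i (Set.finite_singleton v) hi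
  obtain ⟨hE', hcE⟩ := card_of_range_eq_compl j (Set.toFinite _) hj
  rw [Set.ncard_singleton] at hcW
  have h3 : ({e₁, e₂, e₃} : Set E').ncard = 3 := by
    rw [Set.ncard_eq_three]
    exact ⟨_, _, _, h12, h13, h23, rfl⟩
  have h1 := Set.ncard_add_ncard_compl ({e} : Set E)
  rw [Set.ncard_singleton] at h1
  have h2 : Nat.card {f // f ≠ e} = ({e}ᶜ : Set E).ncard := Nat.card_coe_set_eq ({e}ᶜ : Set E)
  exact ⟨hW', hE', by omega, hreal⟩

theorem IsVertexToK4.isRealizable (h : S.IsVertexToK4 S') (hS : S.IsRealizable) :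
    S'.IsRealizable := by
  classical
  obtain ⟨hW, hE, hc, x, y, hxy⟩ := hS
  have hreal := h.exists_isRealization hxy
  obtain ⟨v, π, j, hπ, hj, hK, -⟩ := h
  obtain ⟨hW', hcW⟩ := IsCollapse.card (k := 3) hπ
  -- The new edges are determined by their ends.
  have hinj : Set.InjOn S'.ends (Set.range j)ᶜ := by
    intro f hf g hg hfg
    by_contra hne
    obtain ⟨-, -, -, -, -, -, hf1⟩ := hK f hf
    obtain ⟨-, -, -, -, -, -, hg1⟩ := hK g hg
    exact S'.gain_ne_of_parallel f g hne hfg (by rw [hf1, hg1])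
  have hfin : ((Set.range j)ᶜ).Finite := Set.Finite.of_finite_image (Set.toFinite _) hinj
  have hle : ((Set.range j)ᶜ).ncard ≤ 6 := by
    have hKfin : (π ⁻¹' {v}).Finite := Set.toFinite _
    have h6 : ((hKfin.toFinset.offDiag.image (fun p : W' × W' => s(p.1, p.2))) :
        Finset (Sym2 W')).card = 6 := by
      have := Sym2.card_image_offDiag hKfin.toFinset
      rw [← Set.ncard_eq_toFinset_card _ hKfin, hπ.1] at this
      exact this
    rw [← h6, ← Set.ncard_coe_finset]
    refine Set.ncard_le_ncard_of_injOn S'.ends ?_ hinj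
    intro f hf
    obtain ⟨a, b, hab, ha, hb, hfe, -⟩ := hK f hf
    rw [hfe]
    simp only [Finset.coe_image, Set.mem_image, Finset.mem_coe, Finset.mem_offDiag]
    exact ⟨(a, b), ⟨by simpa using ha, by simpa using hb, hab⟩, rfl⟩
  obtain ⟨hE', hcE⟩ := card_of_range_eq_compl j hfin (compl_compl _).symm
  exact ⟨hW', hE', by omega, hreal⟩

theorem IsVertexSplitting.isRealizable (h : S.IsVertexSplitting S') (hS : S.IsRealizable) :
    S'.IsRealizable := by
  obtain ⟨hW, hE, hc, x, y, hxy⟩ := hS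
  have hreal := h.exists_isRealization hxy
  obtain ⟨v, u, e₀, π, j, v₀, v₁, u', f₁, f₂, -, -, hπ, -, -, -, -, -, -, hf, hjr, -⟩ := h
  obtain ⟨hW', hcW⟩ := IsCollapse.card (k := 1) hπ
  obtain ⟨hE', hcE⟩ := card_of_range_eq_compl j (Set.toFinite _) hjr
  rw [Set.ncard_pair hf] at hcE
  exact ⟨hW', hE', by omega, hreal⟩

universe u

theorem Constructible.isRealizable {W E : Type u} {S : SignedGraph W E} (h : S.Constructible) :
    S.IsRealizable := by
  induction h with
  | loop h => exact h.isRealizable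
  | switching _ h ih => exact h.isRealizable ih
  | henneberg1 _ h ih => exact h.isRealizable ih
  | henneberg2 _ h ih => exact h.isRealizable ih
  | vertexToK4 _ h ih => exact h.isRealizable ih
  | vertexSplitting _ h ih => exact h.isRealizable ih

end Realizable

/-! ### Counting constraints -/

section Counting

variable {W E : Type*} (S : SignedGraph W E)

/-- A first end-vertex of the edge `e`. -/
def fstEnd (e : E) : W := (Quot.out (S.ends e)).1

/-- The end-vertex of `e` opposite to `fstEnd e`. -/
def sndEnd (e : E) : W := (Quot.out (S.ends e)).2

theorem ends_eq_fstEnd_sndEnd (e : E) : S.ends e = s(S.fstEnd e, S.sndEnd e) :=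
  (Quot.out_eq (S.ends e)).symm

open Classical in
/-- The constraint that the edge `e` imposes on a flex. -/
def constraint (c : E → Prop) (e : E) : ((W → ℝ) × (W → ℝ)) →ₗ[ℝ] ℝ :=
  if c e then
    ((LinearMap.proj (S.fstEnd e) : (W → ℝ) →ₗ[ℝ] ℝ) -
      signReal (S.gain e) • (LinearMap.proj (S.sndEnd e) : (W → ℝ) →ₗ[ℝ] ℝ)) ∘ₗ
        LinearMap.fst ℝ (W → ℝ) (W → ℝ)
  else
    ((LinearMap.proj (S.fstEnd e) : (W → ℝ) →ₗ[ℝ] ℝ) -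
      (LinearMap.proj (S.sndEnd e) : (W → ℝ) →ₗ[ℝ] ℝ)) ∘ₗ LinearMap.snd ℝ (W → ℝ) (W → ℝ)

variable {S} {c : E → Prop}

theorem constraint_pos {e : E} (hc : c e) (u : (W → ℝ) × (W → ℝ)) :
    S.constraint c e u = u.1 (S.fstEnd e) - signReal (S.gain e) * u.1 (S.sndEnd e) := by
  rw [constraint, if_pos hc]; rfl

theorem constraint_neg {e : E} (hc : ¬ c e) (u : (W → ℝ) × (W → ℝ)) :
    S.constraint c e u = u.2 (S.fstEnd e) - u.2 (S.sndEnd e) := by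
  rw [constraint, if_neg hc]; rfl

theorem isFlex_iff {D : Set E} {u₁ u₂ : W → ℝ} :
    S.IsFlex c D u₁ u₂ ↔ ∀ e ∈ D, S.constraint c e (u₁, u₂) = 0 := by
  constructor
  · intro h e he
    have := h e he _ _ (S.ends_eq_fstEnd_sndEnd e)
    by_cases hc : c e
    · rw [constraint_pos hc]
      exact sub_eq_zero.2 (this.1 hc)
    · rw [constraint_neg hc]
      exact sub_eq_zero.2 (this.2 hc)
  · intro h e he
    refine flex_edge (S.ends_eq_fstEnd_sndEnd e) (fun hc => ?_) (fun hc => ?_)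
    · have := h e he
      rw [constraint_pos hc] at this
      exact sub_eq_zero.1 this
    · have := h e he
      rw [constraint_neg hc] at this
      exact sub_eq_zero.1 this

/-- A rigid edge set has at least `2 |W| - 1` edges, by the rank-nullity theorem. -/
theorem IsRigid.two_mul_card_le [Finite W] [Finite E] {D : Set E} (h : S.IsRigid c D) :
    2 * Nat.card W ≤ D.ncard + 1 := by
  have := Fintype.ofFinite W
  have := Fintype.ofFinite D
  let L : ((W → ℝ) × (W → ℝ)) →ₗ[ℝ] (D → ℝ) := LinearMap.pi fun e => S.constraint c e.1
  have hker : Module.finrank ℝ (LinearMap.ker L) ≤ 1 := by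
    rw [finrank_le_one_iff]
    have hone : ((0, 1) : (W → ℝ) × (W → ℝ)) ∈ LinearMap.ker L := by
      rw [LinearMap.mem_ker]
      funext e
      change S.constraint c e.1 _ = 0
      by_cases hc : c e.1
      · rw [constraint_pos hc]; simp
      · rw [constraint_neg hc]; simp
    refine ⟨⟨_, hone⟩, ?_⟩
    rintro ⟨⟨u₁, u₂⟩, hu⟩
    obtain ⟨h1, h2⟩ := h u₁ u₂ (isFlex_iff.2 fun e he => congrFun (LinearMap.mem_ker.1 hu) ⟨e, he⟩)
    rcases isEmpty_or_nonempty W with hW | ⟨⟨w⟩⟩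
    · exact ⟨0, Subtype.ext (Prod.ext (Subsingleton.elim _ _) (Subsingleton.elim _ _))⟩
    · refine ⟨u₂ w, Subtype.ext (Prod.ext (funext fun a => ?_) (funext fun a => ?_))⟩
      · simp [h1 a]
      · simp [h2 a w]
  have hrn := LinearMap.finrank_range_add_finrank_ker L
  have hr := Submodule.finrank_le (LinearMap.range L)
  rw [Module.finrank_prod, Module.finrank_fintype_fun_eq_card,
    ← Nat.card_eq_fintype_card] at hrn
  rw [Module.finrank_fintype_fun_eq_card, ← Nat.card_eq_fintype_card, Nat.card_coe_set_eq] at hr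
  omega

/-- In a minimally rigid signed graph the constraints are independent: each of them can be
violated without violating the others, so the constraint map is surjective. -/
theorem exists_constraint_eq [Finite E] (h : S.IsRigid c Set.univ) (hmin : ∀ e, ¬ S.IsRigid c {e}ᶜ)
    (r : E → ℝ) : ∃ u, ∀ e, S.constraint c e u = r e := by
  classical
  have := Fintype.ofFinite E
  have hbasis : ∀ e, ∃ u, S.constraint c e u = 1 ∧ ∀ f, f ≠ e → S.constraint c f u = 0 := by
    intro e
    have := hmin e
    unfold IsRigid at this
    push Not at this
    obtain ⟨u₁, u₂, hu, hne⟩ := this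
    rw [isFlex_iff] at hu
    have h0 : S.constraint c e (u₁, u₂) ≠ 0 := by
      intro h0
      obtain ⟨h1, h2⟩ := h u₁ u₂ (isFlex_iff.2 fun f _ => by
        by_cases hf : f = e
        · rw [hf, h0]
        · exact hu f hf)
      obtain ⟨a, b, hab⟩ := hne h1
      exact hab (h2 a b)
    refine ⟨(S.constraint c e (u₁, u₂))⁻¹ • (u₁, u₂), ?_, fun f hf => ?_⟩
    · rw [map_smul, smul_eq_mul, inv_mul_cancel₀ h0]
    · rw [map_smul, hu f hf, smul_zero]
  choose u hu1 hu0 using hbasis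
  refine ⟨∑ e, r e • u e, fun e => ?_⟩
  rw [map_sum, Finset.sum_eq_single e]
  · rw [map_smul, hu1, smul_eq_mul, mul_one]
  · intro f _ hf
    rw [map_smul, hu0 f e (Ne.symm hf), smul_zero]
  · intro he
    exact absurd (Finset.mem_univ e) he

/-- Independent constraints of edges within `U` are bounded by `2 |U|` minus the dimension of any
space of flexes on `U`. -/
theorem card_add_finrank_le [Finite W]
    (hind : ∀ r : E → ℝ, ∃ u, ∀ e, S.constraint c e u = r e)
    {U : Finset W} {F : Finset E} (hF : S.Within U F) {M : Type*} [AddCommGroup M] [Module ℝ M]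
    (A : M →ₗ[ℝ] ((W → ℝ) × (W → ℝ)))
    (hinj : ∀ m, (∀ w ∈ U, (A m).1 w = 0 ∧ (A m).2 w = 0) → m = 0)
    (hA : ∀ e ∈ F, ∀ m, S.constraint c e (A m) = 0) :
    F.card + Module.finrank ℝ M ≤ 2 * U.card := by
  classical
  let ext : (U → ℝ) →ₗ[ℝ] (W → ℝ) := Function.ExtendByZero.linearMap ℝ Subtype.val
  let res : (W → ℝ) →ₗ[ℝ] (U → ℝ) := LinearMap.funLeft ℝ ℝ Subtype.val
  have hext : ∀ (u : W → ℝ) (w : W), w ∈ U → ext (res u) w = u w := fun u w hw =>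
    Subtype.val_injective.extend_apply (res u) 0 (⟨w, hw⟩ : U)
  let L : ((U → ℝ) × (U → ℝ)) →ₗ[ℝ] (F → ℝ) :=
    (LinearMap.pi fun e : F => S.constraint c e.1) ∘ₗ (ext.prodMap ext)
  have hcon : ∀ e ∈ F, ∀ u : (W → ℝ) × (W → ℝ),
      S.constraint c e (ext (res u.1), ext (res u.2)) = S.constraint c e u := by
    intro e he u
    have h1 := hF.mem_left he (S.ends_eq_fstEnd_sndEnd e)
    have h2 := hF.mem_right he (S.ends_eq_fstEnd_sndEnd e)
    by_cases hc : c e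
    · rw [constraint_pos hc, constraint_pos hc]
      dsimp only
      rw [hext _ _ h1, hext _ _ h2]
    · rw [constraint_neg hc, constraint_neg hc]
      dsimp only
      rw [hext _ _ h1, hext _ _ h2]
  have hsurj : Function.Surjective L := by
    intro r
    obtain ⟨u, hu⟩ := hind fun e => if h : e ∈ F then r ⟨e, h⟩ else 0
    refine ⟨(res u.1, res u.2), funext fun e => ?_⟩
    change S.constraint c e.1 (ext (res u.1), ext (res u.2)) = r e
    rw [hcon e.1 e.2, hu, dif_pos e.2]
  let B : M →ₗ[ℝ] ((U → ℝ) × (U → ℝ)) := (res.prodMap res) ∘ₗ A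
  have hB : Function.Injective B := by
    rw [injective_iff_map_eq_zero]
    intro m hm
    refine hinj m fun w hw => ⟨?_, ?_⟩
    · exact congrFun (congrArg Prod.fst hm) ⟨w, hw⟩
    · exact congrFun (congrArg Prod.snd hm) ⟨w, hw⟩
  have hBL : LinearMap.range B ≤ LinearMap.ker L := by
    rintro _ ⟨m, rfl⟩
    rw [LinearMap.mem_ker]
    funext e
    change S.constraint c e.1 (ext (res (A m).1), ext (res (A m).2)) = 0
    rw [hcon e.1 e.2, hA e.1 e.2]
  have hrn := LinearMap.finrank_range_add_finrank_ker L
  have h1 := Submodule.finrank_mono hBL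
  rw [LinearMap.finrank_range_of_inj hB] at h1
  rw [LinearMap.range_eq_top.2 hsurj, finrank_top, Module.finrank_prod,
    Module.finrank_fintype_fun_eq_card, Module.finrank_fintype_fun_eq_card, Fintype.card_coe,
    Fintype.card_coe] at hrn
  omega

/-- A minimally rigid signed graph is gain-tight. -/
theorem IsRigid.gainTight [Finite W] [Finite E] [Nonempty W] (h : S.IsRigid c Set.univ)
    (hmin : ∀ e, ¬ S.IsRigid c {e}ᶜ) : S.GainTight := by
  have hind := exists_constraint_eq h hmin
  have hS : S.Sparse := by
    intro U F hU hF
    obtain ⟨w, hw⟩ := hU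
    constructor
    · -- Translations in the second coordinate are flexes.
      have := card_add_finrank_le hind hF
        (LinearMap.toSpanSingleton ℝ ((W → ℝ) × (W → ℝ)) (0, 1)) (by
          intro m hm
          simpa using (hm w hw).2) (by
          intro e he m
          by_cases hc : c e
          · rw [constraint_pos hc]; simp
          · rw [constraint_neg hc]; simp)
      rwa [Module.finrank_self] at this
    · rintro ⟨s, hs⟩
      -- If there is a potential, then it is a flex in the first coordinate.
      have := card_add_finrank_le hind hF
        ((LinearMap.toSpanSingleton ℝ (W → ℝ) (fun w => signReal (s w))).prodMap
          (LinearMap.toSpanSingleton ℝ (W → ℝ) 1)) (by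
          rintro ⟨m₁, m₂⟩ hm
          have h1 : m₁ * signReal (s w) = 0 := (hm w hw).1
          have h2 : m₂ * 1 = 0 := (hm w hw).2
          rw [mul_one] at h2
          rw [h2, (mul_eq_zero.1 h1).resolve_right (signReal_ne_zero _)]
          rfl) (by
          rintro e he ⟨m₁, m₂⟩
          by_cases hc : c e
          · rw [constraint_pos hc, hs e he _ _ (S.ends_eq_fstEnd_sndEnd e), signReal_mul]
            change m₁ * _ - _ * (m₁ * _) = 0
            linear_combination -m₁ * signReal (s (S.fstEnd e)) *
              signReal_mul_self (s (S.sndEnd e))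
          · rw [constraint_neg hc]
            change m₂ * 1 - m₂ * 1 = 0
            ring)
      rwa [Module.finrank_prod, Module.finrank_self] at this
  have := Fintype.ofFinite W
  have := Fintype.ofFinite E
  refine ⟨hS.gainSparse, ?_⟩
  have h1 := h.two_mul_card_le
  rw [Set.ncard_univ] at h1
  have h2 := (hS Finset.univ Finset.univ Finset.univ_nonempty fun _ _ _ _ => Finset.mem_univ _).1
  rw [Finset.card_univ, Finset.card_univ, ← Nat.card_eq_fintype_card,
    ← Nat.card_eq_fintype_card] at h2
  omega

end Counting

end SignedGraph

/-! ### Norms whose unit ball is a quadrilateral -/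

section Norm

variable {X : Type*} [NormedAddCommGroup X] [NormedSpace ℝ X]

/-- The vertices of a convex hull of finitely many convex independent points are these points. -/
theorem extremePoints_convexHull_range {ι : Type*} [Finite ι] {a : ι → X}
    (ha : ConvexIndependent ℝ a) :
    (convexHull ℝ (Set.range a)).extremePoints ℝ = Set.range a := by
  refine extremePoints_convexHull_subset.antisymm ?_
  rintro _ ⟨i, rfl⟩
  set B := convexHull ℝ (Set.range a) with hB
  have hsub : B.extremePoints ℝ ⊆ Set.range a := extremePoints_convexHull_subset
  have hfin : (Set.range a).Finite := Set.finite_range a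
  have hKM := closure_convexHull_extremePoints (hfin.isCompact_convexHull ℝ) (convex_convexHull ℝ _)
  rw [((hfin.subset hsub).isClosed_convexHull ℝ).closure_eq] at hKM
  by_contra hi
  have hsub' : B.extremePoints ℝ ⊆ a '' {i}ᶜ := by
    intro x hx
    obtain ⟨k, rfl⟩ := hsub hx
    exact ⟨k, fun hk => hi (by rw [← Set.mem_singleton_iff.1 hk]; exact hx), rfl⟩
  have hmem : a i ∈ convexHull ℝ (a '' {i}ᶜ) := by
    refine convexHull_mono hsub' ?_
    rw [hKM]
    exact subset_convexHull ℝ _ ⟨i, rfl⟩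
  exact (ha.mem_convexHull_iff _ _).1 hmem rfl

/-- A centrally symmetric quadrilateral has two pairs of opposite vertices. -/
theorem IsQuadrilateral.exists_eq_convexHull (hX : Module.finrank ℝ X = 2)
    (hP : IsQuadrilateral (Metric.closedBall (0 : X) 1)) :
    ∃ a b : X, Metric.closedBall (0 : X) 1 = convexHull ℝ {a, -a, b, -b} := by
  have : IsAddTorsionFree X := .of_isTorsionFree ℝ X
  have : Nontrivial X := Module.nontrivial_of_finrank_pos (R := ℝ) (by rw [hX]; norm_num)
  obtain ⟨a, ha, hB⟩ := hP
  have hext : (Metric.closedBall (0 : X) 1).extremePoints ℝ = Set.range a := by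
    rw [hB, extremePoints_convexHull_range ha]
  have hne : ∀ i, a i ≠ 0 := by
    intro i hi
    have := extremePoints_closedBall_subset_sphere (hext ▸ Set.mem_range_self i)
    rw [hi] at this
    simp at this
  have hneg : ∀ i, ∃ k, a k = -a i := by
    intro i
    have h1 := image_extremePoints (𝕜 := ℝ) (LinearEquiv.neg ℝ : X ≃ₗ[ℝ] X)
      (Metric.closedBall (0 : X) 1)
    have h2 : (LinearEquiv.neg ℝ : X ≃ₗ[ℝ] X) '' Metric.closedBall (0 : X) 1 =
        Metric.closedBall (0 : X) 1 := by
      ext x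
      simp [LinearEquiv.neg_apply]
    rw [h2, hext] at h1
    have : -a i ∈ Set.range a := by
      rw [← h1]
      exact ⟨a i, ⟨i, rfl⟩, rfl⟩
    exact this
  choose n hn using hneg
  have hnn : ∀ i, n (n i) = i := fun i => ha.injective (by rw [hn, hn, neg_neg])
  have hni : ∀ i, n i ≠ i := by
    intro i h
    have := hn i
    rw [h] at this
    exact hne i (self_eq_neg.1 this)
  obtain ⟨k, hk0, hkn⟩ : ∃ k : Fin 4, k ≠ 0 ∧ k ≠ n 0 := by
    generalize n 0 = m
    revert m
    decide
  have hk : ∀ i, i = 0 ∨ i = n 0 ∨ i = k ∨ i = n k := by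
    have h1 := hni 0
    have h2 := hni k
    have h3 : n k ≠ 0 := fun h => hkn (by rw [← h, hnn])
    have h4 : n k ≠ n 0 := fun h => hk0 (by rw [← hnn k, h, hnn])
    omega
  refine ⟨a 0, a k, ?_⟩
  rw [hB]
  congr 1
  refine Set.Subset.antisymm ?_ ?_
  · rintro _ ⟨i, rfl⟩
    rcases hk i with rfl | rfl | rfl | rfl <;> simp [hn]
  · rintro _ (rfl | rfl | rfl | rfl)
    exacts [⟨0, rfl⟩, ⟨n 0, hn 0⟩, ⟨k, rfl⟩, ⟨n k, hn k⟩]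

theorem exists_eq_smul_add_smul {a b x : X} (hx : x ∈ convexHull ℝ {a, -a, b, -b}) :
    ∃ s t : ℝ, |s| + |t| ≤ 1 ∧ x = s • a + t • b := by
  let C : Set X := {x | ∃ s t : ℝ, |s| + |t| ≤ 1 ∧ x = s • a + t • b}
  have hC : Convex ℝ C := by
    rintro _ ⟨s, t, hst, rfl⟩ _ ⟨s', t', hst', rfl⟩ α β hα hβ hαβ
    refine ⟨α * s + β * s', α * t + β * t', ?_, by module⟩
    have h1 := abs_add_le (α * s) (β * s')
    have h2 := abs_add_le (α * t) (β * t')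
    rw [abs_mul, abs_mul, abs_of_nonneg hα, abs_of_nonneg hβ] at h1 h2
    have h3 := mul_le_mul_of_nonneg_left hst hα
    have h4 := mul_le_mul_of_nonneg_left hst' hβ
    linarith
  have hsub : ({a, -a, b, -b} : Set X) ⊆ C := by
    rintro _ (rfl | rfl | rfl | rfl)
    exacts [⟨1, 0, by simp, by simp⟩, ⟨-1, 0, by simp, by simp⟩, ⟨0, 1, by simp, by simp⟩,
      ⟨0, -1, by simp, by simp⟩]
  exact convexHull_min hsub hC hx

/-- A functional which is at most `1` on the unit ball has operator norm at most `1`. -/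
theorem abs_le_norm_of_le_one {φ : X →ₗ[ℝ] ℝ} (hφ : ∀ x ∈ Metric.closedBall (0 : X) 1, φ x ≤ 1)
    (x : X) : |φ x| ≤ ‖x‖ := by
  have key : ∀ x, φ x ≤ ‖x‖ := by
    intro x
    rcases eq_or_ne x 0 with rfl | hx
    · simp
    · have hpos : 0 < ‖x‖ := norm_pos_iff.2 hx
      have := hφ (‖x‖⁻¹ • x) (by
        rw [mem_closedBall_zero_iff, norm_smul, norm_inv, norm_norm, inv_mul_cancel₀ hpos.ne'])
      rw [map_smul, smul_eq_mul, inv_mul_le_iff₀ hpos, mul_one] at this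
      exact this
  refine abs_le'.2 ⟨key x, ?_⟩
  have := key (-x)
  rwa [map_neg, norm_neg] at this

/-- A facet of the quadrilateral with vertices `±a, ±b` contains one of `±a`. -/
theorem IsFacetFunctional.abs_eq_one {a b : X} {P : Set X}
    (hP : P = convexHull ℝ {a, -a, b, -b}) {φ : X →ₗ[ℝ] ℝ} (hφ : IsFacetFunctional P φ) :
    |φ a| = 1 := by
  obtain ⟨hle, x, ⟨hxP, hx⟩, y, ⟨hyP, hy⟩, hxy⟩ := hφ
  subst hP
  have hmem : ∀ z ∈ ({a, -a, b, -b} : Set X), φ z ≤ 1 :=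
    fun z hz => hle z (subset_convexHull ℝ _ hz)
  have ha : |φ a| ≤ 1 := abs_le'.2 ⟨hmem a (by simp), by rw [← map_neg]; exact hmem (-a) (by simp)⟩
  have hb : |φ b| ≤ 1 := abs_le'.2 ⟨hmem b (by simp), by rw [← map_neg]; exact hmem (-b) (by simp)⟩
  by_contra hne
  have hlt := lt_of_le_of_ne ha hne
  -- Otherwise the facet would be a multiple of `b`.
  have key : ∀ z ∈ convexHull ℝ {a, -a, b, -b}, φ z = 1 → z = (φ b)⁻¹ • b := by
    intro z hz hz1
    obtain ⟨s, t, hst, rfl⟩ := exists_eq_smul_add_smul hz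
    rw [map_add, map_smul, map_smul, smul_eq_mul, smul_eq_mul] at hz1
    have hs : s = 0 := by
      by_contra hs
      have h1 : s * φ a < |s| := (le_abs_self _).trans_lt (by
        rw [abs_mul]; exact mul_lt_of_lt_one_right (abs_pos.2 hs) hlt)
      have h2 : t * φ b ≤ |t| := (le_abs_self _).trans (by
        rw [abs_mul]; exact mul_le_of_le_one_right (abs_nonneg _) hb)
      linarith
    rw [hs, zero_mul, zero_add] at hz1
    rw [hs, zero_smul, zero_add, eq_inv_of_mul_eq_one_left hz1]
  exact hxy ((key x hxP hx).trans (key y hyP hy).symm)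

/-- In the linear coordinates `φ₁`, `φ₂` of the plane `X`, the norm is the maximum norm. -/
structure IsMaxNorm (φ₁ φ₂ : X →ₗ[ℝ] ℝ) : Prop where
  norm_eq : ∀ x, ‖x‖ = max |φ₁ x| |φ₂ x|
  exists_eq : ∀ s t : ℝ, ∃ x, φ₁ x = s ∧ φ₂ x = t

theorem max_abs_add_sub (s t : ℝ) : max |s + t| |s - t| = |s| + |t| := by
  refine le_antisymm (max_le (abs_add_le s t) (abs_sub s t)) ?_
  rcases abs_cases s with ⟨h1, -⟩ | ⟨h1, -⟩ <;> rcases abs_cases t with ⟨h2, -⟩ | ⟨h2, -⟩ <;>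
    rw [h1, h2]
  · exact le_max_of_le_left (le_abs_self _)
  · exact le_max_of_le_right (le_abs_self _)
  · exact le_max_of_le_right ((neg_le_abs _).trans' (by linarith))
  · exact le_max_of_le_left ((neg_le_abs _).trans' (by linarith))

/-- If the unit ball is a quadrilateral, then the norm is the maximum norm in the coordinates given
by two non-opposite facets. -/
theorem IsQuadrilateral.isMaxNorm (hX : Module.finrank ℝ X = 2)
    (hP : IsQuadrilateral (Metric.closedBall (0 : X) 1)) {φ₁ φ₂ : X →ₗ[ℝ] ℝ}
    (hφ₁ : IsFacetFunctional (Metric.closedBall (0 : X) 1) φ₁)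
    (hφ₂ : IsFacetFunctional (Metric.closedBall (0 : X) 1) φ₂)
    (hne : φ₂ ≠ φ₁) (hne' : φ₂ ≠ -φ₁) : IsMaxNorm φ₁ φ₂ := by
  obtain ⟨a, b, hB⟩ := hP.exists_eq_convexHull hX
  have hB' : Metric.closedBall (0 : X) 1 = convexHull ℝ {b, -b, a, -a} := by
    rw [hB]
    congr 1
    ext x
    simp only [Set.mem_insert_iff, Set.mem_singleton_iff]
    tauto
  have ha : ‖a‖ ≤ 1 := by
    rw [← mem_closedBall_zero_iff, hB]; exact subset_convexHull ℝ _ (by simp)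
  have hb : ‖b‖ ≤ 1 := by
    rw [← mem_closedBall_zero_iff, hB]; exact subset_convexHull ℝ _ (by simp)
  have hspan : ∀ x, ∃ s t : ℝ, x = s • a + t • b := by
    intro x
    rcases eq_or_ne x 0 with rfl | hx
    · exact ⟨0, 0, by simp⟩
    · have hpos : 0 < ‖x‖ := norm_pos_iff.2 hx
      have hmem : ‖x‖⁻¹ • x ∈ Metric.closedBall (0 : X) 1 := by
        rw [mem_closedBall_zero_iff, norm_smul, norm_inv, norm_norm, inv_mul_cancel₀ hpos.ne']
      rw [hB] at hmem
      obtain ⟨s, t, -, hst⟩ := exists_eq_smul_add_smul hmem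
      refine ⟨‖x‖ * s, ‖x‖ * t, ?_⟩
      rw [mul_smul, mul_smul, ← smul_add, ← hst, smul_inv_smul₀ hpos.ne']
  have hext : ∀ φ ψ : X →ₗ[ℝ] ℝ, φ a = ψ a → φ b = ψ b → φ = ψ := by
    intro φ ψ h1 h2
    ext x
    obtain ⟨s, t, rfl⟩ := hspan x
    simp [h1, h2]
  have h1a := hφ₁.abs_eq_one hB
  have h1b := hφ₁.abs_eq_one hB'
  have h2a := hφ₂.abs_eq_one hB
  have h2b := hφ₂.abs_eq_one hB'
  have hnorm : ∀ x, ‖x‖ = max |φ₁ x| |φ₂ x| := by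
    intro x
    refine le_antisymm ?_ (max_le (abs_le_norm_of_le_one hφ₁.1 x) (abs_le_norm_of_le_one hφ₂.1 x))
    obtain ⟨s, t, rfl⟩ := hspan x
    have hle : ‖s • a + t • b‖ ≤ |s| + |t| := by
      refine (norm_add_le _ _).trans (add_le_add ?_ ?_)
      all_goals
        rw [norm_smul, Real.norm_eq_abs]
        exact mul_le_of_le_one_right (abs_nonneg _) (by assumption)
    refine hle.trans (le_of_eq ?_)
    have hs : |s| = |s * φ₁ a| := by rw [abs_mul, h1a, mul_one]
    have ht : |t| = |t * φ₁ b| := by rw [abs_mul, h1b, mul_one]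
    rw [hs, ht, ← max_abs_add_sub]
    simp only [map_add, map_smul, smul_eq_mul]
    congr 1
    -- Since `φ₂ ≠ ±φ₁`, the signs of `φ₁`, `φ₂` agree at exactly one of `a`, `b`.
    rcases abs_eq_abs.1 (h2a.trans h1a.symm) with h1 | h1 <;>
      rcases abs_eq_abs.1 (h2b.trans h1b.symm) with h2 | h2
    · exact absurd (hext _ _ h1 h2) hne
    · rw [h1, h2]; ring_nf
    · rw [h1, h2, abs_sub_comm]; ring_nf
    · exact absurd (hext _ _ h1 h2) hne'
  refine ⟨hnorm, fun s t => ?_⟩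
  have : FiniteDimensional ℝ X := Module.finite_of_finrank_pos (by rw [hX]; norm_num)
  have hinj : Function.Injective (φ₁.prod φ₂) := by
    rw [injective_iff_map_eq_zero]
    intro x hx
    obtain ⟨hx1, hx2⟩ := Prod.mk_eq_zero.1 hx
    rw [← norm_eq_zero, hnorm, hx1, hx2, abs_zero, max_self]
  have hsurj := (LinearMap.injective_iff_surjective_of_finrank_eq_finrank (by
    rw [hX, Module.finrank_prod, Module.finrank_self])).1 hinj
  obtain ⟨x, hx⟩ := hsurj (s, t)
  exact ⟨x, congrArg Prod.fst hx, congrArg Prod.snd hx⟩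

end Norm

/-! ### Frameworks in the plane with the maximum norm -/

section MaxNorm

variable {X : Type*} [NormedAddCommGroup X] [NormedSpace ℝ X] {φ₁ φ₂ : X →ₗ[ℝ] ℝ}

namespace IsMaxNorm

theorem symm (h : IsMaxNorm φ₁ φ₂) : IsMaxNorm φ₂ φ₁ :=
  ⟨fun x => by rw [h.norm_eq, max_comm], fun s t => by
    obtain ⟨x, hx, hx'⟩ := h.exists_eq t s
    exact ⟨x, hx', hx⟩⟩

theorem ext (h : IsMaxNorm φ₁ φ₂) {x y : X} (h₁ : φ₁ x = φ₁ y) (h₂ : φ₂ x = φ₂ y) : x = y := by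
  rw [← sub_eq_zero, ← norm_eq_zero, h.norm_eq, map_sub, map_sub, h₁, h₂, sub_self, sub_self,
    abs_zero, max_self]

theorem abs_le_norm (h : IsMaxNorm φ₁ φ₂) (x : X) : |φ₁ x| ≤ ‖x‖ := by
  rw [h.norm_eq]
  exact le_max_left _ _

theorem continuous (h : IsMaxNorm φ₁ φ₂) : Continuous φ₁ :=
  AddMonoidHomClass.continuous_of_bound φ₁ 1 fun x => by
    rw [one_mul, Real.norm_eq_abs]
    exact h.abs_le_norm x

/-- Where the first coordinate dominates, the norm is differentiable. -/
theorem hasFDerivAt_norm (h : IsMaxNorm φ₁ φ₂) {d : X} (hd : |φ₂ d| < |φ₁ d|) :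
    HasFDerivAt (fun x : X => ‖x‖)
      ((SignType.sign (φ₁ d) : ℝ) • (⟨φ₁, h.continuous⟩ : X →L[ℝ] ℝ)) d := by
  have hne : φ₁ d ≠ 0 := abs_pos.1 ((abs_nonneg _).trans_lt hd)
  have h1 : HasFDerivAt (fun x : X => |φ₁ x|)
      ((SignType.sign (φ₁ d) : ℝ) • (⟨φ₁, h.continuous⟩ : X →L[ℝ] ℝ)) d :=
    (hasDerivAt_abs hne).comp_hasFDerivAt d (⟨φ₁, h.continuous⟩ : X →L[ℝ] ℝ).hasFDerivAt
  refine h1.congr_of_eventuallyEq ?_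
  have h2 : ∀ᶠ x in 𝓝 d, |φ₂ x| < |φ₁ x| :=
    (h.symm.continuous.abs.tendsto d).eventually_lt (h.continuous.abs.tendsto d) hd
  filter_upwards [h2] with x hx
  rw [h.norm_eq, max_eq_left hx.le]

theorem differentiableAt_norm (h : IsMaxNorm φ₁ φ₂) {d : X} (hd : |φ₁ d| ≠ |φ₂ d|) :
    DifferentiableAt ℝ (fun x : X => ‖x‖) d := by
  rcases lt_or_gt_of_ne hd with hd | hd
  · exact (h.symm.hasFDerivAt_norm hd).differentiableAt
  · exact (h.hasFDerivAt_norm hd).differentiableAt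

/-- At a nonzero point of a diagonal, the norm has a kink in the direction of the first axis. -/
theorem abs_ne_abs_of_differentiableAt (h : IsMaxNorm φ₁ φ₂) {d z : X} (hd : d ≠ 0)
    (hz₁ : φ₁ z = φ₁ d) (hz₂ : φ₂ z = 0) (hdiff : DifferentiableAt ℝ (fun t : ℝ => ‖d + t • z‖) 0) :
    |φ₁ d| ≠ |φ₂ d| := by
  intro heq
  have hpos : 0 < |φ₁ d| := by
    have := norm_pos_iff.2 hd
    rwa [h.norm_eq, ← heq, max_self] at this
  refine not_differentiableAt_abs_zero ?_
  -- Near `0` the norm is a multiple of `max (1 + t) 1`, and `|t| = 2 * max (1 + t) 1 - 2 - t`.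
  have h1 : DifferentiableAt ℝ (fun t : ℝ => 2 * (|φ₁ d|⁻¹ * ‖d + t • z‖) - 2 - t) 0 := by
    fun_prop
  refine h1.congr_of_eventuallyEq ?_
  filter_upwards [Ioo_mem_nhds (show (-1 : ℝ) < 0 by norm_num) one_pos] with t ht
  have h2 : 0 < 1 + t := by linarith [ht.1]
  have h3 : ‖d + t • z‖ = |φ₁ d| * max (1 + t) 1 := by
    rw [h.norm_eq, map_add, map_add, map_smul, map_smul, hz₁, hz₂, smul_zero, add_zero, ← heq,
      smul_eq_mul, ← one_add_mul, abs_mul, abs_of_pos h2, mul_max_of_nonneg _ _ hpos.le, mul_one,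
      mul_comm (1 + t)]
  rw [h3, inv_mul_cancel_left₀ hpos.ne']
  rcases le_total 0 t with h4 | h4
  · rw [abs_of_nonneg h4, max_eq_left (by linarith)]; ring
  · rw [abs_of_nonpos h4, max_eq_right (by linarith)]; ring

end IsMaxNorm

variable {V : Type*} {G H : SimpleGraph V} {p u : V → X}

/-- No edge of the framework is parallel to a diagonal of the coordinate system. -/
def IsGeneral (φ₁ φ₂ : X →ₗ[ℝ] ℝ) (G : SimpleGraph V) (p : V → X) : Prop :=
  ∀ v w, G.Adj v w → |φ₁ (p v - p w)| ≠ |φ₂ (p v - p w)|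

/-- The norm is differentiable at a nonzero vector if and only if the vector is not on a diagonal. -/
theorem IsMaxNorm.isGeneral_iff [Finite V] (h : IsMaxNorm φ₁ φ₂) :
    IsGeneral φ₁ φ₂ G p ↔ IsFramework G p ∧ WellPositioned G p := by
  classical
  have := Fintype.ofFinite V
  have := Fintype.ofFinite G.edgeSet
  constructor
  · intro hG
    refine ⟨fun v w hvw heq => hG v w hvw (by rw [heq, sub_self, map_zero, map_zero]), ?_⟩
    refine differentiableAt_pi.2 fun e => ?_
    obtain ⟨e, he⟩ := e
    induction e using Sym2.inductionOn with
    | hf v w =>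
      change DifferentiableAt ℝ (fun x : V → X => ‖x v - x w‖) p
      exact DifferentiableAt.comp (g := fun x : X => ‖x‖) (f := fun x : V → X => x v - x w) p
        (h.differentiableAt_norm (hG v w he)) (by fun_prop)
  · rintro ⟨hF, hW⟩ v w hvw
    obtain ⟨z, hz₁, hz₂⟩ := h.exists_eq (φ₁ (p v - p w)) 0
    refine h.abs_ne_abs_of_differentiableAt (sub_ne_zero.2 (hF v w hvw)) hz₁ hz₂ ?_
    have h1 : DifferentiableAt ℝ (fun x : V → X => ‖x v - x w‖) p :=
      differentiableAt_pi.1 hW ⟨s(v, w), hvw⟩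
    have h2 : DifferentiableAt ℝ (fun t : ℝ => p + t • (Pi.single v z : V → X)) 0 := by fun_prop
    have h3 := DifferentiableAt.comp (g := fun x : V → X => ‖x v - x w‖)
      (f := fun t : ℝ => p + t • (Pi.single v z : V → X)) (0 : ℝ) (by simpa using h1) h2
    refine h3.congr_of_eventuallyEq (Eventually.of_forall fun t => ?_)
    simp only [Function.comp_apply, Pi.add_apply, Pi.smul_apply, Pi.single_eq_same,
      Pi.single_eq_of_ne hvw.ne', smul_zero, add_zero]
    rw [add_sub_right_comm]

theorem IsMaxNorm.hasDerivAt_norm_iff (h : IsMaxNorm φ₁ φ₂) {d : X} (hd : |φ₂ d| < |φ₁ d|)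
    {f : ℝ → X} {f' : X} (hf : HasDerivAt f f' 0) (hf0 : f 0 = d) :
    HasDerivAt (fun t => ‖f t‖) 0 0 ↔ φ₁ f' = 0 := by
  subst hf0
  have hne : φ₁ (f 0) ≠ 0 := abs_pos.1 ((abs_nonneg _).trans_lt hd)
  have h1 : HasDerivAt (fun t => ‖f t‖) (SignType.sign (φ₁ (f 0)) * φ₁ f') 0 :=
    (h.hasFDerivAt_norm hd).comp_hasDerivAt 0 hf
  constructor
  · intro h2
    refine (mul_eq_zero.1 (h1.unique h2)).resolve_left ?_
    rcases hne.lt_or_gt with h3 | h3 <;> simp [h3]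
  · intro h2
    rwa [h2, mul_zero] at h1

/-- An edge constrains the coordinate of a flex that dominates in the edge vector. -/
theorem IsMaxNorm.isInfinitesimalFlex_iff [Finite V] (h : IsMaxNorm φ₁ φ₂)
    (hG : IsGeneral φ₁ φ₂ G p) :
    IsInfinitesimalFlex G p u ↔ ∀ v w, G.Adj v w →
      (|φ₂ (p v - p w)| < |φ₁ (p v - p w)| → φ₁ (u v) = φ₁ (u w)) ∧
      (¬ |φ₂ (p v - p w)| < |φ₁ (p v - p w)| → φ₂ (u v) = φ₂ (u w)) := by
  have := Fintype.ofFinite V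
  have := Fintype.ofFinite G.edgeSet
  have key : ∀ v w, G.Adj v w → (HasDerivAt
      (fun t : ℝ => ‖(p + t • u) v - (p + t • u) w‖) 0 0 ↔
      (|φ₂ (p v - p w)| < |φ₁ (p v - p w)| → φ₁ (u v) = φ₁ (u w)) ∧
      (¬ |φ₂ (p v - p w)| < |φ₁ (p v - p w)| → φ₂ (u v) = φ₂ (u w))) := by
    intro v w hvw
    have hf : HasDerivAt (fun t : ℝ => (p + t • u) v - (p + t • u) w) (u v - u w) 0 := by
      have h1 : ∀ v, HasDerivAt (fun t : ℝ => p v + t • u v) (u v) 0 := fun v => by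
        simpa using ((hasDerivAt_id (0 : ℝ)).smul_const (u v)).const_add (p v)
      exact (h1 v).sub (h1 w)
    have hf0 : (p + (0 : ℝ) • u) v - (p + (0 : ℝ) • u) w = p v - p w := by simp
    by_cases hlt : |φ₂ (p v - p w)| < |φ₁ (p v - p w)|
    · rw [h.hasDerivAt_norm_iff hlt hf hf0, map_sub φ₁ (u v), sub_eq_zero]
      exact ⟨fun h1 => ⟨fun _ => h1, fun h2 => absurd hlt h2⟩, fun h1 => h1.1 hlt⟩
    · have hlt' := lt_of_le_of_ne (not_lt.1 hlt) (hG v w hvw)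
      rw [h.symm.hasDerivAt_norm_iff hlt' hf hf0, map_sub φ₂ (u v), sub_eq_zero]
      exact ⟨fun h1 => ⟨fun h2 => absurd h2 hlt, fun _ => h1⟩, fun h1 => h1.2 hlt⟩
  rw [IsInfinitesimalFlex, hasDerivAt_pi]
  constructor
  · intro h1 v w hvw
    exact (key v w hvw).1 (h1 ⟨s(v, w), hvw⟩)
  · rintro h1 ⟨e, he⟩
    induction e using Sym2.inductionOn with
    | hf v w => exact (key v w he).2 (h1 v w he)

/-- The velocities of a rigid motion have the same first coordinate everywhere: any two points can
be joined via a third one that is far away from both in the first coordinate direction. -/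
theorem IsMaxNorm.apply_deriv_eq (h : IsMaxNorm φ₁ φ₂) {α : X → ℝ → X} (hα : IsRigidMotion α)
    (x y : X) : φ₁ (deriv (α x) 0) = φ₁ (deriv (α y) 0) := by
  have key : ∀ x y, |φ₂ (x - y)| < |φ₁ (x - y)| →
      φ₁ (deriv (α x) 0) = φ₁ (deriv (α y) 0) := by
    intro x y hxy
    have h1 := ((hα.differentiableAt x).hasDerivAt).sub ((hα.differentiableAt y).hasDerivAt)
    have h2 := (h.hasDerivAt_norm_iff hxy h1 (by rw [Pi.sub_apply, hα.start, hα.start])).1 (by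
      refine (hasDerivAt_const (0 : ℝ) ‖x - y‖).congr_of_eventuallyEq ?_
      filter_upwards [Icc_mem_nhds (show (-1 : ℝ) < 0 by norm_num) one_pos] with t ht
      exact hα.isometric x y t ht)
    rwa [map_sub, sub_eq_zero] at h2
  obtain ⟨z, hz₁, hz₂⟩ := h.exists_eq (|φ₁ x| + |φ₁ y| + |φ₂ x| + |φ₂ y| + 1) 0
  have hfar : ∀ x, |φ₂ x| + φ₁ x < φ₁ z → |φ₂ (x - z)| < |φ₁ (x - z)| := by
    intro x hx
    rw [map_sub, map_sub, hz₂, sub_zero, abs_sub_comm]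
    exact lt_of_lt_of_le (by linarith) (le_abs_self _)
  have hx := le_abs_self (φ₁ x)
  have hy := le_abs_self (φ₁ y)
  exact (key x z (hfar x (by rw [hz₁]; linarith [abs_nonneg (φ₁ y), abs_nonneg (φ₂ y)]))).trans
    (key y z (hfar y (by rw [hz₁]; linarith [abs_nonneg (φ₁ x), abs_nonneg (φ₂ x)]))).symm

/-- The trivial flexes are the translations. -/
theorem IsMaxNorm.isTrivialFlex_iff [Nonempty V] (h : IsMaxNorm φ₁ φ₂) :
    IsTrivialFlex p u ↔ ∀ v w, u v = u w := by
  constructor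
  · rintro ⟨α, hα, hu⟩ v w
    rw [hu, hu]
    exact h.ext (h.apply_deriv_eq hα _ _) (h.symm.apply_deriv_eq hα _ _)
  · intro hu
    obtain ⟨o⟩ := ‹Nonempty V›
    have hd : ∀ x : X, HasDerivAt (fun t : ℝ => x + t • u o) (u o) 0 := fun x => by
      simpa using ((hasDerivAt_id (0 : ℝ)).smul_const (u o)).const_add x
    refine ⟨fun x t => x + t • u o, ⟨fun x => by fun_prop, fun x => (hd x).differentiableAt,
      fun x => by simp, fun x y t _ => by rw [add_sub_add_right_eq_sub]⟩, fun v => ?_⟩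
    rw [(hd (p v)).deriv, hu v o]

/-! ### The reflection -/

theorem IsReflection.apply_eq {T : X ≃ₗᵢ[ℝ] X}
    (hT : IsReflection T (LinearMap.ker φ₁) (LinearMap.ker φ₂)) (x : X) :
    φ₁ (T x) = -φ₁ x ∧ φ₂ (T x) = φ₂ x := by
  obtain ⟨-, -, P, hP, hr, hk, hTx⟩ := hT
  have h1 : φ₁ (x - P x) = 0 := by
    rw [← LinearMap.mem_ker, ← hk, LinearMap.mem_ker, map_sub, hP, sub_self]
  have h2 : φ₂ (P x) = 0 := by
    rw [← LinearMap.mem_ker, ← hr]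
    exact LinearMap.mem_range_self P x
  rw [map_sub, sub_eq_zero] at h1
  rw [hTx, map_sub, map_sub, map_smul, map_smul, ← h1, h2, smul_eq_mul, smul_zero]
  constructor <;> ring

/-- The representation of `ℤ₂` by the reflection in the mirror `ker φ₁`. -/
theorem IsMaxNorm.exists_isReflection (h : IsMaxNorm φ₁ φ₂) :
    ∃ τ : ℤˣ →* (X ≃ₗᵢ[ℝ] X),
      IsReflection (τ (-1)) (LinearMap.ker φ₁) (LinearMap.ker φ₂) := by
  obtain ⟨a, ha₁, ha₂⟩ := h.exists_eq 1 0
  let P : X →ₗ[ℝ] X := φ₁.smulRight a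
  have hP : ∀ x, P x = φ₁ x • a := fun x => rfl
  let L : X →ₗ[ℝ] X := LinearMap.id - (2 : ℝ) • P
  have hL₁ : ∀ x, φ₁ (L x) = -φ₁ x := by
    intro x
    change φ₁ (x - (2 : ℝ) • φ₁ x • a) = _
    rw [map_sub, map_smul, map_smul, ha₁, smul_eq_mul, smul_eq_mul]; ring
  have hL₂ : ∀ x, φ₂ (L x) = φ₂ x := by
    intro x
    change φ₂ (x - (2 : ℝ) • φ₁ x • a) = _
    rw [map_sub, map_smul, map_smul, ha₂, smul_zero, smul_zero, sub_zero]
  have hLL : Function.Involutive L := fun x =>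
    h.ext (by rw [hL₁, hL₁, neg_neg]) (by rw [hL₂, hL₂])
  let T : X ≃ₗᵢ[ℝ] X :=
    { LinearEquiv.ofInvolutive L hLL with
      norm_map' := fun x => by
        change ‖L x‖ = ‖x‖
        rw [h.norm_eq, h.norm_eq, hL₁, hL₂, abs_neg] }
  have hTT : T * T = 1 := LinearIsometryEquiv.ext hLL
  let τ : ℤˣ →* (X ≃ₗᵢ[ℝ] X) := MonoidHom.mk' (fun γ => if γ = 1 then 1 else T) (by
    intro γ δ
    rcases Int.units_eq_one_or γ with rfl | rfl <;> rcases Int.units_eq_one_or δ with rfl | rfl <;>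
      simp [hTT])
  have hτ : ∀ x, τ (-1) x = L x := fun x => by simp [τ, T]
  have hker₂ : LinearMap.ker φ₂ = ℝ ∙ a := by
    ext x
    rw [LinearMap.mem_ker, Submodule.mem_span_singleton]
    constructor
    · intro hx
      exact ⟨φ₁ x, h.ext (by simp [ha₁]) (by simp [ha₂, hx])⟩
    · rintro ⟨c, rfl⟩
      rw [map_smul, ha₂, smul_zero]
  have ha0 : a ≠ 0 := fun h0 => by
    rw [h0, map_zero] at ha₁
    exact zero_ne_one ha₁
  refine ⟨τ, ⟨?_, ?_⟩, ?_, P, ?_, ?_, ?_, ?_⟩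
  · rw [Submodule.disjoint_def]
    intro x hx₁ hx₂
    exact h.ext (by rw [LinearMap.mem_ker.1 hx₁, map_zero])
      (by rw [LinearMap.mem_ker.1 hx₂, map_zero])
  · rw [codisjoint_iff, Submodule.eq_top_iff']
    intro x
    refine Submodule.mem_sup.2 ⟨x - φ₁ x • a, ?_, φ₁ x • a, ?_, sub_add_cancel _ _⟩
    · rw [LinearMap.mem_ker, map_sub, map_smul, ha₁, smul_eq_mul, mul_one, sub_self]
    · rw [LinearMap.mem_ker, map_smul, ha₂, smul_zero]
  · rw [hker₂, finrank_span_singleton ha0]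
  · intro x
    rw [hP, hP, map_smul, ha₁, smul_eq_mul, mul_one]
  · rw [hker₂]
    refine le_antisymm ?_ ?_
    · rintro _ ⟨x, rfl⟩
      exact Submodule.smul_mem _ _ (Submodule.mem_span_singleton_self a)
    · rw [Submodule.span_singleton_le_iff_mem]
      exact ⟨a, by rw [hP, ha₁, one_smul]⟩
  · ext x
    rw [LinearMap.mem_ker, LinearMap.mem_ker, hP, smul_eq_zero]
    exact or_iff_left ha0
  · exact hτ

end MaxNorm

/-! ### Symmetric frameworks and their signed quotient graphs -/

section Transfer

variable {V : Type*} {G : SimpleGraph V} {θ : ℤˣ →* (G ≃g G)} {R : Set V}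

theorem eq_of_act_eq (hθ : ∀ v, θ (-1) v ≠ v) {γ δ : ℤˣ} {v : V} (h : θ γ v = θ δ v) : γ = δ := by
  have h1 : θ (δ⁻¹ * γ) v = v := by
    rw [← act_act, h, act_act, inv_mul_cancel, map_one, RelIso.one_apply]
  rcases Int.units_eq_one_or (δ⁻¹ * γ) with h2 | h2
  · rwa [inv_mul_eq_one, eq_comm] at h2
  · rw [h2] at h1
    exact absurd h1 (hθ v)

/-- The chosen representative of a vertex orbit. -/
def orbitRep (hR : IsRepresentatives θ R) (q : VertexOrbit θ) : V := (hR q).choose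

theorem orbitRep_mem (hR : IsRepresentatives θ R) (q : VertexOrbit θ) : orbitRep hR q ∈ R :=
  (hR q).choose_spec.1.1

theorem vertexOrbit_orbitRep (hR : IsRepresentatives θ R) (q : VertexOrbit θ) :
    vertexOrbit θ (orbitRep hR q) = q :=
  (hR q).choose_spec.1.2

theorem orbitRep_eq (hR : IsRepresentatives θ R) {v : V} (hv : v ∈ R) :
    orbitRep hR (vertexOrbit θ v) = v :=
  (hR (vertexOrbit θ v)).unique ⟨orbitRep_mem hR _, vertexOrbit_orbitRep hR _⟩ ⟨hv, rfl⟩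

variable (R) in
open Classical in
/-- The sign that distinguishes the chosen representatives from the other vertices. -/
def vertexSign (v : V) : ℤˣ := if v ∈ R then 1 else -1

theorem act_vertexSign_orbitRep (hR : IsRepresentatives θ R) (v : V) :
    θ (vertexSign R v) (orbitRep hR (vertexOrbit θ v)) = v := by
  by_cases hv : v ∈ R
  · rw [vertexSign, if_pos hv, map_one, RelIso.one_apply, orbitRep_eq hR hv]
  · obtain ⟨γ, hγ⟩ := Quotient.exact (vertexOrbit_orbitRep hR (vertexOrbit θ v))
    rcases Int.units_eq_one_or γ with rfl | rfl
    · rw [map_one, RelIso.one_apply] at hγ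
      exact absurd (hγ ▸ orbitRep_mem hR _) hv
    · rwa [vertexSign, if_neg hv]

theorem vertexSign_act (hθ : ∀ v, θ (-1) v ≠ v) (hR : IsRepresentatives θ R) (γ : ℤˣ) (v : V) :
    vertexSign R (θ γ v) = γ * vertexSign R v := by
  have h1 := act_vertexSign_orbitRep hR (θ γ v)
  rw [vertexOrbit_act] at h1
  refine eq_of_act_eq hθ (h1.trans ?_)
  rw [← act_act, act_vertexSign_orbitRep hR v]

theorem vertexSign_of_mem {v : V} (hv : v ∈ R) : vertexSign R v = 1 := if_pos hv

theorem signedQuotient_ends (hR : IsRepresentatives θ R) {v w : V} (h : G.Adj v w) :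
    (signedQuotient θ R hR).ends (edgeOrbit θ ⟨s(v, w), h⟩) =
      s(vertexOrbit θ v, vertexOrbit θ w) := rfl

theorem signedQuotient_gain (hθ : ∀ v, θ (-1) v ≠ v) (hR : IsRepresentatives θ R) {v w : V}
    (h : G.Adj v w) :
    (signedQuotient θ R hR).gain (edgeOrbit θ ⟨s(v, w), h⟩) =
      vertexSign R v * vertexSign R w := by
  change orbitGain θ R _ = _
  obtain ⟨a, ha, b, hb, f, hf, hfq, -⟩ := exists_normal_form θ hR (edgeOrbit θ ⟨s(v, w), h⟩)
  obtain ⟨γ, hγ⟩ := Quotient.exact hfq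
  rw [hf, Sym2.map_mk, act_act] at hγ
  generalize orbitGain θ R (edgeOrbit θ ⟨s(v, w), h⟩) = g at hγ ⊢
  have hsign : ∀ δ, ∀ c ∈ R, vertexSign R (θ δ c) = δ := fun δ c hc => by
    rw [vertexSign_act hθ hR, vertexSign_of_mem hc, mul_one]
  rcases Sym2.eq_iff.1 hγ with ⟨h1, h2⟩ | ⟨h1, h2⟩
  · rw [← h1, ← h2, hsign γ a ha, hsign _ b hb, ← mul_assoc, Int.units_mul_self, one_mul]
  · rw [← h1, ← h2, hsign γ a ha, hsign _ b hb, mul_comm, ← mul_assoc, Int.units_mul_self, one_mul]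

/-- The edges of the signed quotient graph that come from the edges of the subgraph `H`. -/
def edgeOrbits (θ : ℤˣ →* (G ≃g G)) (H : SimpleGraph V) : Set (EdgeOrbit θ) :=
  {q | ∃ v w, ∃ h : G.Adj v w, H.Adj v w ∧ edgeOrbit θ ⟨s(v, w), h⟩ = q}

theorem edgeOrbits_self : edgeOrbits θ G = Set.univ := by
  rw [Set.eq_univ_iff_forall]
  intro q
  obtain ⟨⟨e, he⟩, rfl⟩ := Quotient.exists_rep q
  induction e using Sym2.inductionOn with
  | hf v w => exact ⟨v, w, he, he, rfl⟩

theorem adj_of_mem_edgeOrbits {H : SimpleGraph V}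
    (hinv : ∀ v w, H.Adj v w ↔ H.Adj (θ (-1) v) (θ (-1) w)) {v w : V} (h : G.Adj v w)
    (hq : edgeOrbit θ ⟨s(v, w), h⟩ ∈ edgeOrbits θ H) : H.Adj v w := by
  obtain ⟨a, b, hab, hH, hq⟩ := hq
  obtain ⟨γ, hγ⟩ := Quotient.exact hq
  have hact : H.Adj (θ γ a) (θ γ b) := by
    rcases Int.units_eq_one_or γ with rfl | rfl
    · rwa [map_one, RelIso.one_apply, RelIso.one_apply]
    · exact (hinv a b).1 hH
  have hγ : s(θ γ a, θ γ b) = s(v, w) := hγ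
  rwa [← SimpleGraph.mem_edgeSet, ← hγ, SimpleGraph.mem_edgeSet]

/-- The subgraph obtained by deleting an edge orbit. -/
def deleteOrbit (q : EdgeOrbit θ) : SimpleGraph V where
  Adj v w := ∃ h : G.Adj v w, edgeOrbit θ ⟨s(v, w), h⟩ ≠ q
  symm := ⟨by
    rintro v w ⟨h, hq⟩
    refine ⟨h.symm, fun h' => hq ?_⟩
    rw [← h']
    congr 2
    exact Sym2.eq_swap⟩
  loopless := ⟨fun v h => G.loopless.irrefl v h.1⟩

theorem deleteOrbit_le (q : EdgeOrbit θ) : deleteOrbit q ≤ G := fun _ _ h => h.1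

theorem edgeOrbits_deleteOrbit (q : EdgeOrbit θ) : edgeOrbits θ (deleteOrbit q) = {q}ᶜ := by
  ext q'
  constructor
  · rintro ⟨v, w, h, ⟨_, h1⟩, rfl⟩
    exact h1
  · intro hq'
    obtain ⟨v, w, h, -, rfl⟩ : q' ∈ edgeOrbits θ G := edgeOrbits_self ▸ Set.mem_univ q'
    exact ⟨v, w, h, ⟨h, hq'⟩, rfl⟩

theorem deleteOrbit_ne (q : EdgeOrbit θ) : deleteOrbit q ≠ G := by
  intro h
  have h1 := edgeOrbits_deleteOrbit q
  rw [h, edgeOrbits_self] at h1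
  exact h1.le (Set.mem_univ q) rfl

theorem deleteOrbit_invariant (q : EdgeOrbit θ) (v w : V) :
    (deleteOrbit q).Adj v w ↔ (deleteOrbit q).Adj (θ (-1) v) (θ (-1) w) := by
  have horb : ∀ (h : G.Adj v w) (h' : G.Adj (θ (-1) v) (θ (-1) w)),
      edgeOrbit θ ⟨s(v, w), h⟩ = edgeOrbit θ ⟨s(θ (-1) v, θ (-1) w), h'⟩ :=
    fun _ _ => Quotient.sound ⟨-1, rfl⟩
  constructor
  · rintro ⟨h, hq⟩
    have h' := (θ (-1)).map_rel_iff.2 h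
    exact ⟨h', by rwa [← horb h h']⟩
  · rintro ⟨h', hq⟩
    have h := (θ (-1)).map_rel_iff.1 h'
    exact ⟨h, by rwa [horb h h']⟩

variable {X : Type*} [NormedAddCommGroup X] [NormedSpace ℝ X] {φ₁ φ₂ : X →ₗ[ℝ] ℝ}

variable (R θ) in
/-- `u` is the symmetric vector whose coordinates at the orbit representatives are given by `x` and
`y`, where `-1` acts on the plane by `(ξ, η) ↦ (-ξ, η)`. -/
structure IsLift (φ₁ φ₂ : X →ₗ[ℝ] ℝ) (x y : VertexOrbit θ → ℝ) (u : V → X) : Prop where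
  fst : ∀ v, φ₁ (u v) = signReal (vertexSign R v) * x (vertexOrbit θ v)
  snd : ∀ v, φ₂ (u v) = y (vertexOrbit θ v)

theorem IsMaxNorm.exists_isLift (h : IsMaxNorm φ₁ φ₂) (x y : VertexOrbit θ → ℝ) :
    ∃ u, IsLift θ R φ₁ φ₂ x y u := by
  choose f hf₁ hf₂ using h.exists_eq
  exact ⟨fun v => f (signReal (vertexSign R v) * x (vertexOrbit θ v)) (y (vertexOrbit θ v)),
    fun v => hf₁ _ _, fun v => hf₂ _ _⟩

variable {τ : ℤˣ →* (X ≃ₗᵢ[ℝ] X)}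

theorem IsLift.isSymmetricVec (h : IsMaxNorm φ₁ φ₂) (hθ : ∀ v, θ (-1) v ≠ v)
    (hR : IsRepresentatives θ R) (hτ : ∀ z, φ₁ (τ (-1) z) = -φ₁ z ∧ φ₂ (τ (-1) z) = φ₂ z)
    {x y : VertexOrbit θ → ℝ} {u : V → X} (hu : IsLift θ R φ₁ φ₂ x y u) :
    IsSymmetricVec θ τ u := by
  intro v
  refine h.ext ?_ ?_
  · rw [(hτ _).1, hu.fst, hu.fst, vertexSign_act hθ hR, vertexOrbit_act, signReal_mul,
      signReal_neg_one]
    ring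
  · rw [(hτ _).2, hu.snd, hu.snd, vertexOrbit_act]

theorem IsSymmetricVec.isLift (hR : IsRepresentatives θ R)
    (hτ : ∀ z, φ₁ (τ (-1) z) = -φ₁ z ∧ φ₂ (τ (-1) z) = φ₂ z) {u : V → X}
    (hu : IsSymmetricVec θ τ u) :
    IsLift θ R φ₁ φ₂ (fun q => φ₁ (u (orbitRep hR q))) (fun q => φ₂ (u (orbitRep hR q))) u := by
  have key : ∀ v, φ₁ (u v) = signReal (vertexSign R v) * φ₁ (u (orbitRep hR (vertexOrbit θ v))) ∧
      φ₂ (u v) = φ₂ (u (orbitRep hR (vertexOrbit θ v))) := by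
    intro v
    have h1 := act_vertexSign_orbitRep hR v
    rcases Int.units_eq_one_or (vertexSign R v) with h2 | h2
    · rw [h2, map_one, RelIso.one_apply] at h1
      rw [h2, signReal_one, one_mul, h1]
      exact ⟨rfl, rfl⟩
    · rw [h2] at h1
      have h3 := hu (orbitRep hR (vertexOrbit θ v))
      rw [h1] at h3
      rw [h2, signReal_neg_one, neg_one_mul, ← h3]
      exact hτ _
  exact ⟨fun v => (key v).1, fun v => (key v).2⟩

/-- A lifted vector is constant if and only if it is a vertical translation. -/
theorem IsLift.forall_eq_iff (h : IsMaxNorm φ₁ φ₂) (hθ : ∀ v, θ (-1) v ≠ v)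
    (hR : IsRepresentatives θ R) {x y : VertexOrbit θ → ℝ} {u : V → X}
    (hu : IsLift θ R φ₁ φ₂ x y u) :
    (∀ v w, u v = u w) ↔ (∀ q, x q = 0) ∧ ∀ q q', y q = y q' := by
  constructor
  · intro h1
    refine ⟨fun q => ?_, fun q q' => ?_⟩
    · obtain ⟨v, rfl⟩ := Quotient.exists_rep q
      have h2 := congrArg φ₁ (h1 v (θ (-1) v))
      rw [hu.fst, hu.fst, vertexSign_act hθ hR, vertexOrbit_act, signReal_mul,
        signReal_neg_one] at h2
      exact (mul_eq_zero.1 (show signReal (vertexSign R v) * x (vertexOrbit θ v) = 0 by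
        linarith)).resolve_left (signReal_ne_zero _)
    · obtain ⟨v, rfl⟩ := Quotient.exists_rep q
      obtain ⟨w, rfl⟩ := Quotient.exists_rep q'
      have h2 := congrArg φ₂ (h1 v w)
      rwa [hu.snd, hu.snd] at h2
  · rintro ⟨h1, h2⟩ v w
    exact h.ext (by rw [hu.fst, hu.fst, h1, h1, mul_zero, mul_zero])
      (by rw [hu.snd, hu.snd, h2])

section Edges

variable {x y u₁ u₂ : VertexOrbit θ → ℝ} {p u : V → X}

theorem IsLift.abs_fst (hθ : ∀ v, θ (-1) v ≠ v) (hR : IsRepresentatives θ R)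
    (hp : IsLift θ R φ₁ φ₂ x y p) {v w : V} (h : G.Adj v w) :
    |φ₁ (p v - p w)| = (signedQuotient θ R hR).hlen x (edgeOrbit θ ⟨s(v, w), h⟩) := by
  rw [SignedGraph.hlen_eq (signedQuotient_ends hR h), signedQuotient_gain hθ, map_sub, hp.fst,
    hp.fst, signReal_mul]
  rw [← one_mul (|_ - signReal _ * signReal _ * _|), ← abs_signReal (vertexSign R v), ← abs_mul,
    mul_sub, mul_assoc, signReal_mul_self_mul]

theorem IsLift.abs_snd (hR : IsRepresentatives θ R)
    (hp : IsLift θ R φ₁ φ₂ x y p) {v w : V} (h : G.Adj v w) :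
    |φ₂ (p v - p w)| = (signedQuotient θ R hR).vlen y (edgeOrbit θ ⟨s(v, w), h⟩) := by
  rw [SignedGraph.vlen_eq (signedQuotient_ends hR h), map_sub, hp.snd, hp.snd]

theorem IsLift.isGeneral_iff (hθ : ∀ v, θ (-1) v ≠ v) (hR : IsRepresentatives θ R)
    (hp : IsLift θ R φ₁ φ₂ x y p) : IsGeneral φ₁ φ₂ G p ↔
      ∀ e, (signedQuotient θ R hR).hlen x e ≠ (signedQuotient θ R hR).vlen y e := by
  constructor
  · intro h e
    obtain ⟨v, w, hvw, -, rfl⟩ : e ∈ edgeOrbits θ G := edgeOrbits_self ▸ Set.mem_univ e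
    rw [← hp.abs_fst hθ hR, ← hp.abs_snd hR]
    exact h v w hvw
  · intro h v w hvw
    rw [hp.abs_fst hθ hR hvw, hp.abs_snd hR hvw]
    exact h _

theorem IsLift.isInfinitesimalFlex_iff [Finite V] (h : IsMaxNorm φ₁ φ₂)
    (hθ : ∀ v, θ (-1) v ≠ v) (hR : IsRepresentatives θ R) (hp : IsLift θ R φ₁ φ₂ x y p)
    (hgen : IsGeneral φ₁ φ₂ G p) (hu : IsLift θ R φ₁ φ₂ u₁ u₂ u) {H : SimpleGraph V}
    (hH : H ≤ G) :
    IsInfinitesimalFlex H p u ↔ (signedQuotient θ R hR).IsFlex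
      (fun e => (signedQuotient θ R hR).vlen y e < (signedQuotient θ R hR).hlen x e)
      (edgeOrbits θ H) u₁ u₂ := by
  have hfst : ∀ v w, φ₁ (u v) = φ₁ (u w) ↔ u₁ (vertexOrbit θ v) =
      signReal (vertexSign R v * vertexSign R w) * u₁ (vertexOrbit θ w) := by
    intro v w
    rw [hu.fst, hu.fst, signReal_mul, mul_assoc]
    constructor
    · intro h1
      rw [← h1, signReal_mul_self_mul]
    · intro h1
      rw [h1, signReal_mul_self_mul]
  rw [h.isInfinitesimalFlex_iff fun v w hvw => hgen v w (hH hvw)]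
  constructor
  · rintro h1 _ ⟨v, w, hvw, hHvw, rfl⟩
    have h2 := h1 v w hHvw
    rw [hp.abs_fst hθ hR hvw, hp.abs_snd hR hvw, hfst, hu.snd, hu.snd,
      ← signedQuotient_gain hθ hR hvw] at h2
    exact SignedGraph.flex_edge (signedQuotient_ends hR hvw) h2.1 h2.2
  · intro h1 v w hHvw
    have hvw := hH hHvw
    have h2 := h1 _ ⟨v, w, hvw, hHvw, rfl⟩ _ _ (signedQuotient_ends hR hvw)
    rwa [hp.abs_fst hθ hR hvw, hp.abs_snd hR hvw, hfst, hu.snd, hu.snd,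
      ← signedQuotient_gain hθ hR hvw]

/-- Symmetric infinitesimal rigidity can be read off from the signed quotient graph. -/
theorem IsLift.symInfRigid_iff [Finite V] [Nonempty V] (h : IsMaxNorm φ₁ φ₂)
    (hθ : ∀ v, θ (-1) v ≠ v) (hR : IsRepresentatives θ R)
    (hτ : ∀ z, φ₁ (τ (-1) z) = -φ₁ z ∧ φ₂ (τ (-1) z) = φ₂ z) (hp : IsLift θ R φ₁ φ₂ x y p)
    (hgen : IsGeneral φ₁ φ₂ G p) {H : SimpleGraph V} (hH : H ≤ G) :
    SymInfRigid θ τ H p ↔ (signedQuotient θ R hR).IsRigid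
      (fun e => (signedQuotient θ R hR).vlen y e < (signedQuotient θ R hR).hlen x e)
      (edgeOrbits θ H) := by
  constructor
  · intro h1 u₁ u₂ hu
    obtain ⟨u, hlift⟩ := h.exists_isLift (R := R) u₁ u₂
    rw [← hlift.forall_eq_iff h hθ hR, ← h.isTrivialFlex_iff (p := p)]
    exact h1 u (hlift.isSymmetricVec h hθ hR hτ)
      ((hp.isInfinitesimalFlex_iff h hθ hR hgen hlift hH).2 hu)
  · intro h1 u hsym hflex
    have hlift := hsym.isLift hR hτ
    rw [h.isTrivialFlex_iff, hlift.forall_eq_iff h hθ hR]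
    exact h1 _ _ ((hp.isInfinitesimalFlex_iff h hθ hR hgen hlift hH).1 hflex)

end Edges

end Transfer

end GridLike

end

open GridLike in
theorem theorem22 {X : Type*} [NormedAddCommGroup X] [NormedSpace ℝ X]
    (hX : Module.finrank ℝ X = 2)
    (hP : IsQuadrilateral (Metric.closedBall (0 : X) 1))
    (φ₁ φ₂ : X →ₗ[ℝ] ℝ)
    (hφ₁ : IsFacetFunctional (Metric.closedBall (0 : X) 1) φ₁)
    (hφ₂ : IsFacetFunctional (Metric.closedBall (0 : X) 1) φ₂)
    (hne : φ₂ ≠ φ₁) (hne' : φ₂ ≠ -φ₁)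
    {V : Type*} [Finite V] [Nonempty V] (G : SimpleGraph V) (θ : ℤˣ →* (G ≃g G))
    (hθ : ∀ v, θ (-1) v ≠ v)
    (R : Set V) (hR : IsRepresentatives θ R) :
    List.TFAE [
      ∃ (τ : ℤˣ →* (X ≃ₗᵢ[ℝ] X)) (p : V → X),
        IsReflection (τ (-1)) (LinearMap.ker φ₁) (LinearMap.ker φ₂) ∧
        IsFramework G p ∧ WellPositioned G p ∧ IsSymmetricVec θ τ p ∧ SymIsostatic θ τ p,
      (signedQuotient θ R hR).GainTight,
      (signedQuotient θ R hR).Constructible ] := by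
  have hmax := hP.isMaxNorm hX hφ₁ hφ₂ hne hne'
  tfae_have 1 → 2 := by
    rintro ⟨τ, p, href, hframe, hwell, hsym, hrigid, hmin⟩
    have hτ := href.apply_eq
    have hp := hsym.isLift hR hτ
    have hgen := hmax.isGeneral_iff.2 ⟨hframe, hwell⟩
    have : Nonempty (VertexOrbit θ) := ‹Nonempty V›.map (vertexOrbit θ)
    refine SignedGraph.IsRigid.gainTight
      (edgeOrbits_self ▸ (hp.symInfRigid_iff hmax hθ hR hτ hgen le_rfl).1 hrigid) fun q => ?_
    rw [← edgeOrbits_deleteOrbit, ← hp.symInfRigid_iff hmax hθ hR hτ hgen (deleteOrbit_le q)]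
    exact hmin _ (deleteOrbit_le q) (deleteOrbit_ne q) (deleteOrbit_invariant q)
  tfae_have 2 → 3 := fun h => h.constructible
  tfae_have 3 → 1 := by
    intro h
    obtain ⟨-, -, hcard, x, y, hxy⟩ := h.isRealizable
    obtain ⟨τ, href⟩ := hmax.exists_isReflection
    have hτ := href.apply_eq
    obtain ⟨p, hp⟩ := hmax.exists_isLift (R := R) x y
    have hgen := (hp.isGeneral_iff hθ hR).2 hxy.hlen_ne_vlen
    obtain ⟨hframe, hwell⟩ := hmax.isGeneral_iff.1 hgen
    refine ⟨τ, p, href, hframe, hwell, hp.isSymmetricVec hmax hθ hR hτ, ?_, ?_⟩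
    · rw [hp.symInfRigid_iff hmax hθ hR hτ hgen le_rfl, edgeOrbits_self]
      exact hxy.isRigid
    · intro H hH hHne hinv hrigid
      -- A proper subgraph misses an edge orbit, which leaves too few edges for rigidity.
      have hlt : edgeOrbits θ H ≠ Set.univ := fun huniv =>
        hHne (le_antisymm hH fun v w hvw =>
          adj_of_mem_edgeOrbits hinv hvw (huniv ▸ Set.mem_univ _))
      have h1 := ((hp.symInfRigid_iff hmax hθ hR hτ hgen hH).1 hrigid).two_mul_card_le
      have h2 := Set.ncard_lt_card hlt
      omega
  tfae_finish
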